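/- Let $d\ge 3$ be an integer and let $R,\mu,\lambda,C_V,\kappa,P_0>0$ be fixed. Consider, for functions $P,U,\Theta:[0,\infty)\to\mathbb R$, the system of ordinary differential equations on $r>0$ $$ -\tfrac12 rP'+P'U+P\Big(U'+\tfrac{d-1}{r}U\Big)=0, $$ $$ -\tfrac12 PU-\tfrac12 r(PU)'+(PU^2)'+\tfrac{d-1}{r}PU^2+(PR\Theta)'=(2\mu+\lambda)\Big(U''+\tfrac{d-1}{r}U'-\tfrac{d-1}{r^2}U\Big), $$ $$ \begin{aligned} &-P\Big(\tfrac{U^2}{2}+C_V\Theta\Big)-\tfrac12 r\Big(P\Big(\tfrac{U^2}{2}+C_V\Theta\Big)\Big)'+\Big(UP\Big(\tfrac{U^2}{2}+C_V\Theta\Big)+UPR\Theta\Big)'\\ &\quad+\tfrac{d-1}{r}\Big(UP\Big(\tfrac{U^2}{2}+C_V\Theta\Big)+UPR\Theta\Big)-\kappa\Big(\Theta''+\tfrac{d-1}{r}\Theta'\Big)\\ &=2\mu\Big((U')^2+\tfrac{d-1}{r^2}U^2\Big)+\lambda\Big(U'+\tfrac{d-1}{r}U\Big)^2+(2\mu+\lambda)\Big(U''+\tfrac{d-1}{r}U'-\tfrac{d-1}{r^2}U\Big)U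 . \end{aligned} $$ A solution is a triple $(P,U,\Theta)\in C^1([0,\infty))^3$ such that $U$ and $\Theta$ are twice differentiable on $(0,\infty)$ and the three equations hold at every $r>0$. Then there are constants $\varepsilon>0$ and $C>0$, depending only on $d,R,\mu,\lambda,C_V,\kappa,P_0$, such that for every $\Theta_0\in(0,\varepsilon)$ there exists exactly one solution $(P,U,\Theta)$ satisfying $$ P(0)=P_0,\qquad \Theta(0)=\Theta_0,\qquad U(r)=O(r^2),\quad U'(r)=O(r),\quad \Theta'(r)=O(r)\qquad\text{as } r\to0^+ . $$ This solution satisfies, for all $r\ge0$, $$ |U(r)|\le \frac{C\Theta_0r^2}{(1+r)^3},\quad |U'(r)|\le \frac{C\Theta_0r}{(1+r)^3},\quad |\Theta(r)|\le \frac{C\Theta_0}{(1+r)^2},\quad |\Theta'(r)|\le \frac{C\Theta_0r}{(1+r)^2}. $$ Furthermore there exist $P_\infty>0$, $U_\infty<0$, $\Theta_\infty>0$ such that, for all $r\ge1$, $$ |P(r)-P_\infty|\le\frac{C}{r^2},\qquad \Big|U(r)-\frac{U_\infty}{r}\Big|\le\frac{C}{r^3},\qquad \Big|\Theta(r)-\frac{\Theta_\infty}{r^2}\Big|\le\frac{C}{r^4},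 $$ and $$ |U_\infty+2R\Theta_0|\le C\Theta_0^2,\qquad \Big|\Theta_\infty-\frac{2(d-2)\kappa}{C_VP_0}\Theta_0\Big|\le C\Theta_0^2 . $$ -/

import Mathlib

open Set Filter Topology Asymptotics

namespace SelfSimilarNS

/-- Conservation of mass for the radial self-similar profiles `P` (density) and `U` (velocity),
at the radius `r`, in space dimension `d`. -/
def MassEq (d : ℕ) (P U : ℝ → ℝ) (r : ℝ) : Prop :=
  -(1 / 2) * r * deriv P r + deriv P r * U r
    + P r * (deriv U r + ((d : ℝ) - 1) / r * U r) = 0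

/-- Conservation of momentum for the radial self-similar profiles. -/
def MomentumEq (d : ℕ) (R μ lam : ℝ) (P U Θ : ℝ → ℝ) (r : ℝ) : Prop :=
  -(1 / 2) * P r * U r
    - 1 / 2 * r * deriv (fun s => P s * U s) r
    + deriv (fun s => P s * U s ^ 2) r
    + ((d : ℝ) - 1) / r * P r * U r ^ 2
    + deriv (fun s => P s * R * Θ s) r
  = (2 * μ + lam) *
      (deriv (deriv U) r + ((d : ℝ) - 1) / r * deriv U r - ((d : ℝ) - 1) / r ^ 2 * U r)

/-- Conservation of energy for the radial self-similar profiles. -/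
def EnergyEq (d : ℕ) (R μ lam CV κ : ℝ) (P U Θ : ℝ → ℝ) (r : ℝ) : Prop :=
  -(P r * (U r ^ 2 / 2 + CV * Θ r))
    - 1 / 2 * r * deriv (fun s => P s * (U s ^ 2 / 2 + CV * Θ s)) r
    + deriv (fun s => U s * P s * (U s ^ 2 / 2 + CV * Θ s) + U s * P s * R * Θ s) r
    + ((d : ℝ) - 1) / r *
        (U r * P r * (U r ^ 2 / 2 + CV * Θ r) + U r * P r * R * Θ r)
    - κ * (deriv (deriv Θ) r + ((d : ℝ) - 1) / r * deriv Θ r)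
  = 2 * μ * (deriv U r ^ 2 + ((d : ℝ) - 1) / r ^ 2 * U r ^ 2)
    + lam * (deriv U r + ((d : ℝ) - 1) / r * U r) ^ 2
    + (2 * μ + lam) *
        (deriv (deriv U) r + ((d : ℝ) - 1) / r * deriv U r - ((d : ℝ) - 1) / r ^ 2 * U r) * U r

/-- `(P, U, Θ)` is a triple of `C¹([0, ∞))` functions which solves the self-similar system
classically on `(0, ∞)` (the second derivatives of `U` and `Θ`, which enter the equations, exist
there). Only the values on `[0, ∞)` matter. -/
structure IsProfile (d : ℕ) (R μ lam CV κ : ℝ) (P U Θ : ℝ → ℝ) : Prop where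
  contDiffOn_P : ContDiffOn ℝ 1 P (Ici 0)
  contDiffOn_U : ContDiffOn ℝ 1 U (Ici 0)
  contDiffOn_Θ : ContDiffOn ℝ 1 Θ (Ici 0)
  differentiableAt_deriv_U : ∀ r : ℝ, 0 < r → DifferentiableAt ℝ (deriv U) r
  differentiableAt_deriv_Θ : ∀ r : ℝ, 0 < r → DifferentiableAt ℝ (deriv Θ) r
  mass : ∀ r : ℝ, 0 < r → MassEq d P U r
  momentum : ∀ r : ℝ, 0 < r → MomentumEq d R μ lam P U Θ r
  energy : ∀ r : ℝ, 0 < r → EnergyEq d R μ lam CV κ P U Θ r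

/-- The conditions at the origin. -/
structure OriginCond (P₀ Θ₀ : ℝ) (P U Θ : ℝ → ℝ) : Prop where
  P_zero : P 0 = P₀
  Θ_zero : Θ 0 = Θ₀
  U_isBigO : U =O[𝓝[>] (0 : ℝ)] fun r => r ^ 2
  deriv_U_isBigO : deriv U =O[𝓝[>] (0 : ℝ)] fun r => r
  deriv_Θ_isBigO : deriv Θ =O[𝓝[>] (0 : ℝ)] fun r => r

end SelfSimilarNS

/-! Write `W` for the divergence `U' + (d-1)U/r` and `a = 2μ + λ`. Momentum and energy can be
integrated once: `a W - R (P Θ - P₀ Θ₀) + P (r/2 - U) U = I` and `κ (r Θ' + (d-2)(Θ - Θ₀)) + C_V P r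
(r/2 - U) Θ = J`, where `I'` and `J'` are quadratic in `(U, W, Θ)`. In the rescaled unknowns `U/r²`,
`(P/P₀ - 1)/r`, `Λ(Θ - Θ₀)/r`, `I/r²`, `J/r²` the system takes the form `(r^(k+1) z)' = r^k H(r,
z)`, componentwise in `k`. Its solutions bounded at the origin are the fixed points of an average
over `[0, r]`. For small `Θ₀` and a suitable `Λ` the linear part of `H` at `r = 0` has norm at most
`1/2`. After truncation to a box the rest of `H` carries a factor `r` and grows polynomially, so an
exponential weight makes the averaged map a contraction on the whole half line (`exists_eq_avg`,
`eqOn_of_eq_avg`).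

A priori bounds then show that the truncation is never active. Assume the decay estimates with a
constant `δ` such that `Θ₀ ≤ δ` and `δ² ≤ Θ₀`. Then `I` and `J` are `O(δ²) = O(Θ₀)`, while `Θ`, `r
U` and `W` solve relaxation equations `X' = -q X + g` whose rate `q` grows at least linearly in `r`.
The comparison `abs_mul_le_of_relaxation` returns the same estimates with `C Θ₀` in place of `δ`,
where `C` does not depend on `δ`. Taking `δ = K Θ₀` with `K` above all these `C` closes a continuity
argument, and the solution stays strictly inside the box (`exists_isMild_bounded`).

At infinity `P`, `I` and `J` converge at rate `r⁻²`. In the two integrated laws the terms `P r U /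
2` and `C_V P r² Θ / 2` then balance constants, which determines the limits of `r U` and `r² Θ`. The
quantities `I∞`, `J∞` and `Θ₀ (P∞ - P₀)` are `O(Θ₀²)`, whence the leading coefficients and, for
small `Θ₀`, their signs (`exists_asymptotics`).

For uniqueness, the rescaled unknowns of any competing profile tend to `0` at the origin
(`tendsto_hat`); the delicate point is that the slope of its density vanishes there. They satisfy
the same averaged equation while they lie in the box, so they coincide there with the constructed
solution. Since that one is strictly inside, the competitor never reaches the boundary
(`eqOn_of_isProfile`). -/

namespace SelfSimilarNS

/-! ### The averaged integral equation: contraction in an exponentially weighted norm. -/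

section Volterra

variable {ι : Type*}

/-- The componentwise average `∫₀¹ t ^ k h(t r) dt`, which for `r > 0` is the solution
of `(r ^ (k + 1) y)' = r ^ k h` that is bounded at the origin. -/
noncomputable def avg (k : ι → ℕ) (h : ℝ → ι → ℝ) (r : ℝ) (i : ι) : ℝ :=
  ∫ t in (0 : ℝ)..1, t ^ k i * h (t * r) i

/-- The weight of the norm in which the averaged problem is contractive. -/
noncomputable def expWeight (B : ℝ) (m : ℕ) (s : ℝ) : ℝ := Real.exp (B * (1 + s) ^ (m + 1))

theorem expWeight_pos (B : ℝ) (m : ℕ) (s : ℝ) : 0 < expWeight B m s := Real.exp_pos _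

theorem continuous_expWeight (B : ℝ) (m : ℕ) : Continuous (expWeight B m) := by
  unfold expWeight; fun_prop

theorem one_le_expWeight {B : ℝ} (hB : 0 ≤ B) (m : ℕ) {s : ℝ} (hs : 0 ≤ s) :
    1 ≤ expWeight B m s := by
  apply Real.one_le_exp; positivity

/-- The constant `1/2` is paid by monotonicity of the weight. The growing part is at most a quarter
of the exact derivative of the weight along `t ↦ t r`, which is what the rate `4 C` achieves. Hence
the contraction factor `1/2 + 1/4`. -/
theorem integral_expWeight_le {C : ℝ} (hC : 0 < C) (m : ℕ) {r : ℝ} (hr : 0 ≤ r) :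
    ∫ t in (0 : ℝ)..1, (1 / 2 + t * r * (C * (1 + t * r) ^ m)) * expWeight (4 * C) m (t * r)
      ≤ 3 / 4 * expWeight (4 * C) m r := by
  set E := expWeight (4 * C) m with hE
  have hEc : Continuous E := continuous_expWeight _ _
  have hder : ∀ t : ℝ, HasDerivAt (fun t => E (t * r))
      (E (t * r) * (4 * C * ((m + 1) * (1 + t * r) ^ m * r))) t := by
    intro t
    have h1 : HasDerivAt (fun t : ℝ => 1 + t * r) r t := by
      simpa using ((hasDerivAt_id t).mul_const r).const_add 1
    have h2 := ((h1.pow (m + 1)).const_mul (4 * C)).exp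
    simpa [hE, expWeight] using h2
  have hint : ∫ t in (0 : ℝ)..1, E (t * r) * (4 * C * ((m + 1) * (1 + t * r) ^ m * r))
      = E r - E 0 := by
    rw [intervalIntegral.integral_eq_sub_of_hasDerivAt (fun t _ => hder t)]
    · simp
    · apply Continuous.intervalIntegrable; fun_prop
  have hmono : ∀ t ∈ Icc (0 : ℝ) 1, E (t * r) ≤ E r := by
    intro t ht
    apply Real.exp_le_exp.2
    have : t * r ≤ r := mul_le_of_le_one_left hr ht.2
    have : 0 ≤ t * r := mul_nonneg ht.1 hr
    gcongr
  calc ∫ t in (0 : ℝ)..1, (1 / 2 + t * r * (C * (1 + t * r) ^ m)) * E (t * r)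
      ≤ ∫ t in (0 : ℝ)..1, (1 / 2 * E r
          + 1 / 4 * (E (t * r) * (4 * C * ((m + 1) * (1 + t * r) ^ m * r)))) := by
        apply intervalIntegral.integral_mono_on zero_le_one
        · apply Continuous.intervalIntegrable; fun_prop
        · apply Continuous.intervalIntegrable; fun_prop
        · intro t ht
          have h1 := hmono t ht
          have h2 : 0 < E (t * r) := expWeight_pos _ _ _
          have h3 : 0 ≤ t * r := mul_nonneg ht.1 hr
          have h4 : t * r * (C * (1 + t * r) ^ m) * E (t * r)
              ≤ ((m + 1) * r) * (C * (1 + t * r) ^ m) * E (t * r) := by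
            have : t * r ≤ (m + 1) * r := by
              have : (0 : ℝ) ≤ m := by positivity
              have := ht.2
              gcongr; linarith
            gcongr
          nlinarith
    _ = 1 / 2 * E r + 1 / 4 * (E r - E 0) := by
        rw [intervalIntegral.integral_add, intervalIntegral.integral_const_mul (1 / 4), hint]
        · simp
        · simp
        · apply Continuous.intervalIntegrable; fun_prop
    _ ≤ 3 / 4 * E r := by
        have : 0 < E 0 := expWeight_pos _ _ _
        linarith

/-- The factor `t ^ k` is at most `1`, so a pointwise bound by the Lipschitz constant times the
weight passes to the average with factor `3/4`. This serves uniqueness, self-mapping and contraction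
alike. -/
theorem abs_avg_le [Fintype ι] {C : ℝ} (hC : 0 < C) (m : ℕ) {r : ℝ} (hr : 0 ≤ r) {M : ℝ} (k : ι → ℕ)
    {h : ℝ → ι → ℝ}
    (hh : ∀ s ∈ Icc 0 r, ‖h s‖ ≤ (1 / 2 + s * (C * (1 + s) ^ m)) * (expWeight (4 * C) m s * M))
    (i : ι) : |avg k h r i| ≤ 3 / 4 * expWeight (4 * C) m r * M := by
  have hEc := continuous_expWeight (4 * C) m
  have hM : 0 ≤ M := by
    have h1 := (norm_nonneg _).trans (hh 0 ⟨le_rfl, hr⟩)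
    have h2 := expWeight_pos (4 * C) m 0
    have h3 : 0 ≤ (1 / 2 * expWeight (4 * C) m 0) * M := by linarith
    exact nonneg_of_mul_nonneg_right h3 (by positivity)
  calc |avg k h r i| ≤ ∫ t in (0 : ℝ)..1,
      ((1 / 2 + t * r * (C * (1 + t * r) ^ m)) * expWeight (4 * C) m (t * r)) * M := by
        rw [← Real.norm_eq_abs]
        apply intervalIntegral.norm_integral_le_of_norm_le zero_le_one
        · refine Eventually.of_forall fun t ht => ?_
          have h0 : 0 ≤ t * r := mul_nonneg ht.1.le hr
          have h1 := hh (t * r) ⟨h0, mul_le_of_le_one_left hr ht.2⟩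
          have h2 := norm_le_pi_norm (h (t * r)) i
          have h3 : t ^ k i ≤ 1 := pow_le_one₀ ht.1.le ht.2
          rw [norm_mul, Real.norm_of_nonneg (pow_nonneg ht.1.le _)]
          calc t ^ k i * ‖h (t * r) i‖ ≤ 1 * ‖h (t * r) i‖ := by gcongr
            _ ≤ _ := by linarith
        · apply Continuous.intervalIntegrable; fun_prop
    _ ≤ _ := by
        rw [intervalIntegral.integral_mul_const]
        exact mul_le_mul_of_nonneg_right (integral_expWeight_le hC m hr) hM

theorem intervalIntegrable_avg (k : ι → ℕ) {h : ℝ → ι → ℝ} {r : ℝ} (hr : 0 ≤ r)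
    (hc : ContinuousOn h (Icc 0 r)) (i : ι) :
    IntervalIntegrable (fun t => t ^ k i * h (t * r) i) MeasureTheory.volume 0 1 := by
  apply ContinuousOn.intervalIntegrable
  rw [uIcc_of_le zero_le_one]
  refine ContinuousOn.mul (by fun_prop) ?_
  have : ContinuousOn (fun t => h (t * r)) (Icc 0 1) :=
    hc.comp (by fun_prop) fun t ht => ⟨mul_nonneg ht.1 hr, mul_le_of_le_one_left hr ht.2⟩
  exact (continuous_apply i).comp_continuousOn this

theorem avg_sub (k : ι → ℕ) {h h' : ℝ → ι → ℝ} {r : ℝ} (hr : 0 ≤ r)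
    (hc : ContinuousOn h (Icc 0 r)) (hc' : ContinuousOn h' (Icc 0 r)) (i : ι) :
    avg k h r i - avg k h' r i = avg k (fun s => h s - h' s) r i := by
  unfold avg
  rw [← intervalIntegral.integral_sub (intervalIntegrable_avg k hr hc i)
    (intervalIntegrable_avg k hr hc' i)]
  simp [mul_sub]

theorem continuous_avg (k : ι → ℕ) {h : ℝ → ι → ℝ} (hc : Continuous h) :
    Continuous (avg k h) := by
  refine continuous_pi fun i => ?_
  unfold avg
  apply intervalIntegral.continuous_parametric_intervalIntegral_of_continuous'
  fun_prop

/-- Uniqueness for the averaged integral equation on a bounded interval. -/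
theorem eqOn_of_eq_avg [Fintype ι] {k : ι → ℕ} {H : ℝ → (ι → ℝ) → ι → ℝ} (hH : Continuous fun q : ℝ × (ι → ℝ) => H q.1 q.2)
    {C : ℝ} (hC : 0 < C) {m : ℕ}
    (hlip : ∀ s, 0 ≤ s → ∀ z z', ‖H s z - H s z'‖ ≤ (1 / 2 + s * (C * (1 + s) ^ m)) * ‖z - z'‖)
    {τ : ℝ} (hτ : 0 ≤ τ) {z z' : ℝ → ι → ℝ} (hz : ContinuousOn z (Icc 0 τ))
    (hz' : ContinuousOn z' (Icc 0 τ))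
    (he : ∀ r ∈ Icc 0 τ, z r = avg k (fun s => H s (z s)) r)
    (he' : ∀ r ∈ Icc 0 τ, z' r = avg k (fun s => H s (z' s)) r) : EqOn z z' (Icc 0 τ) := by
  set E := expWeight (4 * C) m
  have hE : Continuous E := continuous_expWeight _ _
  have hEpos : ∀ s, 0 < E s := expWeight_pos _ _
  -- The weighted difference attains its maximum `M`; the equation at the maximum point gives `M ≤
  -- 3/4 M`.
  obtain ⟨r₀, hr₀, hmax⟩ := isCompact_Icc.exists_isMaxOn (nonempty_Icc.2 hτ)
    (f := fun s => ‖z s - z' s‖ / E s)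
    ((hz.sub hz').norm.div hE.continuousOn fun s _ => (hEpos s).ne')
  set M := ‖z r₀ - z' r₀‖ / E r₀ with hM
  have hbd : ∀ s ∈ Icc 0 τ, ‖z s - z' s‖ ≤ E s * M := by
    intro s hs
    have : ‖z s - z' s‖ / E s ≤ M := hmax hs
    rw [div_le_iff₀ (hEpos s)] at this
    linarith
  have hcomp : ∀ {y : ℝ → ι → ℝ}, ContinuousOn y (Icc 0 τ) →
      ContinuousOn (fun s => H s (y s)) (Icc 0 r₀) := by
    intro y hy
    exact hH.comp_continuousOn
      (continuousOn_id.prodMk (hy.mono (Icc_subset_Icc_right hr₀.2)))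
  have h1 : ‖z r₀ - z' r₀‖ ≤ 3 / 4 * E r₀ * M := by
    have hM0 : 0 ≤ M := div_nonneg (norm_nonneg _) (hEpos _).le
    have := hEpos r₀
    refine (pi_norm_le_iff_of_nonneg (by positivity)).2 fun i => ?_
    rw [Pi.sub_apply, he r₀ hr₀, he' r₀ hr₀, avg_sub k hr₀.1 (hcomp hz) (hcomp hz')]
    apply abs_avg_le hC m hr₀.1
    intro s hs
    refine (hlip s hs.1 _ _).trans ?_
    have := hbd s ⟨hs.1, hs.2.trans hr₀.2⟩
    have := hs.1
    gcongr
  have h2 : M ≤ 3 / 4 * M := by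
    rw [hM, div_le_iff₀ (hEpos _), ← hM]; linarith
  intro s hs
  have h3 := hbd s hs
  have h4 : E s * M ≤ 0 := mul_nonpos_of_nonneg_of_nonpos (hEpos s).le (by linarith)
  exact sub_eq_zero.1 (norm_le_zero_iff.1 (h3.trans h4))

/-- Existence for the averaged integral equation on the half line. -/
theorem exists_eq_avg [Fintype ι] {k : ι → ℕ} {H : ℝ → (ι → ℝ) → ι → ℝ} (hH : Continuous fun q : ℝ × (ι → ℝ) => H q.1 q.2)
    {C : ℝ} (hC : 0 < C) {m : ℕ}
    (hlip : ∀ s, 0 ≤ s → ∀ z z', ‖H s z - H s z'‖ ≤ (1 / 2 + s * (C * (1 + s) ^ m)) * ‖z - z'‖)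
    (hzero : ∀ s, 0 ≤ s → ‖H s 0‖ ≤ s * (C * (1 + s) ^ m)) :
    ∃ z : ℝ → ι → ℝ, Continuous z ∧ ∀ r, 0 ≤ r → z r = avg k (fun s => H s (z s)) r := by
  set E := expWeight (4 * C) m with hEdef
  have hE : Continuous E := continuous_expWeight _ _
  have hEpos : ∀ s, 0 < E s := expWeight_pos _ _
  -- The fixed point is sought for `f = z / E`. Even extension through `|r|` turns the problem on
  -- the half line into one for bounded continuous functions on `ℝ`.
  let F : (BoundedContinuousFunction ℝ (ι → ℝ)) → ℝ → ι → ℝ := fun f s => H s (E s • f s)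
  have hF : ∀ f, Continuous (F f) := fun f =>
    hH.comp (continuous_id.prodMk (hE.smul f.continuous))
  let S : (BoundedContinuousFunction ℝ (ι → ℝ)) → ℝ → ι → ℝ :=
    fun f r => (E |r|)⁻¹ • avg k (F f) |r|
  have hS : ∀ f, Continuous (S f) := fun f =>
    ((hE.comp continuous_abs).inv₀ fun r => (hEpos _).ne').smul
      ((continuous_avg k (hF f)).comp continuous_abs)
  have hbd : ∀ f r, ‖S f r‖ ≤ 3 / 4 * (1 + ‖f‖) := by
    intro f r
    refine (pi_norm_le_iff_of_nonneg (by positivity)).2 fun i => ?_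
    have h1 : |avg k (F f) |r| i| ≤ 3 / 4 * E |r| * (1 + ‖f‖) := by
      apply abs_avg_le hC m (abs_nonneg r)
      intro s hs
      have hs0 := hs.1
      have h1 := hlip s hs0 (E s • f s) 0
      have h2 := hzero s hs0
      have h3 : ‖F f s‖ ≤ ‖H s (E s • f s) - H s 0‖ + ‖H s 0‖ := by
        simpa [F] using norm_add_le (H s (E s • f s) - H s 0) (H s 0)
      have h4 : ‖E s • f s - 0‖ ≤ E s * ‖f‖ := by
        rw [sub_zero, norm_smul, Real.norm_of_nonneg (hEpos s).le]
        have := hEpos s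
        gcongr
        exact f.norm_coe_le_norm s
      have h5 : 1 ≤ E s := one_le_expWeight (by positivity) m hs0
      have h6 : 0 ≤ s * (C * (1 + s) ^ m) := by positivity
      have h7 : (1 / 2 + s * (C * (1 + s) ^ m)) * ‖E s • f s - 0‖
        ≤ (1 / 2 + s * (C * (1 + s) ^ m)) * (E s * ‖f‖) := by gcongr
      have h8 : (1 / 2 + s * (C * (1 + s) ^ m)) * 1 ≤ (1 / 2 + s * (C * (1 + s) ^ m)) * E s := by
        gcongr
      change ‖F f s‖ ≤ (1 / 2 + s * (C * (1 + s) ^ m)) * (E s * (1 + ‖f‖))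
      linarith
    have h2 := hEpos |r|
    simp only [S, Pi.smul_apply, smul_eq_mul, norm_mul, norm_inv, Real.norm_eq_abs, abs_of_pos h2]
    rw [inv_mul_le_iff₀ h2]
    linarith
  let T : (BoundedContinuousFunction ℝ (ι → ℝ)) → (BoundedContinuousFunction ℝ (ι → ℝ)) :=
    fun f => BoundedContinuousFunction.ofNormedAddCommGroup (S f) (hS f) _ (hbd f)
  have hT : ContractingWith (3 / 4) T := by
    refine ⟨by
      rw [← NNReal.coe_lt_coe]; norm_num, LipschitzWith.of_dist_le_mul fun f g => ?_⟩
    have h34 : ((3 / 4 : NNReal) : ℝ) = 3 / 4 := by norm_num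
    rw [h34]
    refine (BoundedContinuousFunction.dist_le (by positivity)).2 fun r => ?_
    rw [dist_eq_norm]
    refine (pi_norm_le_iff_of_nonneg (by positivity)).2 fun i => ?_
    have h1 : |avg k (F f) |r| i - avg k (F g) |r| i| ≤ 3 / 4 * E |r| * dist f g := by
      rw [avg_sub k (abs_nonneg r) (hF f).continuousOn (hF g).continuousOn]
      apply abs_avg_le hC m (abs_nonneg r)
      intro s hs
      refine (hlip s hs.1 _ _).trans ?_
      have := hs.1
      rw [← smul_sub, norm_smul, Real.norm_of_nonneg (hEpos s).le]
      have := hEpos s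
      have : ‖f s - g s‖ ≤ dist f g := by
        rw [← dist_eq_norm]; exact BoundedContinuousFunction.dist_coe_le_dist s
      gcongr
    have h2 := hEpos |r|
    have h3 : (T f r - T g r) i = (E |r|)⁻¹ * (avg k (F f) |r| i - avg k (F g) |r| i) := by
      change (S f r - S g r) i = _
      simp [S, mul_sub]
    rw [h3, norm_mul, norm_inv, Real.norm_eq_abs, Real.norm_eq_abs, abs_of_pos h2,
      inv_mul_le_iff₀ h2]
    linarith
  obtain ⟨f, hf, -⟩ := hT.exists_fixedPoint 0 (edist_ne_top _ _)
  refine ⟨fun r => E r • f r, hE.smul f.continuous, fun r hr => ?_⟩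
  have h1 : f r = S f r := by
    conv_lhs => rw [← hf.eq]
    rfl
  change E r • f r = _
  rw [h1]
  simp only [S, abs_of_nonneg hr, smul_smul, mul_inv_cancel₀ (hEpos r).ne', one_smul]
  rfl

end Volterra

end SelfSimilarNS

namespace SelfSimilarNS

/-! ### Averages as the regular solutions of singular differential equations. -/

section AvgDeriv

variable {ι : Type*}

/-- Substitution `s = t r`; this links the average, which makes sense at `r = 0`, with the
differential equation away from it. -/
theorem pow_mul_avg (k : ι → ℕ) (h : ℝ → ι → ℝ) (r : ℝ) (i : ι) :
    r ^ (k i + 1) * avg k h r i = ∫ s in (0 : ℝ)..r, s ^ k i * h s i := by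
  have h1 := intervalIntegral.mul_integral_comp_mul_right (a := 0) (b := 1) (c := r)
    (f := fun s => s ^ k i * h s i)
  simp only [zero_mul, one_mul] at h1
  rw [← h1, avg, pow_succ', mul_assoc, ← intervalIntegral.integral_const_mul (r ^ k i)]
  congr 1
  refine intervalIntegral.integral_congr fun t _ => ?_
  simp only [mul_pow]
  ring

theorem hasDerivAt_of_eq_avg {k : ι → ℕ} {y h : ℝ → ι → ℝ} (hh : Continuous h)
    (hy : ∀ r, 0 ≤ r → y r = avg k h r) (i : ι) {r : ℝ} (hr : 0 < r) :
    HasDerivAt (fun s => s ^ (k i + 1) * y s i) (r ^ k i * h r i) r := by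
  have hc : Continuous fun s => s ^ k i * h s i :=
    (continuous_pow _).mul ((continuous_apply i).comp hh)
  refine (hc.integral_hasStrictDerivAt 0 r).hasDerivAt.congr_of_eventuallyEq ?_
  filter_upwards [lt_mem_nhds hr] with s hs
  rw [hy s hs.le, pow_mul_avg]

/-- Continuity at `0` kills the boundary term `s ^ (k+1) y` there. At `r = 0` itself the average
reduces to a multiple of `h 0`, hence the two vanishing hypotheses. -/
theorem eq_avg_of_hasDerivAt {k : ι → ℕ} {y h : ℝ → ι → ℝ} {τ : ℝ}
    (hyc : ContinuousOn y (Icc 0 τ)) (hhc : ContinuousOn h (Icc 0 τ))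
    (hy : ∀ r ∈ Ioo 0 τ, ∀ i, HasDerivAt (fun s => s ^ (k i + 1) * y s i) (r ^ k i * h r i) r)
    (h0 : y 0 = 0) (h0' : h 0 = 0) {r : ℝ} (hr : r ∈ Icc 0 τ) : y r = avg k h r := by
  funext i
  rcases hr.1.eq_or_lt with rfl | hr0
  · simp [avg, h0, h0']
  have hsub : Icc 0 r ⊆ Icc 0 τ := Icc_subset_Icc_right hr.2
  have h1 := pow_mul_avg k h r i
  rw [intervalIntegral.integral_eq_sub_of_hasDeriv_right_of_le hr0.le
    (f := fun s => s ^ (k i + 1) * y s i)] at h1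
  · have : r ^ (k i + 1) ≠ 0 := (pow_pos hr0 _).ne'
    simp only [ne_eq, Nat.add_eq_zero_iff, one_ne_zero, and_false, not_false_eq_true, zero_pow,
      zero_mul, sub_zero] at h1
    exact (mul_left_cancel₀ this h1).symm
  · exact (continuous_pow _).continuousOn.mul
      ((continuous_apply i).comp_continuousOn (hyc.mono hsub))
  · intro s hs
    exact (hy s ⟨hs.1, hs.2.trans_le hr.2⟩ i).hasDerivWithinAt
  · apply ContinuousOn.intervalIntegrable
    rw [uIcc_of_le hr0.le]
    exact (continuous_pow _).continuousOn.mul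
      ((continuous_apply i).comp_continuousOn (hhc.mono hsub))

end AvgDeriv

/-! ### Parameters of the system. -/

/-- The parameters of the system, in dimension `n + 3`. -/
structure Params where
  n : ℕ
  R : ℝ
  μ : ℝ
  lam : ℝ
  CV : ℝ
  κ : ℝ
  P₀ : ℝ
  R_pos : 0 < R
  μ_pos : 0 < μ
  lam_pos : 0 < lam
  CV_pos : 0 < CV
  κ_pos : 0 < κ
  P₀_pos : 0 < P₀

namespace Params

variable (p : Params)

/-- The coefficient `d - 1` of the radial divergence. -/
def D : ℝ := (p.n : ℝ) + 2

/-- The total viscosity. -/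
def a : ℝ := 2 * p.μ + p.lam

/-- The scale of the temperature component, which makes the system contractive. -/
noncomputable def Λ : ℝ := 8 * p.R * p.P₀ / p.a

theorem a_pos : 0 < p.a := by
  have := p.μ_pos; have := p.lam_pos; unfold a; positivity

theorem D_pos : 0 < p.D := by unfold D; positivity

theorem Λ_pos : 0 < p.Λ := by
  have := p.R_pos; have := p.P₀_pos; have := p.a_pos; unfold Λ; positivity

end Params

/-! ### Truncation to a box, and a calculus of polynomially Lipschitz functions. -/

/-- The half-width of the box to which the rescaled unknowns are truncated. -/
noncomputable def boxWidth (s : ℝ) : ℝ := 1 / (4 * (1 + |s|))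

theorem boxWidth_pos (s : ℝ) : 0 < boxWidth s := by unfold boxWidth; positivity

theorem continuous_boxWidth : Continuous boxWidth := by
  unfold boxWidth
  refine continuous_const.div (by fun_prop) fun s => by positivity

theorem boxWidth_le (s : ℝ) : boxWidth s ≤ 1 / 4 := by
  unfold boxWidth
  have := abs_nonneg s
  apply one_div_le_one_div_of_le <;> linarith

theorem mul_boxWidth_le {s : ℝ} (hs : 0 ≤ s) : s * boxWidth s ≤ 1 / 4 := by
  unfold boxWidth
  rw [abs_of_nonneg hs, mul_one_div, div_le_div_iff₀ (by positivity) (by norm_num)]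
  linarith

/-- Componentwise truncation to the box. -/
noncomputable def clamp (s : ℝ) (z : Fin 5 → ℝ) : Fin 5 → ℝ :=
  fun i => max (-boxWidth s) (min (boxWidth s) (z i))

/-- The box. -/
def InBox (s : ℝ) (z : Fin 5 → ℝ) : Prop := ∀ i, |z i| ≤ boxWidth s

theorem inBox_clamp (s : ℝ) (z : Fin 5 → ℝ) : InBox s (clamp s z) := by
  intro i
  have := boxWidth_pos s
  rw [abs_le]
  exact ⟨le_max_left _ _, max_le (by linarith) (min_le_left _ _)⟩

theorem clamp_eq {s : ℝ} {z : Fin 5 → ℝ} (h : InBox s z) : clamp s z = z := by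
  funext i
  have := abs_le.1 (h i)
  simp [clamp, this.1, this.2]

theorem norm_clamp_sub_le (s : ℝ) (z z' : Fin 5 → ℝ) :
    ‖clamp s z - clamp s z'‖ ≤ ‖z - z'‖ := by
  refine (pi_norm_le_iff_of_nonneg (norm_nonneg _)).2 fun i => ?_
  refine le_trans ?_ (norm_le_pi_norm (z - z') i)
  simp only [Pi.sub_apply, clamp, Real.norm_eq_abs]
  refine (abs_max_sub_max_le_max _ _ _ _).trans ?_
  rw [sub_self, abs_zero, max_eq_right (abs_nonneg _)]
  refine (abs_min_sub_min_le_max _ _ _ _).trans ?_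
  rw [sub_self, abs_zero, max_eq_right (abs_nonneg _)]

theorem continuous_clamp : Continuous fun q : ℝ × (Fin 5 → ℝ) => clamp q.1 q.2 := by
  refine continuous_pi fun i => ?_
  have h := continuous_boxWidth.comp (continuous_fst : Continuous fun q : ℝ × (Fin 5 → ℝ) => q.1)
  exact h.neg.max (h.min ((continuous_apply i).comp continuous_snd))

/-- Functions on the box which grow, together with their Lipschitz constants, at most
polynomially in the radius. -/
def PolyLip (f : ℝ → (Fin 5 → ℝ) → ℝ) : Prop :=
  (Continuous fun q : ℝ × (Fin 5 → ℝ) => f q.1 (clamp q.1 q.2)) ∧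
  ∃ C > 0, ∃ m : ℕ, ∀ s, 0 ≤ s → ∀ z z', InBox s z → InBox s z' →
    |f s z| ≤ C * (1 + s) ^ m ∧ |f s z - f s z'| ≤ C * (1 + s) ^ m * ‖z - z'‖

namespace PolyLip

variable {f g : ℝ → (Fin 5 → ℝ) → ℝ}

theorem const (c : ℝ) : PolyLip fun _ _ => c := by
  refine ⟨continuous_const, |c| + 1, by positivity, 0, fun s hs z z' _ _ => ⟨by simp, ?_⟩⟩
  simp only [sub_self, abs_zero]
  positivity

theorem radius : PolyLip fun s _ => s := by
  refine ⟨continuous_fst, 1, by positivity, 1, fun s hs z z' _ _ => ⟨?_, ?_⟩⟩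
  · rw [abs_of_nonneg hs]; linarith
  · simp only [sub_self, abs_zero]; positivity

theorem coord (i : Fin 5) : PolyLip fun _ z => z i := by
  refine ⟨(continuous_apply i).comp continuous_clamp, 1, by positivity, 0,
    fun s hs z z' h _ => ⟨?_, ?_⟩⟩
  · have := h i; have := boxWidth_le s
    simp only [pow_zero]; linarith
  · simpa using norm_le_pi_norm (z - z') i

theorem add (hf : PolyLip f) (hg : PolyLip g) : PolyLip fun s z => f s z + g s z := by
  obtain ⟨hfc, C, hC, m, hf⟩ := hf
  obtain ⟨hgc, C', hC', m', hg⟩ := hg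
  refine ⟨hfc.add hgc, C + C', by positivity, m + m', fun s hs z z' h h' => ?_⟩
  obtain ⟨h1, h2⟩ := hf s hs z z' h h'
  obtain ⟨h3, h4⟩ := hg s hs z z' h h'
  have h5 : (1 : ℝ) ≤ 1 + s := by linarith
  have h6 : (1 + s) ^ m ≤ (1 + s) ^ (m + m') := pow_le_pow_right₀ h5 (by omega)
  have h7 : (1 + s) ^ m' ≤ (1 + s) ^ (m + m') := pow_le_pow_right₀ h5 (by omega)
  constructor
  · calc |f s z + g s z| ≤ |f s z| + |g s z| := abs_add_le _ _
      _ ≤ C * (1 + s) ^ m + C' * (1 + s) ^ m' := add_le_add h1 h3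
      _ ≤ C * (1 + s) ^ (m + m') + C' * (1 + s) ^ (m + m') := by gcongr
      _ = _ := by ring
  · calc |f s z + g s z - (f s z' + g s z')| = |(f s z - f s z') + (g s z - g s z')| := by ring_nf
      _ ≤ |f s z - f s z'| + |g s z - g s z'| := abs_add_le _ _
      _ ≤ C * (1 + s) ^ m * ‖z - z'‖ + C' * (1 + s) ^ m' * ‖z - z'‖ := add_le_add h2 h4
      _ ≤ C * (1 + s) ^ (m + m') * ‖z - z'‖ + C' * (1 + s) ^ (m + m') * ‖z - z'‖ := by gcongr
      _ = _ := by ring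

theorem mul (hf : PolyLip f) (hg : PolyLip g) : PolyLip fun s z => f s z * g s z := by
  obtain ⟨hfc, C, hC, m, hf⟩ := hf
  obtain ⟨hgc, C', hC', m', hg⟩ := hg
  refine ⟨hfc.mul hgc, 2 * C * C', by positivity, m + m', fun s hs z z' h h' => ?_⟩
  obtain ⟨h1, h2⟩ := hf s hs z z' h h'
  obtain ⟨h3, h4⟩ := hg s hs z z' h h'
  have h5 := (hf s hs z' z h' h).1
  constructor
  · calc |f s z * g s z| = |f s z| * |g s z| := abs_mul _ _
      _ ≤ (C * (1 + s) ^ m) * (C' * (1 + s) ^ m') := by gcongr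
      _ ≤ 2 * ((C * (1 + s) ^ m) * (C' * (1 + s) ^ m')) := by
        have : 0 ≤ (C * (1 + s) ^ m) * (C' * (1 + s) ^ m') := by positivity
        linarith
      _ = _ := by ring
  · calc |f s z * g s z - f s z' * g s z'|
        = |(f s z - f s z') * g s z + f s z' * (g s z - g s z')| := by ring_nf
      _ ≤ |f s z - f s z'| * |g s z| + |f s z'| * |g s z - g s z'| := by
        rw [← abs_mul, ← abs_mul]; exact abs_add_le _ _
      _ ≤ (C * (1 + s) ^ m * ‖z - z'‖) * (C' * (1 + s) ^ m')
          + (C * (1 + s) ^ m) * (C' * (1 + s) ^ m' * ‖z - z'‖) := by gcongr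
      _ = _ := by ring

theorem neg (hf : PolyLip f) : PolyLip fun s z => -f s z := by
  simpa using (const (-1)).mul hf

theorem sub (hf : PolyLip f) (hg : PolyLip g) : PolyLip fun s z => f s z - g s z := by
  simpa [sub_eq_add_neg] using hf.add hg.neg

theorem pow (hf : PolyLip f) : ∀ j : ℕ, PolyLip fun s z => f s z ^ j
  | 0 => by simpa using const 1
  | j + 1 => by simpa [pow_succ] using (pow hf j).mul hf

theorem div_const (hf : PolyLip f) (c : ℝ) : PolyLip fun s z => f s z / c := by
  simpa [div_eq_mul_inv] using hf.mul (const c⁻¹)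

/-- Used only for the transport gap `1/2 - s z₀`, which the truncation keeps above `1/4`. -/
theorem inv (hf : PolyLip f) (h4 : ∀ s z, InBox s z → 1 / 4 ≤ f s z) :
    PolyLip fun s z => (f s z)⁻¹ := by
  obtain ⟨hfc, C, hC, m, hf⟩ := hf
  have hpos : ∀ s z, InBox s z → 0 < f s z := fun s z h => by linarith [h4 s z h]
  have hle : ∀ s z, InBox s z → (f s z)⁻¹ ≤ 4 := fun s z h => by
    rw [inv_le_comm₀ (hpos s z h) (by norm_num)]; linarith [h4 s z h]
  refine ⟨hfc.inv₀ fun q => (hpos _ _ (inBox_clamp _ _)).ne', 4 + 16 * C, by positivity, m,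
    fun s hs z z' h h' => ?_⟩
  have h5 : (1 : ℝ) ≤ (1 + s) ^ m := one_le_pow₀ (by linarith)
  have h6 := hpos s z h
  have h7 := hpos s z' h'
  constructor
  · rw [abs_of_pos (inv_pos.2 h6)]
    have := hle s z h
    nlinarith
  · have e : (f s z)⁻¹ - (f s z')⁻¹ = (f s z)⁻¹ * (f s z')⁻¹ * -(f s z - f s z') := by
      field_simp; ring
    rw [e, abs_mul, abs_neg, abs_of_pos (by positivity)]
    have h8 := (hf s hs z z' h h').2
    calc (f s z)⁻¹ * (f s z')⁻¹ * |f s z - f s z'|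
        ≤ 4 * 4 * (C * (1 + s) ^ m * ‖z - z'‖) := by
          gcongr
          · exact hle s z h
          · exact hle s z' h'
      _ = 16 * C * (1 + s) ^ m * ‖z - z'‖ := by ring
      _ ≤ _ := by gcongr; linarith

end PolyLip

theorem InBox.abs_mul_le {s : ℝ} {z : Fin 5 → ℝ} (h : InBox s z) (i : Fin 5) :
    |s * z i| ≤ 1 / 4 := by
  rw [abs_mul]
  have h1 := h i
  calc |s| * |z i| ≤ |s| * boxWidth s := by gcongr
    _ = |s| * boxWidth |s| := by simp [boxWidth]
    _ ≤ 1 / 4 := mul_boxWidth_le (abs_nonneg s)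

/-! ### The vector field in the rescaled unknowns. -/

namespace Params

variable (p : Params) (Θ₀ : ℝ)

/-- The density in terms of the rescaled unknowns. -/
def dens (s : ℝ) (z : Fin 5 → ℝ) : ℝ := p.P₀ * (1 + s * z 1)

/-- The temperature in terms of the rescaled unknowns. -/
noncomputable def temp (s : ℝ) (z : Fin 5 → ℝ) : ℝ := Θ₀ + s * (z 2 / p.Λ)

/-- The part of the rescaled divergence which does not vanish at the origin. -/
noncomputable def divLin (z : Fin 5 → ℝ) : ℝ :=
  p.R * p.P₀ * (Θ₀ * z 1 + z 2 / p.Λ) / p.a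

/-- The rescaled divergence `(U' + (d - 1) U / s) / s` in terms of the rescaled unknowns. -/
noncomputable def divHat (s : ℝ) (z : Fin 5 → ℝ) : ℝ :=
  (p.R * p.P₀ * (p.temp Θ₀ s z * z 1 + z 2 / p.Λ)
    - p.dens s z * s ^ 2 * (1 / 2 - s * z 0) * z 0 + s * z 3) / p.a

/-- The right-hand side of the system for the rescaled unknowns. -/
noncomputable def field (s : ℝ) (z : Fin 5 → ℝ) : Fin 5 → ℝ :=
  ![p.divHat Θ₀ s z,
    (1 + s * z 1) * p.divHat Θ₀ s z * (1 / 2 - s * z 0)⁻¹,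
    p.Λ * (s * z 4 - p.CV * p.dens s z * s * (1 / 2 - s * z 0) * p.temp Θ₀ s z) / p.κ,
    p.D * p.dens s z * s ^ 2 * z 0 ^ 2,
    p.CV * (p.n + 1) * p.dens s z * (s * z 0) * p.temp Θ₀ s z
      + p.R * p.dens s z * p.temp Θ₀ s z * (s * p.divHat Θ₀ s z)
      - s ^ 2 * (2 * p.μ * ((p.divHat Θ₀ s z - p.D * z 0) ^ 2 + p.D * z 0 ^ 2)
        + p.lam * p.divHat Θ₀ s z ^ 2)]

/-- The remainder of the divergence. -/
noncomputable def divRem (s : ℝ) (z : Fin 5 → ℝ) : ℝ :=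
  (p.R * p.P₀ * (z 2 / p.Λ * z 1) - p.dens s z * s * (1 / 2 - s * z 0) * z 0 + z 3) / p.a

/-- The remainder of the right-hand side. -/
noncomputable def fieldRem (s : ℝ) (z : Fin 5 → ℝ) : Fin 5 → ℝ :=
  ![p.divRem s z,
    (z 1 + 2 * z 0) * (1 / 2 - s * z 0)⁻¹ * p.divLin Θ₀ z
      + (1 + s * z 1) * (1 / 2 - s * z 0)⁻¹ * p.divRem s z,
    p.Λ * (z 4 - p.CV * p.dens s z * (1 / 2 - s * z 0) * p.temp Θ₀ s z) / p.κ,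
    p.D * p.dens s z * s * z 0 ^ 2,
    p.CV * (p.n + 1) * p.dens s z * z 0 * p.temp Θ₀ s z
      + p.R * p.dens s z * p.temp Θ₀ s z * p.divHat Θ₀ s z
      - s * (2 * p.μ * ((p.divHat Θ₀ s z - p.D * z 0) ^ 2 + p.D * z 0 ^ 2)
        + p.lam * p.divHat Θ₀ s z ^ 2)]

/-- The linear part of the right-hand side at the origin. -/
noncomputable def fieldLin (z : Fin 5 → ℝ) : Fin 5 → ℝ :=
  ![p.divLin Θ₀ z, 2 * p.divLin Θ₀ z, 0, 0, 0]

/-- The truncated right-hand side. -/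
noncomputable def cutField (s : ℝ) (z : Fin 5 → ℝ) : Fin 5 → ℝ := p.field Θ₀ s (clamp s z)

/-- The exponents of the system for the rescaled unknowns. -/
def expo : Fin 5 → ℕ := ![p.n + 3, 0, p.n + 1, 1, 1]

theorem divHat_eq (s : ℝ) (z : Fin 5 → ℝ) :
    p.divHat Θ₀ s z = p.divLin Θ₀ z + s * p.divRem s z := by
  simp only [divHat, divLin, divRem, temp]
  ring

/-- Every term outside the linear part contains a factor `s`. For the density component this rests
on `(1 + s z₁) - 2 (1/2 - s z₀) = s (z₁ + 2 z₀)`. -/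
theorem field_eq {s : ℝ} {z : Fin 5 → ℝ} (h : InBox s z) :
    p.field Θ₀ s z = p.fieldLin Θ₀ z + s • p.fieldRem Θ₀ s z := by
  have h1 := abs_le.1 (h.abs_mul_le 0)
  have h2 : (1 / 2 - s * z 0) * (1 / 2 - s * z 0)⁻¹ = 1 :=
    mul_inv_cancel₀ (by linarith)
  funext i
  fin_cases i
  · simp [field, fieldLin, fieldRem, divHat_eq]
  · simp only [field, fieldLin, fieldRem, divHat_eq, Fin.mk_one, Matrix.cons_val_one,
      Matrix.cons_val_zero, Pi.add_apply, Pi.smul_apply, smul_eq_mul]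
    linear_combination (2 * p.divLin Θ₀ z) * h2
  · simp [field, fieldLin, fieldRem]; ring
  · simp [field, fieldLin, fieldRem]; ring
  · simp [field, fieldLin, fieldRem]; ring

theorem polyLip_dens : PolyLip p.dens :=
  (PolyLip.const _).mul ((PolyLip.const 1).add (PolyLip.radius.mul (PolyLip.coord 1)))

theorem polyLip_temp : PolyLip (p.temp Θ₀) :=
  (PolyLip.const _).add (PolyLip.radius.mul ((PolyLip.coord 2).div_const _))

theorem polyLip_gap : PolyLip fun s z => 1 / 2 - s * z 0 :=
  (PolyLip.const _).sub (PolyLip.radius.mul (PolyLip.coord 0))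

theorem polyLip_gap_inv : PolyLip fun s z => (1 / 2 - s * z 0)⁻¹ :=
  polyLip_gap.inv fun s z h => by linarith [(abs_le.1 (h.abs_mul_le 0)).2]

theorem polyLip_divLin : PolyLip fun _ z => p.divLin Θ₀ z :=
  ((PolyLip.const _).mul (((PolyLip.const _).mul (PolyLip.coord 1)).add
    ((PolyLip.coord 2).div_const _))).div_const _

theorem polyLip_divRem : PolyLip p.divRem :=
  ((((PolyLip.const _).mul (((PolyLip.coord 2).div_const _).mul (PolyLip.coord 1))).sub
    (((p.polyLip_dens.mul PolyLip.radius).mul polyLip_gap).mul (PolyLip.coord 0))).add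
      (PolyLip.coord 3)).div_const _

theorem polyLip_divHat : PolyLip (p.divHat Θ₀) := by
  have h := (p.polyLip_divLin Θ₀).add (PolyLip.radius.mul p.polyLip_divRem)
  have e : (fun s z => p.divLin Θ₀ z + s * p.divRem s z) = p.divHat Θ₀ := by
    funext s z; rw [divHat_eq]
  rwa [e] at h

theorem polyLip_fieldRem (i : Fin 5) : PolyLip fun s z => p.fieldRem Θ₀ s z i := by
  have hw := p.polyLip_divHat Θ₀
  have hT := p.polyLip_temp Θ₀
  have hP := p.polyLip_dens
  have h0 := PolyLip.coord 0
  fin_cases i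
  · exact p.polyLip_divRem
  · exact ((((PolyLip.coord 1).add ((PolyLip.const 2).mul h0)).mul polyLip_gap_inv).mul
      (p.polyLip_divLin Θ₀)).add ((((PolyLip.const 1).add (PolyLip.radius.mul
        (PolyLip.coord 1))).mul polyLip_gap_inv).mul p.polyLip_divRem)
  · exact ((PolyLip.const _).mul ((PolyLip.coord 4).sub
      ((((PolyLip.const _).mul hP).mul polyLip_gap).mul hT))).div_const _
  · exact ((((PolyLip.const _).mul hP)).mul PolyLip.radius).mul (h0.pow 2)
  · exact ((((((PolyLip.const _).mul hP)).mul h0).mul hT).add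
      (((((PolyLip.const _).mul hP)).mul hT).mul hw)).sub
      (PolyLip.radius.mul (((PolyLip.const _).mul (((hw.sub ((PolyLip.const _).mul h0)).pow 2).add
        ((PolyLip.const _).mul (h0.pow 2)))).add ((PolyLip.const _).mul (hw.pow 2))))

/-- The choice of `Λ` gives the temperature coefficient of `divLin` the value exactly `1/8`, and
small `Θ₀` bounds the density coefficient by `1/8`. The factor `2` in the density component then
yields `1/2`. Without the scale `Λ` the temperature coefficient would be uncontrolled. -/
theorem norm_fieldLin_le {Θ₀ : ℝ} (hΘ₀ : 0 ≤ Θ₀) (hsmall : 8 * p.R * p.P₀ * Θ₀ ≤ p.a)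
    (z : Fin 5 → ℝ) : ‖p.fieldLin Θ₀ z‖ ≤ 1 / 2 * ‖z‖ := by
  have ha := p.a_pos
  have hR := p.R_pos
  have hP := p.P₀_pos
  have h1 : |p.divLin Θ₀ z| ≤ 1 / 4 * ‖z‖ := by
    have e : p.divLin Θ₀ z = p.R * p.P₀ * Θ₀ / p.a * z 1 + 1 / 8 * z 2 := by
      simp only [divLin, Λ]; field_simp
    have h2 : p.R * p.P₀ * Θ₀ / p.a ≤ 1 / 8 := by
      rw [div_le_iff₀ ha]; linarith
    have h3 : 0 ≤ p.R * p.P₀ * Θ₀ / p.a := by positivity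
    have h4 : |z 1| ≤ ‖z‖ := norm_le_pi_norm z 1
    have h5 : |z 2| ≤ ‖z‖ := norm_le_pi_norm z 2
    rw [e]
    calc _ ≤ |p.R * p.P₀ * Θ₀ / p.a * z 1| + |1 / 8 * z 2| := abs_add_le _ _
      _ = p.R * p.P₀ * Θ₀ / p.a * |z 1| + 1 / 8 * |z 2| := by
        rw [abs_mul, abs_mul, abs_of_nonneg h3, abs_of_nonneg (by norm_num : (0 : ℝ) ≤ 1 / 8)]
      _ ≤ 1 / 8 * ‖z‖ + 1 / 8 * ‖z‖ := by gcongr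
      _ = _ := by ring
  have h0 := norm_nonneg z
  refine (pi_norm_le_iff_of_nonneg (by positivity)).2 fun i => ?_
  fin_cases i
  · simp only [fieldLin, Real.norm_eq_abs, Fin.zero_eta, Matrix.cons_val_zero]; linarith
  · simp only [fieldLin, Real.norm_eq_abs, Fin.mk_one, Matrix.cons_val_one, Matrix.cons_val_zero,
      abs_mul, abs_two]
    linarith
  all_goals simp [fieldLin]

theorem fieldLin_sub (z z' : Fin 5 → ℝ) :
    p.fieldLin Θ₀ z - p.fieldLin Θ₀ z' = p.fieldLin Θ₀ (z - z') := by
  funext i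
  fin_cases i <;> simp [fieldLin, divLin] <;> ring

theorem continuous_divLin : Continuous (p.divLin Θ₀) := by
  unfold divLin; fun_prop

theorem cutField_eq (s : ℝ) (z : Fin 5 → ℝ) :
    p.cutField Θ₀ s z = p.fieldLin Θ₀ (clamp s z) + s • p.fieldRem Θ₀ s (clamp s z) :=
  p.field_eq Θ₀ (inBox_clamp s z)

theorem continuous_cutField :
    Continuous fun q : ℝ × (Fin 5 → ℝ) => p.cutField Θ₀ q.1 q.2 := by
  simp only [cutField_eq]
  have h1 : Continuous (p.fieldLin Θ₀) := by
    refine continuous_pi fun i => ?_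
    have := p.continuous_divLin Θ₀
    fin_cases i
    · exact this
    · exact this.const_mul 2
    all_goals exact continuous_const
  refine (h1.comp continuous_clamp).add (continuous_fst.smul (continuous_pi fun i => ?_))
  exact (p.polyLip_fieldRem Θ₀ i).1

theorem cutField_zero : p.cutField Θ₀ 0 0 = 0 := by
  rw [cutField_eq, clamp_eq (fun i => by simpa using (boxWidth_pos 0).le)]
  funext i
  fin_cases i <;> simp [fieldLin, divLin]

/-- Exactly the hypotheses of the averaged fixed point theorems. Truncation is a componentwise
contraction, so the Lipschitz bounds valid on the box extend to all `z`. -/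
theorem exists_lipschitz_cutField {Θ₀ : ℝ} (hΘ₀ : 0 ≤ Θ₀)
    (hsmall : 8 * p.R * p.P₀ * Θ₀ ≤ p.a) : ∃ C > 0, ∃ m : ℕ,
      (∀ s, 0 ≤ s → ∀ z z', ‖p.cutField Θ₀ s z - p.cutField Θ₀ s z'‖
        ≤ (1 / 2 + s * (C * (1 + s) ^ m)) * ‖z - z'‖) ∧
      (∀ s, 0 ≤ s → ‖p.cutField Θ₀ s 0‖ ≤ s * (C * (1 + s) ^ m)) := by
  choose _ C hC m hm using p.polyLip_fieldRem Θ₀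
  have hC' : ∀ i, C i ≤ ∑ i, C i := fun i =>
    Finset.single_le_sum (f := C) (fun j _ => (hC j).le) (Finset.mem_univ i)
  have hm' : ∀ i, m i ≤ ∑ i, m i := fun i =>
    Finset.single_le_sum (f := m) (fun j _ => Nat.zero_le _) (Finset.mem_univ i)
  have hCpos : 0 < ∑ i, C i := (hC 0).trans_le (hC' 0)
  have hle : ∀ i s, 0 ≤ s → C i * (1 + s) ^ m i ≤ (∑ i, C i) * (1 + s) ^ (∑ i, m i) := by
    intro i s hs
    have := hC i
    have h1 := hC' i
    have h2 : (1 + s) ^ m i ≤ (1 + s) ^ (∑ i, m i) := pow_le_pow_right₀ (by linarith) (hm' i)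
    gcongr
  refine ⟨∑ i, C i, hCpos, ∑ i, m i, fun s hs z z' => ?_, fun s hs => ?_⟩
  · rw [cutField_eq, cutField_eq]
    have e : p.fieldLin Θ₀ (clamp s z) + s • p.fieldRem Θ₀ s (clamp s z)
        - (p.fieldLin Θ₀ (clamp s z') + s • p.fieldRem Θ₀ s (clamp s z'))
        = p.fieldLin Θ₀ (clamp s z - clamp s z')
          + s • (p.fieldRem Θ₀ s (clamp s z) - p.fieldRem Θ₀ s (clamp s z')) := by
      rw [← fieldLin_sub, smul_sub]; abel
    rw [e]
    have h1 := norm_clamp_sub_le s z z'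
    have h2 : ‖p.fieldRem Θ₀ s (clamp s z) - p.fieldRem Θ₀ s (clamp s z')‖
        ≤ (∑ i, C i) * (1 + s) ^ (∑ i, m i) * ‖z - z'‖ := by
      refine (pi_norm_le_iff_of_nonneg (by positivity)).2 fun i => ?_
      refine ((hm i s hs _ _ (inBox_clamp s z) (inBox_clamp s z')).2).trans ?_
      have h3 := hle i s hs
      gcongr
    calc _ ≤ ‖p.fieldLin Θ₀ (clamp s z - clamp s z')‖
          + ‖s • (p.fieldRem Θ₀ s (clamp s z) - p.fieldRem Θ₀ s (clamp s z'))‖ := norm_add_le _ _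
      _ ≤ 1 / 2 * ‖z - z'‖ + s * ((∑ i, C i) * (1 + s) ^ (∑ i, m i) * ‖z - z'‖) := by
        rw [norm_smul, Real.norm_of_nonneg hs]
        have h3 := p.norm_fieldLin_le hΘ₀ hsmall (clamp s z - clamp s z')
        gcongr
        linarith
      _ = _ := by ring
  · have h0 : InBox s 0 := fun i => by simpa using (boxWidth_pos s).le
    have h1 : p.fieldLin Θ₀ 0 = 0 := by
      funext i
      fin_cases i <;> simp [fieldLin, divLin]
    rw [cutField_eq, clamp_eq h0, h1, zero_add, norm_smul, Real.norm_of_nonneg hs]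
    gcongr
    refine (pi_norm_le_iff_of_nonneg (by positivity)).2 fun i => ?_
    exact ((hm i s hs _ _ h0 h0).1).trans (hle i s hs)

end Params

end SelfSimilarNS

/-! ### Real-variable tools: comparison, relaxation, continuity arguments, limits. -/

namespace SelfSimilarNS

theorem monotoneOn_Icc_of_hasDerivAt {f f' : ℝ → ℝ} {a b : ℝ} (hc : ContinuousOn f (Icc a b))
    (hd : ∀ x ∈ Ioo a b, HasDerivAt f (f' x) x) (h0 : ∀ x ∈ Ioo a b, 0 ≤ f' x) :
    MonotoneOn f (Icc a b) := by
  apply monotoneOn_of_deriv_nonneg (convex_Icc a b) hc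
  · rw [interior_Icc]
    exact fun x hx => (hd x hx).differentiableAt.differentiableWithinAt
  · rw [interior_Icc]
    exact fun x hx => by rw [(hd x hx).deriv]; exact h0 x hx

theorem abs_sub_le_of_abs_deriv_le {f f' φ φ' : ℝ → ℝ} {a b : ℝ}
    (hf : ContinuousOn f (Icc a b)) (hφ : ContinuousOn φ (Icc a b))
    (hf' : ∀ x ∈ Ioo a b, HasDerivAt f (f' x) x) (hφ' : ∀ x ∈ Ioo a b, HasDerivAt φ (φ' x) x)
    (hle : ∀ x ∈ Ioo a b, |f' x| ≤ φ' x) {x : ℝ} (hx : x ∈ Icc a b) :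
    |f x - f a| ≤ φ x - φ a := by
  have ha : a ∈ Icc a b := ⟨le_rfl, hx.1.trans hx.2⟩
  have h1 := monotoneOn_Icc_of_hasDerivAt (hφ.sub hf) (fun x hx => (hφ' x hx).sub (hf' x hx))
    (fun x hx => by have := (abs_le.1 (hle x hx)).2; linarith) ha hx hx.1
  have h2 := monotoneOn_Icc_of_hasDerivAt (hφ.add hf) (fun x hx => (hφ' x hx).add (hf' x hx))
    (fun x hx => by have := (abs_le.1 (hle x hx)).1; linarith) ha hx hx.1
  simp only [Pi.sub_apply, Pi.add_apply] at h1 h2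
  rw [abs_le]
  constructor <;> linarith

/-- A function which does not increase where it exceeds `M` stays below `M`. -/
theorem le_of_deriv_nonpos_above {f f' : ℝ → ℝ} {a b M : ℝ} (hc : ContinuousOn f (Icc a b))
    (hd : ∀ x ∈ Ioo a b, HasDerivAt f (f' x) x) (ha : f a ≤ M)
    (h0 : ∀ x ∈ Ioo a b, M < f x → f' x ≤ 0) {x : ℝ} (hx : x ∈ Icc a b) : f x ≤ M := by
  by_contra! hlt
  have hsub : Icc a x ⊆ Icc a b := Icc_subset_Icc_right hx.2
  -- Start from the last point before `x` at which `f ≤ M`: beyond it `f` cannot increase.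
  have hK : IsCompact (Icc a x ∩ f ⁻¹' Iic M) :=
    isCompact_Icc.of_isClosed_subset
      ((hc.mono hsub).preimage_isClosed_of_isClosed isClosed_Icc isClosed_Iic) inter_subset_left
  obtain ⟨y, ⟨hy, hyM⟩, hmax⟩ := hK.exists_isGreatest ⟨a, ⟨le_rfl, hx.1⟩, ha⟩
  have hM : ∀ s ∈ Ioo y x, M < f s := by
    intro s hs
    by_contra! h
    exact absurd (hmax ⟨⟨hy.1.trans hs.1.le, hs.2.le⟩, h⟩) (not_le.2 hs.1)
  have hin : ∀ s ∈ Ioo y x, s ∈ Ioo a b :=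
    fun s hs => ⟨hy.1.trans_lt hs.1, hs.2.trans_le hx.2⟩
  have hmono := monotoneOn_Icc_of_hasDerivAt (f := fun s => -f s) (a := y) (b := x)
    (hc.mono fun s hs => ⟨hy.1.trans hs.1, hs.2.trans hx.2⟩).neg
    (fun s hs => (hd s (hin s hs)).neg)
    (fun s hs => by have := h0 s (hin s hs) (hM s hs); linarith)
    (left_mem_Icc.2 hy.2) (right_mem_Icc.2 hy.2) hy.2
  have : f y ≤ M := hyM
  linarith

/-- Solutions of a linear relaxation equation whose rate grows linearly follow the size of the
forcing. -/
theorem abs_mul_le_of_relaxation {X g q : ℝ → ℝ} {a b M η : ℝ} (ha0 : 0 ≤ a) (hη : 0 ≤ η)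
    (hM : 0 ≤ M) (hc : ContinuousOn X (Icc a b))
    (hd : ∀ x ∈ Ioo a b, HasDerivAt X (-q x * X x + g x) x)
    (hq : ∀ x ∈ Ioo a b, 4 * η * x ≤ q x)
    (hg : ∀ x ∈ Ioo a b, |g x| * (1 + η * x ^ 2) ≤ M / 2 * q x)
    (ha : |X a| * (1 + η * a ^ 2) ≤ M) {x : ℝ} (hx : x ∈ Icc a b) :
    |X x| * (1 + η * x ^ 2) ≤ M := by
  have key : ∀ {Y G : ℝ → ℝ}, ContinuousOn Y (Icc a b) →
      (∀ x ∈ Ioo a b, HasDerivAt Y (-q x * Y x + G x) x) →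
      (∀ x ∈ Ioo a b, G x * (1 + η * x ^ 2) ≤ M / 2 * q x) →
      Y a * (1 + η * a ^ 2) ≤ M → Y x * (1 + η * x ^ 2) ≤ M := by
    intro Y G hYc hYd hG hYa
    refine le_of_deriv_nonpos_above (f := fun x => Y x * (1 + η * x ^ 2))
      (f' := fun x => (-q x * Y x + G x) * (1 + η * x ^ 2) + Y x * (η * (2 * x)))
      (hYc.mul (by fun_prop)) (fun s hs => ?_) hYa (fun s hs hlt => ?_) hx
    · have h1 : HasDerivAt (fun x : ℝ => 1 + η * x ^ 2) (η * (2 * s)) s := by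
        simpa using ((hasDerivAt_pow 2 s).const_mul η).const_add 1
      exact (hYd s hs).mul h1
    · have hs0 : 0 < s := ha0.trans_lt hs.1
      have h1 := hq s hs
      have h2 := hG s hs
      have h3 : 0 ≤ 4 * η * s := by positivity
      have h4 : 0 < 1 + η * s ^ 2 := by positivity
      have h5 : 0 ≤ Y s := by
        by_contra! h
        have : Y s * (1 + η * s ^ 2) < 0 := mul_neg_of_neg_of_pos h h4
        linarith
      -- Half of the damping absorbs the derivative of the weight, by `4 η s ≤ q`; the other half
      -- beats the forcing wherever the weighted function exceeds `M`.
      have h6 : Y s * (η * (2 * s)) ≤ Y s * (1 / 2 * q s * (1 + η * s ^ 2)) := by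
        apply mul_le_mul_of_nonneg_left _ h5
        have : 0 ≤ q s * (η * s ^ 2) := mul_nonneg (by linarith) (by positivity)
        nlinarith
      have h7 : 0 ≤ 1 / 2 * q s * (Y s * (1 + η * s ^ 2) - M) :=
        mul_nonneg (by linarith) (by linarith)
      linarith
  have h1 := key hc hd (fun s hs => by
    have := le_abs_self (g s)
    have : g s * (1 + η * s ^ 2) ≤ |g s| * (1 + η * s ^ 2) := by gcongr
    linarith [hg s hs]) (by
    have : X a * (1 + η * a ^ 2) ≤ |X a| * (1 + η * a ^ 2) := by gcongr; exact le_abs_self _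
    linarith)
  have h2 := key (Y := fun s => -X s) (G := fun s => -g s) hc.neg
    (fun s hs => (hd s hs).fun_neg.congr_deriv (by ring)) (fun s hs => by
    have : -g s * (1 + η * s ^ 2) ≤ |g s| * (1 + η * s ^ 2) := by gcongr; exact neg_le_abs _
    linarith [hg s hs]) (by
    have : -X a * (1 + η * a ^ 2) ≤ |X a| * (1 + η * a ^ 2) := by gcongr; exact neg_le_abs _
    linarith)
  rcases abs_cases (X x) with ⟨h, -⟩ | ⟨h, -⟩ <;> rw [h] <;> linarith

/-- A continuous function which starts below `1`, and is below `1` at every point up to which it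
has been at most `1`, is below `1` everywhere. -/
theorem lt_one_of_bootstrap {f : ℝ → ℝ} (hc : ContinuousOn f (Ici 0)) (h0 : f 0 < 1)
    (hstep : ∀ τ, 0 ≤ τ → (∀ s ∈ Icc 0 τ, f s ≤ 1) → f τ < 1) {r : ℝ} (hr : 0 ≤ r) :
    f r < 1 := by
  by_contra! hge
  have hK : IsCompact (Icc 0 r ∩ f ⁻¹' Ici 1) :=
    isCompact_Icc.of_isClosed_subset
      ((hc.mono Icc_subset_Ici_self).preimage_isClosed_of_isClosed isClosed_Icc isClosed_Ici)
      inter_subset_left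
  obtain ⟨y, ⟨hy, hy1⟩, hmin⟩ := hK.exists_isLeast ⟨r, ⟨hr, le_rfl⟩, hge⟩
  have hlt : ∀ s ∈ Ico 0 y, f s < 1 := by
    intro s hs
    by_contra! h
    exact absurd (hmin ⟨⟨hs.1, hs.2.le.trans hy.2⟩, h⟩) (not_le.2 hs.2)
  have hy0 : 0 < y := by
    rcases hy.1.eq_or_lt with h | h
    · rw [← h] at hy1; exact absurd h0 (not_lt.2 hy1)
    · exact h
  have hyle : f y ≤ 1 := by
    have h1 : Tendsto f (𝓝[<] y) (𝓝 (f y)) := by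
      have : ContinuousAt f y := hc.continuousAt (Ici_mem_nhds hy0)
      exact this.tendsto.mono_left nhdsWithin_le_nhds
    refine le_of_tendsto h1 ?_
    filter_upwards [Ioo_mem_nhdsLT hy0] with s hs
    exact (hlt s ⟨hs.1.le, hs.2⟩).le
  refine absurd (hstep y hy.1 fun s hs => ?_) (not_lt.2 hy1)
  rcases hs.2.eq_or_lt with h | h
  · rwa [h]
  · exact (hlt s ⟨hs.1, h⟩).le

/-- At the endpoint the one-sided derivative is the limit of the interior derivatives, so only a
continuous extension of the formula for the derivative is needed. -/
theorem hasDerivWithinAt_Ici_of_pos {f f' : ℝ → ℝ} (hf : ContinuousOn f (Ici 0))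
    (hf' : ContinuousOn f' (Ici 0)) (hd : ∀ r, 0 < r → HasDerivAt f (f' r) r) {r : ℝ}
    (hr : 0 ≤ r) : HasDerivWithinAt f (f' r) (Ici 0) r := by
  rcases hr.eq_or_lt with rfl | hr0
  · refine hasDerivWithinAt_Ici_of_tendsto_deriv (s := Ioi 0)
      (fun x hx => (hd x hx).differentiableAt.differentiableWithinAt)
      ((hf 0 self_mem_Ici).mono Ioi_subset_Ici_self) self_mem_nhdsWithin ?_
    have h1 : Tendsto f' (𝓝[>] 0) (𝓝 (f' 0)) :=
      (hf' 0 self_mem_Ici).mono_left (nhdsWithin_mono _ Ioi_subset_Ici_self)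
    refine h1.congr' ?_
    filter_upwards [self_mem_nhdsWithin] with x hx
    exact (hd x hx).deriv.symm
  · exact (hd r hr0).hasDerivWithinAt

theorem contDiffOn_one_Ici {f f' : ℝ → ℝ} (hf : ContinuousOn f (Ici 0))
    (hf' : ContinuousOn f' (Ici 0)) (hd : ∀ r, 0 < r → HasDerivAt f (f' r) r) :
    ContDiffOn ℝ 1 f (Ici 0) := by
  have h := fun r (hr : r ∈ Ici (0 : ℝ)) => hasDerivWithinAt_Ici_of_pos hf hf' hd hr
  have hu : UniqueDiffOn ℝ (Ici (0 : ℝ)) := uniqueDiffOn_Ici 0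
  rw [show (1 : WithTop ℕ∞) = 0 + 1 by simp, contDiffOn_succ_iff_derivWithin hu]
  refine ⟨fun r hr => (h r hr).differentiableWithinAt, by simp, ?_⟩
  rw [contDiffOn_zero]
  exact hf'.congr fun r hr => (h r hr).derivWithin (hu r hr)

theorem derivWithin_Ici_eq {f f' : ℝ → ℝ} (hf : ContinuousOn f (Ici 0))
    (hf' : ContinuousOn f' (Ici 0)) (hd : ∀ r, 0 < r → HasDerivAt f (f' r) r) {r : ℝ}
    (hr : 0 ≤ r) : derivWithin f (Ici 0) r = f' r :=
  (hasDerivWithinAt_Ici_of_pos hf hf' hd hr).derivWithin (uniqueDiffOn_Ici 0 r hr)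

/-- A function with derivative `O(r⁻³)` converges at the rate `O(r⁻²)`. -/
theorem exists_limit_of_abs_deriv_le {f f' : ℝ → ℝ} {M : ℝ}
    (hd : ∀ r, 1 ≤ r → HasDerivAt f (f' r) r) (hle : ∀ r, 1 ≤ r → |f' r| ≤ M / r ^ 3) :
    ∃ L, Tendsto f atTop (𝓝 L) ∧ ∀ r, 1 ≤ r → |f r - L| ≤ M / r ^ 2 := by
  have hM : 0 ≤ M := by simpa using (abs_nonneg _).trans (hle 1 le_rfl)
  have key : ∀ r s, 1 ≤ r → r ≤ s → |f s - f r| ≤ M / r ^ 2 := by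
    intro r s hr hrs
    have hr0 : 0 < r := by linarith
    have h1 := abs_sub_le_of_abs_deriv_le (f := f) (f' := f') (φ := fun x => -(M / 2) * (x ^ 2)⁻¹)
      (φ' := fun x => -(M / 2) * (-(2 * x) / (x ^ 2) ^ 2)) (a := r) (b := s) (x := s)
      (fun x hx => (hd x (hr.trans hx.1)).continuousAt.continuousWithinAt)
      (ContinuousOn.mul continuousOn_const (ContinuousOn.inv₀ (by fun_prop) fun x hx => by
        have : 0 < x := hr0.trans_le hx.1
        positivity))
      (fun x hx => hd x (hr.trans hx.1.le))
      (fun x hx => by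
        have hx0 : 0 < x := hr0.trans hx.1
        have := ((hasDerivAt_pow 2 x).fun_inv (by positivity)).const_mul (-(M / 2))
        simpa using this)
      (fun x hx => by
        have hx0 : 0 < x := hr0.trans hx.1
        refine (hle x (hr.trans hx.1.le)).trans (le_of_eq ?_)
        field_simp) ⟨hrs, le_rfl⟩
    have hs0 : 0 < s := hr0.trans_le hrs
    have h2 : 0 ≤ M / 2 * (s ^ 2)⁻¹ := by positivity
    have h3 : 0 ≤ M / 2 * (r ^ 2)⁻¹ := by positivity
    have h4 : M / r ^ 2 = M / 2 * (r ^ 2)⁻¹ + M / 2 * (r ^ 2)⁻¹ := by field_simp; ring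
    linarith
  -- The estimate is known only from `1` on; `max r 1` makes it available for all indices.
  have hcau : CauchySeq fun r => f (max r 1) := by
    refine cauchySeq_of_le_tendsto_0' (fun r => M / (max r 1) ^ 2) (fun r s hrs => ?_) ?_
    · rw [dist_comm, Real.dist_eq]
      exact key _ _ (le_max_right _ _) (max_le_max hrs le_rfl)
    · refine Tendsto.div_atTop tendsto_const_nhds ?_
      refine (tendsto_pow_atTop two_ne_zero).comp ?_
      exact tendsto_atTop_mono (fun r => le_max_left r 1) tendsto_id
  obtain ⟨L, hL⟩ := cauchySeq_tendsto_of_complete hcau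
  have hL' : Tendsto f atTop (𝓝 L) := by
    refine hL.congr' ?_
    filter_upwards [eventually_ge_atTop 1] with r hr
    rw [max_eq_left hr]
  refine ⟨L, hL', fun r hr => ?_⟩
  rw [abs_sub_comm]
  refine le_of_tendsto (hL'.sub_const (f r)).abs ?_
  filter_upwards [eventually_ge_atTop r] with s hs
  exact key r s hr hs

end SelfSimilarNS

/-! ### The once integrated system and consequences of the assumed decay. -/

namespace SelfSimilarNS

/-- Density, velocity, divergence and temperature of a flow, together with the two integral
quantities through which the momentum and energy equations are integrated once. -/
structure Flow where
  P : ℝ → ℝ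
  U : ℝ → ℝ
  W : ℝ → ℝ
  Θ : ℝ → ℝ
  I : ℝ → ℝ
  J : ℝ → ℝ

namespace Flow

variable (X : Flow) (p : Params) (Θ₀ r : ℝ)

/-- The derivative of the velocity. -/
noncomputable def velDeriv : ℝ := X.W r - p.D * (X.U r / r)

/-- The derivative of the density. -/
noncomputable def densDeriv : ℝ := X.P r * X.W r / (r / 2 - X.U r)

/-- The derivative of the temperature. -/
noncomputable def tempDeriv : ℝ :=
  (X.J r - p.CV * X.P r * (r * (r / 2 - X.U r)) * X.Θ r) / (p.κ * r)
    - (p.n + 1) * (X.Θ r - Θ₀) / r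

/-- The derivative of the momentum integral. -/
noncomputable def momDeriv : ℝ := p.D * X.P r * X.U r * (X.U r / r)

/-- The derivative of the energy integral. -/
noncomputable def energyDeriv : ℝ :=
  p.CV * (p.n + 1) * X.P r * X.U r * X.Θ r + p.R * r * X.P r * X.Θ r * X.W r
    - r * (2 * p.μ * ((X.W r - p.D * (X.U r / r)) ^ 2 + p.D * (X.U r / r) ^ 2)
      + p.lam * X.W r ^ 2)

/-- The derivative of the divergence, multiplied by the viscosity. -/
noncomputable def divDeriv : ℝ :=
  -(X.P r * (r / 2 - X.U r)) * X.W r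
    + (p.R * (X.densDeriv r * X.Θ r + X.P r * X.tempDeriv p Θ₀ r)
      + X.P r * X.U r * ((p.D - 1) / 2 - p.D * (X.U r / r)))

end Flow

/-- The flow solves the once integrated system on the interval `[0, τ]`. -/
structure Solves (p : Params) (Θ₀ τ : ℝ) (X : Flow) : Prop where
  cont_P : ContinuousOn X.P (Icc 0 τ)
  cont_U : ContinuousOn X.U (Icc 0 τ)
  cont_W : ContinuousOn X.W (Icc 0 τ)
  cont_Θ : ContinuousOn X.Θ (Icc 0 τ)
  cont_I : ContinuousOn X.I (Icc 0 τ)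
  cont_J : ContinuousOn X.J (Icc 0 τ)
  P_zero : X.P 0 = p.P₀
  U_zero : X.U 0 = 0
  Θ_zero : X.Θ 0 = Θ₀
  I_zero : X.I 0 = 0
  J_zero : X.J 0 = 0
  U_flat : Tendsto (fun r => X.U r / r ^ 2) (𝓝[>] 0) (𝓝 0)
  deriv_U : ∀ r ∈ Ioo 0 τ, HasDerivAt X.U (X.velDeriv p r) r
  deriv_P : ∀ r ∈ Ioo 0 τ, HasDerivAt X.P (X.densDeriv r) r
  deriv_Θ : ∀ r ∈ Ioo 0 τ, HasDerivAt X.Θ (X.tempDeriv p Θ₀ r) r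
  deriv_I : ∀ r ∈ Ioo 0 τ, HasDerivAt X.I (X.momDeriv p r) r
  deriv_J : ∀ r ∈ Ioo 0 τ, HasDerivAt X.J (X.energyDeriv p r) r
  W_eq : ∀ r ∈ Icc 0 τ, p.a * X.W r
    = p.R * (X.P r * X.Θ r - p.P₀ * Θ₀) - X.P r * (r / 2 - X.U r) * X.U r + X.I r

/-- A solution which satisfies the decay bounds with the constant `δ`. -/
structure Bounded (p : Params) (Θ₀ δ τ : ℝ) (X : Flow) : Prop extends Solves p Θ₀ τ X where
  Θ₀_pos : 0 < Θ₀
  Θ₀_le : Θ₀ ≤ δ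
  sq_le : δ ^ 2 ≤ Θ₀
  δ_le : δ ≤ 1 / 8
  le_P : ∀ r ∈ Icc 0 τ, p.P₀ / 2 ≤ X.P r
  P_le : ∀ r ∈ Icc 0 τ, X.P r ≤ 2 * p.P₀
  abs_U_le : ∀ r ∈ Icc 0 τ, |X.U r| ≤ δ * (r ^ 2 / (1 + r) ^ 3)
  abs_W_le : ∀ r ∈ Icc 0 τ, |X.W r| ≤ δ * (r / (1 + r) ^ 3)
  abs_Θ_le : ∀ r ∈ Icc 0 τ, |X.Θ r| ≤ δ * (1 / (1 + r) ^ 2)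

/-- Differentiating the algebraic law for `W` and replacing `P' (r/2 - U)` by `P W` exhibits a
relaxation equation with rate `P (r/2 - U) / a`. It gives decay at infinity that the algebraic law
cannot see. -/
theorem Solves.deriv_W {p : Params} {Θ₀ τ : ℝ} {X : Flow} (h : Solves p Θ₀ τ X) {r : ℝ}
    (hr : r ∈ Ioo 0 τ) (hgap : r / 2 - X.U r ≠ 0) :
    HasDerivAt X.W (X.divDeriv p Θ₀ r / p.a) r := by
  have ha := p.a_pos.ne'
  have hr0 : r ≠ 0 := hr.1.ne'
  have hgap' : HasDerivAt (fun s => s / 2 - X.U s) (1 / 2 - X.velDeriv p r) r :=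
    ((hasDerivAt_id r).div_const 2).sub (h.deriv_U r hr)
  have h1 := ((((((h.deriv_P r hr).mul (h.deriv_Θ r hr)).sub_const (p.P₀ * Θ₀)).const_mul p.R).sub
    (((h.deriv_P r hr).mul hgap').mul (h.deriv_U r hr))).add (h.deriv_I r hr)).div_const p.a
  have h2 := h1.congr_of_eventuallyEq (f₁ := X.W) (by
    filter_upwards [Ioo_mem_nhds hr.1 hr.2] with s hs
    have := h.W_eq s ⟨hs.1.le, hs.2.le⟩
    simp only [Pi.add_apply, Pi.sub_apply, Pi.mul_apply]
    rw [← this]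
    field_simp)
  refine h2.congr_deriv ?_
  congr 1
  have hPD : X.densDeriv r * (r / 2 - X.U r) = X.P r * X.W r := div_mul_cancel₀ _ hgap
  rw [hPD]
  simp only [Flow.divDeriv, Flow.momDeriv, Flow.velDeriv, Pi.mul_apply]
  field_simp
  ring

section Weights

variable {r : ℝ}

theorem sq_div_cube_le (hr : 0 ≤ r) : r ^ 2 / (1 + r) ^ 3 ≤ r := by
  rw [div_le_iff₀ (by positivity)]
  have h1 : 0 ≤ r ^ 2 := by positivity
  have h2 : 0 ≤ r ^ 3 := by positivity
  have h3 : 0 ≤ r ^ 4 := by positivity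
  nlinarith

theorem mul_sq_div_cube_le (hr : 0 ≤ r) :
    r * (r / (1 + r) ^ 3) ^ 2 ≤ r ^ 2 / (1 + r) ^ 5 := by
  rw [div_pow, ← mul_div_assoc, div_le_div_iff₀ (by positivity) (by positivity)]
  have : 0 ≤ r ^ 2 * (1 + r) ^ 5 := by positivity
  nlinarith

/-- The right side is the derivative of `(r / (1 + r))²`, which is therefore the common profile for
the bounds on `I` and `J`. -/
theorem sq_div_fifth_le (hr : 0 ≤ r) :
    r ^ 2 / (1 + r) ^ 5 ≤ 2 * r / (1 + r) ^ 3 := by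
  rw [div_le_div_iff₀ (by positivity) (by positivity)]
  have h1 : 0 ≤ r * (1 + r) ^ 3 := by positivity
  have h2 : 0 ≤ r * (1 + r) ^ 3 * r ^ 2 := by positivity
  have h3 : 0 ≤ r * (1 + r) ^ 3 * r := by positivity
  nlinarith

theorem div_one_add_le_one (hr : 0 ≤ r) : r / (1 + r) ≤ 1 := by
  rw [div_le_one (by positivity)]; linarith

theorem sq_div_le_div (hr : 0 ≤ r) : (r / (1 + r)) ^ 2 ≤ r / (1 + r) := by
  have h1 := div_one_add_le_one hr
  have h2 : 0 ≤ r / (1 + r) := by positivity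
  nlinarith

/-- Merges a bound near the origin with a decay bound for `r ≥ 1`; the factor `8 = 2³` comes from `1
+ r ≤ 2` and `1 + r ≤ 2 r` respectively. -/
theorem le_weight_of_le {x C₁ C₂ : ℝ} (j : ℕ) (hr : 0 ≤ r) (hC₁ : 0 ≤ C₁) (hC₂ : 0 ≤ C₂)
    (h1 : x ≤ C₁ * r ^ j) (h2 : 1 ≤ r → x * r ^ 3 ≤ C₂ * r ^ j) :
    x ≤ 8 * (C₁ + C₂) * (r ^ j / (1 + r) ^ 3) := by
  have hj : 0 ≤ r ^ j := by positivity
  rw [← mul_div_assoc, le_div_iff₀ (by positivity)]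
  rcases lt_or_ge x 0 with hx | hx
  · have : x * (1 + r) ^ 3 ≤ 0 := mul_nonpos_of_nonpos_of_nonneg hx.le (by positivity)
    have : 0 ≤ 8 * (C₁ + C₂) * r ^ j := by positivity
    linarith
  · have h3 : 0 ≤ C₁ * r ^ j := by positivity
    have h4 : 0 ≤ C₂ * r ^ j := by positivity
    rcases le_total r 1 with h | h
    · calc x * (1 + r) ^ 3 ≤ x * (1 + 1) ^ 3 := by gcongr
        _ ≤ _ := by linarith
    · calc x * (1 + r) ^ 3 ≤ x * (r + r) ^ 3 := by gcongr
        _ = 8 * (x * r ^ 3) := by ring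
        _ ≤ _ := by linarith [h2 h]

theorem le_sq_weight_of_le {x C : ℝ} (hr : 0 ≤ r) (hC : 0 ≤ C) (h1 : x ≤ C * r ^ 2)
    (h2 : x ≤ C) : x ≤ 4 * C * (r / (1 + r)) ^ 2 := by
  rw [div_pow, ← mul_div_assoc, le_div_iff₀ (by positivity)]
  rcases lt_or_ge x 0 with hx | hx
  · have : x * (1 + r) ^ 2 ≤ 0 := mul_nonpos_of_nonpos_of_nonneg hx.le (by positivity)
    have : 0 ≤ 4 * C * r ^ 2 := by positivity
    linarith
  · rcases le_total r 1 with h | h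
    · calc x * (1 + r) ^ 2 ≤ x * (1 + 1) ^ 2 := by gcongr
        _ ≤ _ := by linarith
    · calc x * (1 + r) ^ 2 ≤ x * (r + r) ^ 2 := by gcongr
        _ = 4 * (x * r ^ 2) := by ring
        _ ≤ 4 * (C * r ^ 2) := by gcongr
        _ = _ := by ring

theorem hasDerivAt_div_one_add (hr : 0 < r) :
    HasDerivAt (fun s : ℝ => s / (1 + s)) (1 / (1 + r) ^ 2) r := by
  have h := (hasDerivAt_id r).div ((hasDerivAt_id r).const_add 1) (by simp; positivity)
  refine h.congr_deriv ?_
  simp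

theorem continuousOn_div_one_add (τ : ℝ) :
    ContinuousOn (fun s : ℝ => s / (1 + s)) (Icc 0 τ) := by
  refine ContinuousOn.div (by fun_prop) (by fun_prop) fun x hx => ?_
  have := hx.1
  positivity

end Weights

namespace Bounded

variable {p : Params} {Θ₀ δ τ r : ℝ} {X : Flow}

theorem δ_pos (h : Bounded p Θ₀ δ τ X) : 0 < δ := h.Θ₀_pos.trans_le h.Θ₀_le

/-- Since `|U| ≤ δ r ≤ r/8`, the transport coefficient `r/2 - U` degenerates only at the origin, and
the damping rates below are comparable to `r`. -/
theorem gap (h : Bounded p Θ₀ δ τ X) (hr : r ∈ Icc 0 τ) :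
    r / 4 ≤ r / 2 - X.U r ∧ r / 2 - X.U r ≤ r := by
  have h1 := h.abs_U_le r hr
  have h2 := sq_div_cube_le hr.1
  have h3 := h.δ_le
  have h4 := h.δ_pos
  have h5 : δ * (r ^ 2 / (1 + r) ^ 3) ≤ 1 / 8 * r := by
    have := hr.1
    gcongr
  have := abs_le.1 h1
  have := hr.1
  constructor <;> linarith

theorem P_pos (h : Bounded p Θ₀ δ τ X) (hr : r ∈ Icc 0 τ) : 0 < X.P r := by
  have := h.le_P r hr
  have := p.P₀_pos
  linarith

theorem le_mul_gap (h : Bounded p Θ₀ δ τ X) (hr : r ∈ Icc 0 τ) :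
    p.P₀ * r / 8 ≤ X.P r * (r / 2 - X.U r) := by
  have h1 := h.gap hr
  have h2 := h.le_P r hr
  have h3 := p.P₀_pos
  have := hr.1
  calc p.P₀ * r / 8 = p.P₀ / 2 * (r / 4) := by ring
    _ ≤ _ := mul_le_mul h2 h1.1 (by positivity) (h.P_pos hr).le

theorem mul_gap_le (h : Bounded p Θ₀ δ τ X) (hr : r ∈ Icc 0 τ) :
    X.P r * (r / 2 - X.U r) ≤ 2 * p.P₀ * r := by
  have h1 := h.gap hr
  have h2 := h.P_le r hr
  have h3 := p.P₀_pos
  have := hr.1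
  have : 0 ≤ r / 2 - X.U r := by linarith
  gcongr
  exact h1.2

theorem abs_U_div_le (h : Bounded p Θ₀ δ τ X) (hr : r ∈ Icc 0 τ) (hr0 : 0 < r) :
    |X.U r / r| ≤ δ * (r / (1 + r) ^ 3) := by
  rw [abs_div, abs_of_pos hr0, div_le_iff₀ hr0]
  calc |X.U r| ≤ _ := h.abs_U_le r hr
    _ = _ := by ring

theorem abs_densDeriv_le (h : Bounded p Θ₀ δ τ X) (hr : r ∈ Icc 0 τ) (hr0 : 0 < r) :
    |X.densDeriv r| ≤ 8 * p.P₀ * δ * (1 / (1 + r) ^ 3) := by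
  have h1 := (h.gap hr).1
  have h2 := h.abs_W_le r hr
  have h3 := h.P_le r hr
  have h4 := h.P_pos hr
  have h5 := p.P₀_pos
  have h6 := h.δ_pos
  have h7 : 0 < r / 2 - X.U r := by linarith
  rw [Flow.densDeriv, abs_div, abs_mul, abs_of_pos h4, abs_of_pos h7, div_le_iff₀ h7]
  calc X.P r * |X.W r| ≤ 2 * p.P₀ * (δ * (r / (1 + r) ^ 3)) := by gcongr
    _ = 8 * p.P₀ * δ * (1 / (1 + r) ^ 3) * (r / 4) := by ring
    _ ≤ _ := by gcongr

/-- The bound on `P'` decays faster than `(1 + r)⁻²`, which is the derivative of `r / (1 + r)`. -/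
theorem abs_P_sub_le (h : Bounded p Θ₀ δ τ X) (hr : r ∈ Icc 0 τ) :
    |X.P r - p.P₀| ≤ 8 * p.P₀ * δ * (r / (1 + r)) := by
  have h1 := abs_sub_le_of_abs_deriv_le (φ := fun s => 8 * p.P₀ * δ * (s / (1 + s)))
    (φ' := fun s => 8 * p.P₀ * δ * (1 / (1 + s) ^ 2)) h.cont_P
    (continuousOn_const.mul (continuousOn_div_one_add τ)) h.deriv_P
    (fun s hs => (hasDerivAt_div_one_add hs.1).const_mul _) (fun s hs => ?_) hr
  · simpa [h.P_zero] using h1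
  · refine (h.abs_densDeriv_le ⟨hs.1.le, hs.2.le⟩ hs.1).trans ?_
    have h5 := p.P₀_pos
    have h6 := h.δ_pos
    have h7 := hs.1
    gcongr
    · linarith
    · norm_num

theorem abs_momDeriv_le (h : Bounded p Θ₀ δ τ X) (hr : r ∈ Icc 0 τ) (hr0 : 0 < r) :
    |X.momDeriv p r| ≤ 2 * p.D * p.P₀ * δ ^ 2 * (r ^ 2 / (1 + r) ^ 5) := by
  have h1 := h.abs_U_le r hr
  have h2 := h.abs_U_div_le hr hr0
  have h3 := h.P_le r hr
  have h4 := h.P_pos hr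
  have h5 := p.P₀_pos
  have h6 := h.δ_pos
  have h7 := p.D_pos
  rw [Flow.momDeriv, abs_mul, abs_mul, abs_mul, abs_of_pos h4, abs_of_pos h7]
  calc p.D * X.P r * |X.U r| * |X.U r / r|
      ≤ p.D * (2 * p.P₀) * (δ * (r ^ 2 / (1 + r) ^ 3)) * (δ * (r / (1 + r) ^ 3)) := by gcongr
    _ = 2 * p.D * p.P₀ * δ ^ 2 * (r * (r / (1 + r) ^ 3) ^ 2) := by ring
    _ ≤ _ := by gcongr; exact mul_sq_div_cube_le hr0.le

/-- The constant in the bound for the energy integral. -/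
noncomputable def energyConst (p : Params) : ℝ :=
  2 * p.CV * (p.n + 1) * p.P₀ + 2 * p.R * p.P₀ + (2 * p.μ * ((1 + p.D) ^ 2 + p.D) + p.lam)

theorem energyConst_pos (p : Params) : 0 < energyConst p := by
  have := p.P₀_pos; have := p.CV_pos; have := p.R_pos; have := p.μ_pos; have := p.lam_pos
  have := p.D_pos
  unfold energyConst
  positivity

/-- Each term of `J'` has two small decaying factors: this yields `δ²`, hence a size controlled by
`Θ₀`, and decay of order `r⁻³`, hence convergence of `J`. -/
theorem abs_energyDeriv_le (h : Bounded p Θ₀ δ τ X) (hr : r ∈ Icc 0 τ) (hr0 : 0 < r) :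
    |X.energyDeriv p r| ≤ energyConst p * δ ^ 2 * (r ^ 2 / (1 + r) ^ 5) := by
  have h1 := h.abs_U_le r hr
  have h2 := h.abs_U_div_le hr hr0
  have h3 := h.P_le r hr
  have h4 := h.P_pos hr
  have h5 := p.P₀_pos
  have h6 := h.δ_pos
  have h7 := p.D_pos
  have h8 := h.abs_W_le r hr
  have h9 := h.abs_Θ_le r hr
  have := p.CV_pos; have := p.R_pos; have := p.μ_pos; have := p.lam_pos
  set A := r / (1 + r) ^ 3 with hA
  have hA0 : 0 ≤ A := by positivity
  have e1 : |p.CV * (p.n + 1) * X.P r * X.U r * X.Θ r|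
      ≤ 2 * p.CV * (p.n + 1) * p.P₀ * δ ^ 2 * (r ^ 2 / (1 + r) ^ 5) := by
    rw [abs_mul, abs_mul, abs_mul, abs_of_pos h4, abs_of_pos (by positivity)]
    calc _ ≤ p.CV * (p.n + 1) * (2 * p.P₀) * (δ * (r ^ 2 / (1 + r) ^ 3))
          * (δ * (1 / (1 + r) ^ 2)) := by gcongr
      _ = _ := by field_simp
  have e2 : |p.R * r * X.P r * X.Θ r * X.W r|
      ≤ 2 * p.R * p.P₀ * δ ^ 2 * (r ^ 2 / (1 + r) ^ 5) := by
    rw [abs_mul, abs_mul, abs_mul, abs_of_pos h4, abs_of_pos (by positivity)]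
    calc _ ≤ p.R * r * (2 * p.P₀) * (δ * (1 / (1 + r) ^ 2)) * (δ * A) := by gcongr
      _ = _ := by rw [hA]; field_simp
  have e3 : |X.W r - p.D * (X.U r / r)| ≤ (1 + p.D) * δ * A := by
    calc _ ≤ |X.W r| + |p.D * (X.U r / r)| := abs_sub _ _
      _ ≤ δ * A + p.D * (δ * A) := by
        rw [abs_mul, abs_of_pos h7]
        gcongr
      _ = _ := by ring
  have e4 : (X.W r - p.D * (X.U r / r)) ^ 2 ≤ ((1 + p.D) * δ * A) ^ 2 :=
    sq_le_sq' (abs_le.1 e3).1 (abs_le.1 e3).2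
  have e5 : (X.U r / r) ^ 2 ≤ (δ * A) ^ 2 := sq_le_sq' (abs_le.1 h2).1 (abs_le.1 h2).2
  have e6 : X.W r ^ 2 ≤ (δ * A) ^ 2 := sq_le_sq' (abs_le.1 h8).1 (abs_le.1 h8).2
  have e7 : |r * (2 * p.μ * ((X.W r - p.D * (X.U r / r)) ^ 2 + p.D * (X.U r / r) ^ 2)
      + p.lam * X.W r ^ 2)|
      ≤ (2 * p.μ * ((1 + p.D) ^ 2 + p.D) + p.lam) * δ ^ 2 * (r ^ 2 / (1 + r) ^ 5) := by
    rw [abs_of_nonneg (by positivity)]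
    calc _ ≤ r * (2 * p.μ * (((1 + p.D) * δ * A) ^ 2 + p.D * (δ * A) ^ 2)
          + p.lam * (δ * A) ^ 2) := by gcongr
      _ = (2 * p.μ * ((1 + p.D) ^ 2 + p.D) + p.lam) * δ ^ 2 * (r * A ^ 2) := by ring
      _ ≤ _ := by gcongr; exact mul_sq_div_cube_le hr0.le
  calc |X.energyDeriv p r| ≤ _ := (abs_sub _ _).trans (add_le_add_left (abs_add_le _ _) _)
    _ ≤ _ := add_le_add (add_le_add e1 e2) e7
    _ = _ := by unfold energyConst; ring

theorem abs_le_of_abs_deriv_le {f f' : ℝ → ℝ} {M : ℝ} (hM : 0 ≤ M)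
    (hc : ContinuousOn f (Icc 0 τ)) (hd : ∀ r ∈ Ioo 0 τ, HasDerivAt f (f' r) r) (h0 : f 0 = 0)
    (hle : ∀ r ∈ Ioo 0 τ, |f' r| ≤ M * (r ^ 2 / (1 + r) ^ 5)) (hr : r ∈ Icc 0 τ) :
    |f r| ≤ M * (r / (1 + r)) ^ 2 := by
  have h1 := abs_sub_le_of_abs_deriv_le (φ := fun s => M * (s / (1 + s)) ^ 2)
    (φ' := fun s => M * (2 * (s / (1 + s)) * (1 / (1 + s) ^ 2))) hc
    (continuousOn_const.mul ((continuousOn_div_one_add τ).pow 2)) hd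
    (fun s hs => by
      simpa using ((hasDerivAt_div_one_add hs.1).pow 2).const_mul M) (fun s hs => ?_) hr
  · simpa [h0] using h1
  · refine (hle s hs).trans ?_
    gcongr
    refine (sq_div_fifth_le hs.1.le).trans (le_of_eq ?_)
    have := hs.1
    field_simp

theorem abs_I_le (h : Bounded p Θ₀ δ τ X) (hr : r ∈ Icc 0 τ) :
    |X.I r| ≤ 2 * p.D * p.P₀ * δ ^ 2 * (r / (1 + r)) ^ 2 := by
  have := p.D_pos; have := p.P₀_pos
  exact abs_le_of_abs_deriv_le (by positivity) h.cont_I h.deriv_I h.I_zero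
    (fun s hs => h.abs_momDeriv_le ⟨hs.1.le, hs.2.le⟩ hs.1) hr

theorem abs_J_le (h : Bounded p Θ₀ δ τ X) (hr : r ∈ Icc 0 τ) :
    |X.J r| ≤ energyConst p * δ ^ 2 * (r / (1 + r)) ^ 2 := by
  have := energyConst_pos p
  exact abs_le_of_abs_deriv_le (by positivity) h.cont_J h.deriv_J h.J_zero
    (fun s hs => h.abs_energyDeriv_le ⟨hs.1.le, hs.2.le⟩ hs.1) hr

end Bounded

end SelfSimilarNS

/-! ### Improved estimates, linear in `Θ₀` with constants independent of `δ`. -/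

namespace SelfSimilarNS

/-- The forcing of the velocity equation. -/
noncomputable def Flow.forcing (X : Flow) (p : Params) (Θ₀ r : ℝ) : ℝ :=
  p.R * (X.P r * X.Θ r - p.P₀ * Θ₀) + X.I r

/-- The damping rate of the velocity equation. -/
noncomputable def Flow.damping (X : Flow) (p : Params) (r : ℝ) : ℝ :=
  X.P r * (r / 2 - X.U r) / p.a

theorem one_add_sq_le {η r : ℝ} (hη : 0 < η) :
    (1 + r) ^ 2 ≤ 2 * (1 + 1 / η) * (1 + η * r ^ 2) := by
  have e : 2 * (1 + 1 / η) * (1 + η * r ^ 2) = 2 * (1 + r ^ 2) + 2 * (1 / η + η * r ^ 2) := by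
    field_simp; ring
  rw [e]
  have : 0 ≤ 2 * (1 / η + η * r ^ 2) := by positivity
  nlinarith [sq_nonneg (r - 1)]

namespace Bounded

variable (p : Params)

/-- Solving the law for `J` for `Θ'` gives relaxation towards a forcing of size `Θ₀ / r`. The part
`(n+1)/r` of the rate controls it near the origin, the part growing like `r` controls it far away
and produces the weight `1 + η r²`. -/
theorem exists_abs_Θ_le : ∃ C > 0, ∀ {Θ₀ δ τ : ℝ} {X : Flow}, Bounded p Θ₀ δ τ X →
    ∀ r ∈ Icc 0 τ, |X.Θ r| ≤ C * Θ₀ * (1 / (1 + r) ^ 2) := by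
  have hE := energyConst_pos p
  have hP₀ := p.P₀_pos; have hκ := p.κ_pos; have hCV := p.CV_pos
  -- Makes `4 η r` equal to `C_V P₀ r / (8 κ)`, the lower bound for the damping rate.
  set η := p.CV * p.P₀ / (32 * p.κ) with hη
  have hη0 : 0 < η := by positivity
  set K := 2 * (energyConst p + p.κ * (p.n + 1)) / p.κ with hK
  have hK0 : 0 < K := by positivity
  refine ⟨K * (2 * (1 + 1 / η)), by positivity, fun {Θ₀ δ τ X} h r hr => ?_⟩
  have hΘ₀ := h.Θ₀_pos
  have key := abs_mul_le_of_relaxation (X := X.Θ) (a := 0) (b := τ) (η := η) (M := K * Θ₀)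
    (q := fun s => ((p.n + 1) * p.κ + p.CV * s * (X.P s * (s / 2 - X.U s))) / (p.κ * s))
    (g := fun s => (X.J s + p.κ * (p.n + 1) * Θ₀) / (p.κ * s))
    le_rfl hη0.le (by positivity) h.cont_Θ (fun s hs => ?_) (fun s hs => ?_) (fun s hs => ?_) ?_ hr
  · have h1 := one_add_sq_le (r := r) hη0
    have hr0 := hr.1
    rw [mul_one_div, le_div_iff₀ (by positivity)]
    calc |X.Θ r| * (1 + r) ^ 2 ≤ |X.Θ r| * (2 * (1 + 1 / η) * (1 + η * r ^ 2)) := by gcongr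
      _ = 2 * (1 + 1 / η) * (|X.Θ r| * (1 + η * r ^ 2)) := by ring
      _ ≤ 2 * (1 + 1 / η) * (K * Θ₀) := by gcongr
      _ = _ := by ring
  · refine (h.deriv_Θ s hs).congr_deriv ?_
    have := hs.1.ne'
    simp only [Flow.tempDeriv]
    field_simp
    ring
  · have hs0 := hs.1
    have h1 := h.le_mul_gap ⟨hs.1.le, hs.2.le⟩
    rw [le_div_iff₀ (by positivity)]
    calc 4 * η * s * (p.κ * s) = p.CV * s * (p.P₀ * s / 8) := by rw [hη]; field_simp; ring
      _ ≤ p.CV * s * (X.P s * (s / 2 - X.U s)) := by gcongr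
      _ ≤ _ := by
        have : 0 ≤ (p.n + 1) * p.κ := by positivity
        linarith
  · have hs0 := hs.1
    have h1 := h.le_mul_gap ⟨hs.1.le, hs.2.le⟩
    have h2 := h.abs_J_le ⟨hs.1.le, hs.2.le⟩
    have h3 : (s / (1 + s)) ^ 2 ≤ 1 := pow_le_one₀ (by positivity) (div_one_add_le_one hs0.le)
    have h4 : |X.J s + p.κ * (p.n + 1) * Θ₀| ≤ K / 2 * p.κ * Θ₀ := by
      calc _ ≤ |X.J s| + |p.κ * (p.n + 1) * Θ₀| := abs_add_le _ _
        _ ≤ energyConst p * Θ₀ * 1 + p.κ * (p.n + 1) * Θ₀ := by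
          rw [abs_of_nonneg (by positivity : 0 ≤ p.κ * (p.n + 1) * Θ₀)]
          have := h.sq_le
          gcongr
          refine h2.trans ?_
          gcongr
        _ = _ := by rw [hK]; field_simp
    rw [abs_div, abs_of_pos (by positivity : 0 < p.κ * s), div_mul_eq_mul_div, ← mul_div_assoc]
    refine div_le_div_of_nonneg_right ?_ (by positivity)
    calc _ ≤ K / 2 * p.κ * Θ₀ * (1 + η * s ^ 2) := by gcongr
      _ = K * Θ₀ / 2 * (p.κ * 1 + p.κ * η * s ^ 2) := by ring
      _ ≤ _ := by
        refine mul_le_mul_of_nonneg_left (add_le_add ?_ ?_) (by positivity)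
        · have : (0 : ℝ) ≤ p.n * p.κ := by positivity
          linarith
        · calc p.κ * η * s ^ 2 ≤ p.κ * (4 * η) * s ^ 2 := by gcongr; linarith
            _ = p.CV * s * (p.P₀ * s / 8) := by rw [hη]; field_simp; ring
            _ ≤ _ := by gcongr
  · rw [h.Θ_zero, abs_of_pos hΘ₀]
    have : 2 ≤ K := by
      rw [hK, le_div_iff₀ hκ]
      have : (0 : ℝ) ≤ p.κ * p.n := by positivity
      linarith
    nlinarith

/-- The derivative of `r^(n+1) (Θ - Θ₀)` is `r^n (J - C_V r P (r/2 - U) Θ) / κ = O(Θ₀ r^(n+2))`;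
integrate for the quadratic behaviour at the origin and use boundedness far away. -/
theorem exists_abs_Θ_sub_le : ∃ C > 0, ∀ {Θ₀ δ τ : ℝ} {X : Flow}, Bounded p Θ₀ δ τ X →
    ∀ r ∈ Icc 0 τ, |X.Θ r - Θ₀| ≤ C * Θ₀ * (r / (1 + r)) ^ 2 := by
  obtain ⟨C, hC, hΘ⟩ := exists_abs_Θ_le p
  have hE := energyConst_pos p
  have hP₀ := p.P₀_pos; have hκ := p.κ_pos; have hCV := p.CV_pos
  set K := (energyConst p + 2 * p.CV * p.P₀ * C) / p.κ with hK
  have hK0 : 0 < K := by positivity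
  refine ⟨4 * (K + C + 1), by positivity, fun {Θ₀ δ τ X} h r hr => ?_⟩
  have hΘ₀ := h.Θ₀_pos
  have hr0 := hr.1
  have hΘ' : ∀ s ∈ Icc 0 τ, |X.Θ s| ≤ C * Θ₀ := fun s hs => by
    have hs0 := hs.1
    refine (hΘ h s hs).trans (mul_le_of_le_one_right (by positivity) ?_)
    rw [div_le_one (by positivity)]
    exact one_le_pow₀ (by linarith)
  have key := abs_sub_le_of_abs_deriv_le (f := fun s => s ^ (p.n + 1) * (X.Θ s - Θ₀))
    (f' := fun s => s ^ p.n * ((X.J s - p.CV * s * (X.P s * (s / 2 - X.U s)) * X.Θ s) / p.κ))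
    (φ := fun s => K * Θ₀ / (p.n + 3) * s ^ (p.n + 3)) (φ' := fun s => K * Θ₀ * s ^ (p.n + 2))
    (a := 0) (b := τ) ((continuousOn_pow _).mul (h.cont_Θ.sub continuousOn_const))
    (by fun_prop) (fun s hs => ?_) (fun s hs => ?_) (fun s hs => ?_) hr
  · simp only [ne_eq, Nat.add_eq_zero_iff, one_ne_zero, and_false, not_false_eq_true, zero_pow,
      zero_mul, sub_zero, OfNat.ofNat_ne_zero, mul_zero] at key
    have h1 : |X.Θ r - Θ₀| ≤ (K + C + 1) * Θ₀ * r ^ 2 := by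
      rcases hr0.eq_or_lt with rfl | hr0
      · simp [h.Θ_zero]
      · rw [abs_mul, abs_of_nonneg (by positivity)] at key
        have h2 : K * Θ₀ / (p.n + 3) * r ^ (p.n + 3) ≤ r ^ (p.n + 1) * (K * Θ₀ * r ^ 2) := by
          have : K * Θ₀ / (p.n + 3) ≤ K * Θ₀ :=
            div_le_self (by positivity) (by
              have : (0 : ℝ) ≤ p.n := by positivity
              linarith)
          calc _ ≤ K * Θ₀ * r ^ (p.n + 3) := by gcongr
            _ = _ := by ring
        have h3 := le_of_mul_le_mul_left (key.trans h2) (by positivity)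
        have : 0 ≤ (C + 1) * Θ₀ * r ^ 2 := by positivity
        linarith
    have h2 : |X.Θ r - Θ₀| ≤ (K + C + 1) * Θ₀ := by
      have := abs_sub (X.Θ r) Θ₀
      rw [abs_of_pos hΘ₀] at this
      have := hΘ' r hr
      have : 0 ≤ K * Θ₀ := by positivity
      linarith
    refine (le_sq_weight_of_le hr.1 (by positivity) h1 h2).trans (le_of_eq (by ring))
  · have h1 := (hasDerivAt_pow (p.n + 1) s).mul ((h.deriv_Θ s hs).sub_const Θ₀)
    refine h1.congr_deriv ?_
    have := hs.1.ne'
    simp only [Flow.tempDeriv, Nat.add_sub_cancel]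
    push_cast
    field_simp
    ring
  · have h1 := (hasDerivAt_pow (p.n + 3) s).const_mul (K * Θ₀ / (p.n + 3))
    refine h1.congr_deriv ?_
    push_cast
    field_simp
  · have hs0 := hs.1
    have hs' : s ∈ Icc 0 τ := ⟨hs.1.le, hs.2.le⟩
    have h1 := h.mul_gap_le hs'
    have h1' := h.le_mul_gap hs'
    have h2 := h.abs_J_le hs'
    have h3 : (s / (1 + s)) ^ 2 ≤ s ^ 2 := by
      gcongr
      exact div_le_self hs0.le (by linarith)
    have h4 : |X.J s| ≤ energyConst p * Θ₀ * s ^ 2 := by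
      have := h.sq_le
      refine h2.trans ?_
      gcongr
    have h5 : |p.CV * s * (X.P s * (s / 2 - X.U s)) * X.Θ s|
        ≤ 2 * p.CV * p.P₀ * C * Θ₀ * s ^ 2 := by
      have h6 : 0 ≤ X.P s * (s / 2 - X.U s) := le_trans (by positivity) h1'
      rw [abs_mul, abs_of_nonneg (by positivity)]
      calc _ ≤ p.CV * s * (2 * p.P₀ * s) * (C * Θ₀) := by gcongr; exact hΘ' s hs'
        _ = _ := by ring
    rw [abs_mul, abs_of_nonneg (by positivity), abs_div, abs_of_pos hκ]
    calc s ^ p.n * (|X.J s - p.CV * s * (X.P s * (s / 2 - X.U s)) * X.Θ s| / p.κ)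
        ≤ s ^ p.n * ((energyConst p * Θ₀ * s ^ 2 + 2 * p.CV * p.P₀ * C * Θ₀ * s ^ 2) / p.κ) := by
          gcongr
          exact (abs_sub _ _).trans (add_le_add h4 h5)
      _ = _ := by rw [hK]; ring

/-- The derivative is read off from the law for `J`, so no second-order estimate is needed. -/
theorem exists_abs_tempDeriv_le : ∃ C > 0, ∀ {Θ₀ δ τ : ℝ} {X : Flow}, Bounded p Θ₀ δ τ X →
    ∀ r ∈ Icc 0 τ, 0 < r → |X.tempDeriv p Θ₀ r| ≤ C * Θ₀ * (r / (1 + r) ^ 2) := by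
  obtain ⟨C, hC, hΘ⟩ := exists_abs_Θ_le p
  obtain ⟨C', hC', hΘ'⟩ := exists_abs_Θ_sub_le p
  have hE := energyConst_pos p
  have hP₀ := p.P₀_pos; have hκ := p.κ_pos; have hCV := p.CV_pos
  refine ⟨(energyConst p + 2 * p.CV * p.P₀ * C) / p.κ + (p.n + 1) * C', by positivity,
    fun {Θ₀ δ τ X} h r hr hr0 => ?_⟩
  have hΘ₀ := h.Θ₀_pos
  have h1 := h.mul_gap_le hr
  have h1' := h.le_mul_gap hr
  have h2 := h.abs_J_le hr
  have h3 := hΘ h r hr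
  have h4 := hΘ' h r hr
  have h5 := h.sq_le
  have h6 : 0 ≤ X.P r * (r / 2 - X.U r) := le_trans (by positivity) h1'
  have e1 : |p.CV * X.P r * (r * (r / 2 - X.U r)) * X.Θ r|
      ≤ 2 * p.CV * p.P₀ * C * Θ₀ * (r / (1 + r)) ^ 2 := by
    rw [show p.CV * X.P r * (r * (r / 2 - X.U r)) * X.Θ r
      = p.CV * r * (X.P r * (r / 2 - X.U r)) * X.Θ r by ring, abs_mul,
      abs_of_nonneg (by positivity)]
    calc _ ≤ p.CV * r * (2 * p.P₀ * r) * (C * Θ₀ * (1 / (1 + r) ^ 2)) := by gcongr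
      _ = _ := by field_simp
  have e2 : |X.J r| ≤ energyConst p * Θ₀ * (r / (1 + r)) ^ 2 := by
    refine h2.trans ?_
    gcongr
  calc |X.tempDeriv p Θ₀ r| ≤ _ := abs_sub _ _
    _ = |X.J r - p.CV * X.P r * (r * (r / 2 - X.U r)) * X.Θ r| / (p.κ * r)
        + (p.n + 1) * |X.Θ r - Θ₀| / r := by
      rw [abs_div, abs_div, abs_of_pos (by positivity : 0 < p.κ * r), abs_of_pos hr0, abs_mul,
        abs_of_pos (by positivity : (0 : ℝ) < p.n + 1)]
    _ ≤ (energyConst p * Θ₀ * (r / (1 + r)) ^ 2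
          + 2 * p.CV * p.P₀ * C * Θ₀ * (r / (1 + r)) ^ 2) / (p.κ * r)
        + (p.n + 1) * (C' * Θ₀ * (r / (1 + r)) ^ 2) / r := by
      gcongr
      exact (abs_sub _ _).trans (add_le_add e2 e1)
    _ = _ := by field_simp

/-- Split `P Θ - P₀ Θ₀ = (P - P₀) Θ + P₀ (Θ - Θ₀)`. The first product and `I` are `O(δ²)`, which `δ²
≤ Θ₀` turns into `O(Θ₀)`. -/
theorem exists_abs_forcing_le : ∃ C > 0, ∀ {Θ₀ δ τ : ℝ} {X : Flow}, Bounded p Θ₀ δ τ X →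
    ∀ r ∈ Icc 0 τ, |X.forcing p Θ₀ r| ≤ C * Θ₀ * (r / (1 + r)) := by
  obtain ⟨C, hC, hΘ⟩ := exists_abs_Θ_sub_le p
  have hP₀ := p.P₀_pos; have hR := p.R_pos; have hD := p.D_pos
  refine ⟨p.R * (8 * p.P₀ + p.P₀ * C) + 2 * p.D * p.P₀, by positivity,
    fun {Θ₀ δ τ X} h r hr => ?_⟩
  have hΘ₀ := h.Θ₀_pos
  have hr0 := hr.1
  have hδ := h.δ_pos
  have h1 := h.abs_P_sub_le hr
  have h2 := hΘ h r hr
  have h3 := h.abs_I_le hr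
  have h4 := sq_div_le_div hr0
  have h5 := h.sq_le
  have h6 : |X.Θ r| ≤ δ := by
    refine (h.abs_Θ_le r hr).trans (mul_le_of_le_one_right hδ.le ?_)
    rw [div_le_one (by positivity)]
    exact one_le_pow₀ (by linarith)
  have e : X.forcing p Θ₀ r = p.R * ((X.P r - p.P₀) * X.Θ r + p.P₀ * (X.Θ r - Θ₀)) + X.I r := by
    unfold Flow.forcing; ring
  rw [e]
  set y := r / (1 + r) with hy
  have hy0 : 0 ≤ y := by positivity
  calc _ ≤ |p.R * ((X.P r - p.P₀) * X.Θ r + p.P₀ * (X.Θ r - Θ₀))| + |X.I r| := abs_add_le _ _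
    _ ≤ p.R * (|X.P r - p.P₀| * |X.Θ r| + p.P₀ * |X.Θ r - Θ₀|) + |X.I r| := by
      rw [abs_mul, abs_of_pos hR]
      gcongr
      refine (abs_add_le _ _).trans ?_
      rw [abs_mul, abs_mul, abs_of_pos hP₀]
    _ ≤ p.R * (8 * p.P₀ * δ * y * δ + p.P₀ * (C * Θ₀ * y ^ 2))
        + 2 * p.D * p.P₀ * δ ^ 2 * y ^ 2 := by gcongr
    _ = p.R * (8 * p.P₀ * δ ^ 2 * y + p.P₀ * (C * Θ₀ * y ^ 2))
        + 2 * p.D * p.P₀ * δ ^ 2 * y ^ 2 := by ring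
    _ ≤ p.R * (8 * p.P₀ * Θ₀ * y + p.P₀ * (C * Θ₀ * y))
        + 2 * p.D * p.P₀ * Θ₀ * y := by gcongr
    _ = _ := by ring

theorem velDeriv_eq {p : Params} {Θ₀ δ τ r : ℝ} {X : Flow} (h : Bounded p Θ₀ δ τ X)
    (hr : r ∈ Icc 0 τ) : X.velDeriv p r
      = X.forcing p Θ₀ r / p.a - X.damping p r * X.U r - p.D * (X.U r / r) := by
  have ha := p.a_pos.ne'
  have h1 : X.W r = X.forcing p Θ₀ r / p.a - X.damping p r * X.U r := by
    have := h.W_eq r hr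
    unfold Flow.forcing Flow.damping
    field_simp
    linarith
  rw [Flow.velDeriv, h1]

theorem le_damping {p : Params} {Θ₀ δ τ r : ℝ} {X : Flow} (h : Bounded p Θ₀ δ τ X)
    (hr : r ∈ Icc 0 τ) : p.P₀ / (8 * p.a) * r ≤ X.damping p r := by
  have ha := p.a_pos
  have := h.le_mul_gap hr
  unfold Flow.damping
  rw [le_div_iff₀ ha]
  calc _ = p.P₀ * r / 8 := by field_simp
    _ ≤ _ := this

/-- Two relaxation equations: `r U` has rate at least of order `r` against a forcing of order `r`,
so it is bounded; `U / r²` has the singular rate `(D + 2)/r` against a forcing of order `1/r`, which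
gives the quadratic behaviour at the origin. -/
theorem exists_abs_U_le : ∃ C > 0, ∀ {Θ₀ δ τ : ℝ} {X : Flow}, Bounded p Θ₀ δ τ X →
    ∀ r ∈ Icc 0 τ, |X.U r| ≤ C * Θ₀ * (r ^ 2 / (1 + r) ^ 3) := by
  obtain ⟨C, hC, hF⟩ := exists_abs_forcing_le p
  have hP₀ := p.P₀_pos; have ha := p.a_pos; have hD := p.D_pos
  set K := 16 * C / p.P₀ with hK
  have hK0 : 0 < K := by positivity
  set K' := 2 * C / p.a with hK'
  have hK0' : 0 < K' := by positivity
  refine ⟨8 * (K' + K), by positivity, fun {Θ₀ δ τ X} h r hr => ?_⟩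
  have hΘ₀ := h.Θ₀_pos
  have h1 := abs_mul_le_of_relaxation (X := fun s => s * X.U s) (a := 0) (b := τ) (η := 0)
    (M := K * Θ₀) (q := fun s => X.damping p s + (p.n + 1) / s)
    (g := fun s => s * X.forcing p Θ₀ s / p.a) le_rfl le_rfl (by positivity)
    (continuousOn_id.mul h.cont_U) (fun s hs => by
      have := hs.1.ne'
      have hs' : s ∈ Icc 0 τ := ⟨hs.1.le, hs.2.le⟩
      refine ((hasDerivAt_id s).mul (h.deriv_U s hs)).congr_deriv ?_
      rw [h.velDeriv_eq hs']
      simp only [id, Params.D]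
      field_simp
      ring) (fun s hs => by
      have := hs.1
      have := h.le_damping (r := s) ⟨hs.1.le, hs.2.le⟩
      have : 0 ≤ X.damping p s := le_trans (by positivity) this
      simp only [mul_zero, zero_mul]
      positivity) (fun s hs => by
      have hs0 := hs.1
      have h2 := hF h s ⟨hs.1.le, hs.2.le⟩
      have h3 := h.le_damping (r := s) ⟨hs.1.le, hs.2.le⟩
      have h4 : C * Θ₀ * (s / (1 + s)) ≤ C * Θ₀ :=
        mul_le_of_le_one_right (by positivity) (div_one_add_le_one hs0.le)
      rw [zero_mul, add_zero, mul_one, abs_div, abs_mul, abs_of_pos hs0, abs_of_pos ha]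
      calc s * |X.forcing p Θ₀ s| / p.a ≤ s * (C * Θ₀) / p.a := by gcongr; linarith
        _ = K * Θ₀ / 2 * (p.P₀ / (8 * p.a) * s) := by rw [hK]; field_simp; norm_num
        _ ≤ _ := by
          gcongr
          have : 0 ≤ (p.n + 1) / s := by positivity
          linarith) (by simp; positivity) hr
  have h2 : |X.U r| ≤ K' * Θ₀ * r ^ 2 := by
    rcases hr.1.eq_or_lt with rfl | hr0
    · simp [h.U_zero]
    -- The equation for `U / s²` is singular at `0`, so the comparison starts at a small `b > 0`,
    -- where flatness supplies the initial bound.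
    have hev : ∀ᶠ s in 𝓝[>] (0 : ℝ), |X.U s / s ^ 2| < K' * Θ₀ := by
      have h3 := h.U_flat.abs
      rw [abs_zero] at h3
      exact h3.eventually_lt_const (by positivity)
    obtain ⟨b, hb, hb0, hbr⟩ := (hev.and (Ioo_mem_nhdsGT hr0)).exists
    have hsub : Ioo b τ ⊆ Ioo 0 τ := Ioo_subset_Ioo_left hb0.le
    have h3 := abs_mul_le_of_relaxation (X := fun s => X.U s / s ^ 2) (a := b) (b := τ) (η := 0)
      (M := K' * Θ₀) (q := fun s => X.damping p s + (p.D + 2) / s)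
      (g := fun s => X.forcing p Θ₀ s / (p.a * s ^ 2)) hb0.le le_rfl (by positivity)
      ((h.cont_U.mono (Icc_subset_Icc_left hb0.le)).div (by fun_prop) fun s hs => by
        have : 0 < s := hb0.trans_le hs.1
        positivity) (fun s hs => by
        have hs0 : s ≠ 0 := (hsub hs).1.ne'
        have hs' : s ∈ Icc 0 τ := ⟨(hsub hs).1.le, hs.2.le⟩
        refine ((h.deriv_U s (hsub hs)).div (hasDerivAt_pow 2 s) (by positivity)).congr_deriv ?_
        rw [h.velDeriv_eq hs']
        field_simp
        push_cast
        ring) (fun s hs => by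
        have := (hsub hs).1
        have := h.le_damping (r := s) ⟨(hsub hs).1.le, hs.2.le⟩
        have : 0 ≤ X.damping p s := le_trans (by positivity) this
        simp only [mul_zero, zero_mul]
        positivity) (fun s hs => by
        have hs0 := (hsub hs).1
        have h2 := hF h s ⟨(hsub hs).1.le, hs.2.le⟩
        have h3 := h.le_damping (r := s) ⟨(hsub hs).1.le, hs.2.le⟩
        have h3' : 0 ≤ X.damping p s := le_trans (by positivity) h3
        have h4 : C * Θ₀ * (s / (1 + s)) ≤ C * Θ₀ * s := by
          gcongr
          exact div_le_self hs0.le (by linarith)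
        rw [zero_mul, add_zero, mul_one, abs_div, abs_of_pos (by positivity : 0 < p.a * s ^ 2)]
        calc |X.forcing p Θ₀ s| / (p.a * s ^ 2) ≤ C * Θ₀ * s / (p.a * s ^ 2) := by
              gcongr; linarith
          _ = K' * Θ₀ / 2 * (1 / s) := by rw [hK']; field_simp
          _ ≤ _ := by
            gcongr
            have : 1 / s ≤ (p.D + 2) / s := by gcongr; linarith
            linarith) (by simpa using hb.le) ⟨hbr.le, hr.2⟩
    rw [zero_mul, add_zero, mul_one, abs_div, abs_of_pos (by positivity : 0 < r ^ 2),
      div_le_iff₀ (by positivity)] at h3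
    exact h3
  have h3 := le_weight_of_le 2 hr.1 (by positivity : 0 ≤ K' * Θ₀)
    (by positivity : 0 ≤ K * Θ₀) h2 (fun h1r => by
      rw [zero_mul, add_zero, mul_one, abs_mul, abs_of_nonneg hr.1] at h1
      calc |X.U r| * r ^ 3 = r * |X.U r| * r ^ 2 := by ring
        _ ≤ _ := by gcongr)
  refine h3.trans (le_of_eq (by ring))

/-- The algebraic law alone gives `O(Θ₀ r / (1 + r))`, good near the origin but merely bounded at
infinity. From `r = 1` on, the relaxation equation for `W`, with forcing `O(Θ₀ / r)`, improves this
to `O(Θ₀ r⁻²)`. -/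
theorem exists_abs_W_le : ∃ C > 0, ∀ {Θ₀ δ τ : ℝ} {X : Flow}, Bounded p Θ₀ δ τ X →
    ∀ r ∈ Icc 0 τ, |X.W r| ≤ C * Θ₀ * (r / (1 + r) ^ 3) := by
  obtain ⟨CF, hCF, hF⟩ := exists_abs_forcing_le p
  obtain ⟨CU, hCU, hU⟩ := exists_abs_U_le p
  obtain ⟨CT, hCT, hT⟩ := exists_abs_tempDeriv_le p
  have hP₀ := p.P₀_pos; have ha := p.a_pos; have hD := p.D_pos; have hR := p.R_pos
  set η := p.P₀ / (32 * p.a) with hη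
  have hη0 : 0 < η := by positivity
  set K := (CF + 2 * p.P₀ * CU) / p.a with hK
  have hK0 : 0 < K := by positivity
  set G := (p.R * (8 * p.P₀ + 2 * p.P₀ * CT) + 2 * p.P₀ * CU * (2 * p.D + 1)) / p.a with hG
  have hG0 : 0 < G := by positivity
  -- The first summand covers the initial value at `r = 1`, the second the forcing.
  set M := K * (1 + η) + 16 * p.a * G * (1 + η) / p.P₀ with hM
  have hM0 : 0 < M := by positivity
  have hUr : ∀ {Θ₀ δ τ : ℝ} {X : Flow}, Bounded p Θ₀ δ τ X →
      ∀ r ∈ Icc 0 τ, r * |X.U r| ≤ CU * Θ₀ * (r / (1 + r)) := by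
    intro Θ₀ δ τ X h r hr
    have hr0 := hr.1
    have hΘ₀ := h.Θ₀_pos
    have h1 := div_one_add_le_one hr0
    have h2 : 0 ≤ r / (1 + r) := by positivity
    calc r * |X.U r| ≤ r * (CU * Θ₀ * (r ^ 2 / (1 + r) ^ 3)) := by gcongr; exact hU h r hr
      _ = CU * Θ₀ * ((r / (1 + r)) * ((r / (1 + r)) * (r / (1 + r)))) := by field_simp
      _ ≤ CU * Θ₀ * ((r / (1 + r)) * (1 * 1)) := by gcongr
      _ = _ := by ring
  refine ⟨8 * (K + M / η), by positivity, fun {Θ₀ δ τ X} h r hr => ?_⟩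
  have hΘ₀ := h.Θ₀_pos
  have hlin : ∀ r ∈ Icc 0 τ, |X.W r| ≤ K * Θ₀ * (r / (1 + r)) := by
    intro r hr
    have hr0 := hr.1
    have h1 := h.W_eq r hr
    have h2 := hF h r hr
    have h3 := h.mul_gap_le hr
    have h3' := h.le_mul_gap hr
    have h4 : 0 ≤ X.P r * (r / 2 - X.U r) := le_trans (by positivity) h3'
    have h5 : p.a * |X.W r| ≤ (CF + 2 * p.P₀ * CU) * Θ₀ * (r / (1 + r)) := by
      calc p.a * |X.W r| = |p.a * X.W r| := by rw [abs_mul, abs_of_pos ha]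
        _ = |X.forcing p Θ₀ r - X.P r * (r / 2 - X.U r) * X.U r| := by
          rw [h1]; congr 1; unfold Flow.forcing; ring
        _ ≤ |X.forcing p Θ₀ r| + |X.P r * (r / 2 - X.U r) * X.U r| := abs_sub _ _
        _ ≤ CF * Θ₀ * (r / (1 + r)) + 2 * p.P₀ * (CU * Θ₀ * (r / (1 + r))) := by
          rw [abs_mul, abs_of_nonneg h4]
          refine add_le_add h2 ?_
          calc _ ≤ 2 * p.P₀ * r * |X.U r| := mul_le_mul_of_nonneg_right h3 (abs_nonneg _)
            _ = 2 * p.P₀ * (r * |X.U r|) := by ring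
            _ ≤ _ := mul_le_mul_of_nonneg_left (hUr h r hr) (by positivity)
        _ = _ := by ring
    calc |X.W r| = p.a * |X.W r| / p.a := by field_simp
      _ ≤ (CF + 2 * p.P₀ * CU) * Θ₀ * (r / (1 + r)) / p.a := by gcongr
      _ = _ := by rw [hK]; ring
  have h3 := le_weight_of_le (x := |X.W r|) (r := r) 1 hr.1 (by positivity : 0 ≤ K * Θ₀)
    (by positivity : 0 ≤ M / η * Θ₀) (by
      refine (hlin r hr).trans ?_
      have := hr.1
      rw [pow_one]
      gcongr
      exact div_le_self this (by linarith)) (fun h1r => ?_)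
  · rw [pow_one] at h3
    exact h3.trans (le_of_eq (by ring))
  have hτ : 1 ≤ τ := h1r.trans hr.2
  have hsub : Icc 1 τ ⊆ Icc 0 τ := Icc_subset_Icc_left zero_le_one
  have key := abs_mul_le_of_relaxation (X := X.W) (a := 1) (b := τ) (η := η)
    (M := M * Θ₀) (q := X.damping p)
    (g := fun s => (p.R * (X.densDeriv s * X.Θ s + X.P s * X.tempDeriv p Θ₀ s)
      + X.P s * X.U s * ((p.D - 1) / 2 - p.D * (X.U s / s))) / p.a) zero_le_one hη0.le
    (by positivity) (h.cont_W.mono hsub) (fun s hs => ?_) (fun s hs => ?_) (fun s hs => ?_) ?_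
    ⟨h1r, hr.2⟩
  · have hr0 : 0 < r := by linarith
    calc |X.W r| * r ^ 3 = |X.W r| * (η * r ^ 2) / η * r := by field_simp
      _ ≤ |X.W r| * (1 + η * r ^ 2) / η * r := by gcongr; linarith
      _ ≤ M * Θ₀ / η * r := by gcongr
      _ = _ := by ring
  · have hs' : s ∈ Icc 0 τ := hsub ⟨hs.1.le, hs.2.le⟩
    have hs0 : 0 < s := by linarith [hs.1]
    have hg := (h.gap hs').1
    refine (h.deriv_W ⟨hs0, hs.2⟩ (by linarith)).congr_deriv ?_
    unfold Flow.divDeriv Flow.damping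
    ring
  · have hs' : s ∈ Icc 0 τ := hsub ⟨hs.1.le, hs.2.le⟩
    refine le_trans (le_of_eq ?_) (h.le_damping hs')
    rw [hη]; field_simp; ring
  · have hs' : s ∈ Icc 0 τ := hsub ⟨hs.1.le, hs.2.le⟩
    have hs1 := hs.1
    have hs0 : 0 < s := by linarith
    have hP := h.P_pos hs'
    have hP2 := h.P_le s hs'
    have hδ := h.δ_pos
    have hinv : 1 / (1 + s) ^ 3 ≤ 1 / s := by
      apply one_div_le_one_div_of_le hs0
      calc s ≤ (1 + s) ^ 1 := by rw [pow_one]; linarith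
        _ ≤ (1 + s) ^ 3 := pow_le_pow_right₀ (by linarith) (by norm_num)
    have e1 : |X.densDeriv s * X.Θ s| ≤ 8 * p.P₀ * Θ₀ * (1 / s) := by
      have h1 := h.abs_densDeriv_le hs' hs0
      have h2 := h.abs_Θ_le s hs'
      have h3 : 1 / (1 + s) ^ 2 ≤ 1 := by
        rw [div_le_one (by positivity)]
        exact one_le_pow₀ (by linarith)
      have h4 := h.sq_le
      rw [abs_mul]
      calc _ ≤ 8 * p.P₀ * δ * (1 / (1 + s) ^ 3) * (δ * (1 / (1 + s) ^ 2)) := by gcongr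
        _ ≤ 8 * p.P₀ * δ * (1 / s) * (δ * 1) := by gcongr
        _ = 8 * p.P₀ * δ ^ 2 * (1 / s) := by ring
        _ ≤ _ := by gcongr
    have e2 : |X.P s * X.tempDeriv p Θ₀ s| ≤ 2 * p.P₀ * (CT * Θ₀ * (1 / s)) := by
      rw [abs_mul, abs_of_pos hP]
      gcongr
      refine (hT h s hs' hs0).trans (mul_le_mul_of_nonneg_left ?_ (by positivity))
      rw [div_le_div_iff₀ (by positivity) hs0]
      nlinarith
    have e3 : |X.U s| ≤ CU * Θ₀ * (1 / s) := by
      have h1 := hUr h s hs'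
      have h2 : CU * Θ₀ * (s / (1 + s)) ≤ CU * Θ₀ :=
        mul_le_of_le_one_right (by positivity) (div_one_add_le_one hs0.le)
      rw [mul_one_div, le_div_iff₀ hs0]
      linarith
    have e4 : |(p.D - 1) / 2 - p.D * (X.U s / s)| ≤ 2 * p.D + 1 := by
      have h1 := h.abs_U_le s hs'
      have h2 := sq_div_cube_le hs0.le
      have h3 : |X.U s / s| ≤ 1 := by
        rw [abs_div, abs_of_pos hs0, div_le_one hs0]
        have := h.δ_le
        calc |X.U s| ≤ δ * (s ^ 2 / (1 + s) ^ 3) := h1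
          _ ≤ 1 * s := by gcongr; linarith
          _ = s := one_mul s
      have h4 := abs_le.1 h3
      rw [abs_le]
      constructor <;> nlinarith
    have e5 : |(p.R * (X.densDeriv s * X.Θ s + X.P s * X.tempDeriv p Θ₀ s)
        + X.P s * X.U s * ((p.D - 1) / 2 - p.D * (X.U s / s))) / p.a| ≤ G * Θ₀ * (1 / s) := by
      rw [abs_div, abs_of_pos ha, div_le_iff₀ ha]
      calc _ ≤ p.R * (|X.densDeriv s * X.Θ s| + |X.P s * X.tempDeriv p Θ₀ s|)
          + X.P s * |X.U s| * |(p.D - 1) / 2 - p.D * (X.U s / s)| := by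
            refine (abs_add_le _ _).trans ?_
            rw [abs_mul, abs_mul, abs_mul, abs_of_pos hR, abs_of_pos hP]
            gcongr
            exact abs_add_le _ _
        _ ≤ p.R * (8 * p.P₀ * Θ₀ * (1 / s) + 2 * p.P₀ * (CT * Θ₀ * (1 / s)))
          + 2 * p.P₀ * (CU * Θ₀ * (1 / s)) * (2 * p.D + 1) := by gcongr
        _ = _ := by rw [hG]; field_simp
    have e6 : 1 + η * s ^ 2 ≤ (1 + η) * s ^ 2 := by
      have : 1 ≤ s ^ 2 := one_le_pow₀ hs1.le
      linarith
    calc _ ≤ G * Θ₀ * (1 / s) * ((1 + η) * s ^ 2) := by gcongr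
      _ = 16 * p.a * G * (1 + η) / p.P₀ * Θ₀ / 2 * (p.P₀ / (8 * p.a) * s) := by
        field_simp; norm_num
      _ ≤ M * Θ₀ / 2 * (p.P₀ / (8 * p.a) * s) := by
        gcongr
        rw [hM]
        have : 0 ≤ K * (1 + η) := by positivity
        linarith
      _ ≤ _ := by gcongr; exact h.le_damping hs'
  · have h1 := hlin 1 ⟨zero_le_one, hτ⟩
    rw [one_pow, mul_one]
    calc |X.W 1| * (1 + η) ≤ K * Θ₀ * (1 / (1 + 1)) * (1 + η) := by gcongr
      _ ≤ K * Θ₀ * 1 * (1 + η) := by gcongr; norm_num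
      _ ≤ M * Θ₀ := by
        rw [hM]
        have : 0 ≤ 16 * p.a * G * (1 + η) / p.P₀ * Θ₀ := by positivity
        linarith

end Bounded

end SelfSimilarNS

/-! ### Global existence: closing the continuity argument. -/

namespace SelfSimilarNS

/-- The flow described by the rescaled unknowns. -/
noncomputable def toFlow (p : Params) (Θ₀ : ℝ) (z : ℝ → Fin 5 → ℝ) : Flow where
  P r := p.dens r (z r)
  U r := r ^ 2 * z r 0
  W r := r * p.cutField Θ₀ r (z r) 0
  Θ r := p.temp Θ₀ r (z r)
  I r := r ^ 2 * z r 3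
  J r := r ^ 2 * z r 4

/-- The integral form of the truncated system on the half line. -/
structure IsMild (p : Params) (Θ₀ : ℝ) (z : ℝ → Fin 5 → ℝ) : Prop where
  cont : Continuous z
  eq_avg : ∀ r, 0 ≤ r → z r = avg p.expo (fun s => p.cutField Θ₀ s (z s)) r

section

variable {p : Params} {Θ₀ : ℝ} {z : ℝ → Fin 5 → ℝ}

theorem IsMild.cont_field (hz : IsMild p Θ₀ z) : Continuous fun s => p.cutField Θ₀ s (z s) :=
  (p.continuous_cutField Θ₀).comp (continuous_id.prodMk hz.cont)

theorem IsMild.hasDerivAt (hz : IsMild p Θ₀ z) (i : Fin 5) {r : ℝ} (hr : 0 < r) :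
    HasDerivAt (fun s => z s i)
      ((p.cutField Θ₀ r (z r) i - (p.expo i + 1) * z r i) / r) r := by
  have h1 := hasDerivAt_of_eq_avg hz.cont_field hz.eq_avg i hr
  have h2 := h1.div (hasDerivAt_pow (p.expo i + 1) r) (pow_ne_zero _ hr.ne')
  refine (h2.congr_of_eventuallyEq ?_).congr_deriv ?_
  · filter_upwards [lt_mem_nhds hr] with s hs
    have : s ^ (p.expo i + 1) ≠ 0 := (pow_pos hs _).ne'
    simp only [Pi.div_apply]
    rw [mul_div_cancel_left₀ _ this]
  · rw [Nat.add_sub_cancel]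
    push_cast
    field_simp
    ring

/-- At `r = 0` the averaged equation is an algebraic fixed point equation for a contraction fixing
`0`; this is uniqueness on the degenerate interval `[0, 0]`. -/
theorem IsMild.zero (hz : IsMild p Θ₀ z) (hΘ₀ : 0 ≤ Θ₀) (hsmall : 8 * p.R * p.P₀ * Θ₀ ≤ p.a) :
    z 0 = 0 := by
  obtain ⟨C, hC, m, hlip, -⟩ := p.exists_lipschitz_cutField hΘ₀ hsmall
  exact eqOn_of_eq_avg (z' := fun _ => 0) (p.continuous_cutField Θ₀) hC hlip le_rfl
    hz.cont.continuousOn continuousOn_const (fun r hr => hz.eq_avg r hr.1)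
    (fun r hr => by
      funext i
      have hr0 : r = 0 := le_antisymm hr.2 hr.1
      simp [avg, hr0, p.cutField_zero]) (left_mem_Icc.2 le_rfl)

/-- Inside the box the truncation is the identity, so the averaged equation is the genuine system.
The condition `z 0 = 0` supplies the flatness `U = o(r²)`. -/
theorem solves_toFlow (hz : IsMild p Θ₀ z) (h0 : z 0 = 0) {τ : ℝ}
    (hbox : ∀ s ∈ Icc 0 τ, InBox s (z s)) : Solves p Θ₀ τ (toFlow p Θ₀ z) := by
  have hc : ∀ i, Continuous fun s => z s i := fun i => (continuous_apply i).comp hz.cont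
  have hcf : ∀ i, Continuous fun s => p.cutField Θ₀ s (z s) i :=
    fun i => (continuous_apply i).comp hz.cont_field
  have hκ := p.κ_pos.ne'
  have hΛ := p.Λ_pos.ne'
  have ha := p.a_pos.ne'
  have hc0 := hc 0; have hc1 := hc 1; have hc2 := hc 2; have hc3 := hc 3; have hc4 := hc 4
  have hcut : ∀ s ∈ Icc 0 τ, p.cutField Θ₀ s (z s) = p.field Θ₀ s (z s) := fun s hs => by
    rw [Params.cutField, clamp_eq (hbox s hs)]
  have hd : ∀ r ∈ Ioo 0 τ, ∀ i, HasDerivAt (fun s => z s i)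
      ((p.field Θ₀ r (z r) i - (p.expo i + 1) * z r i) / r) r := fun r hr i => by
    rw [← hcut r ⟨hr.1.le, hr.2.le⟩]; exact hz.hasDerivAt i hr.1
  have hw : ∀ s ∈ Icc 0 τ, (toFlow p Θ₀ z).W s = s * p.divHat Θ₀ s (z s) := fun s hs => by
    simp only [toFlow, hcut s hs]
    simp [Params.field]
  constructor
  · simp only [toFlow, Params.dens]; fun_prop
  · simp only [toFlow]; fun_prop
  · exact (continuous_id.mul (hcf 0)).continuousOn
  · simp only [toFlow, Params.temp]; fun_prop
  · simp only [toFlow]; fun_prop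
  · simp only [toFlow]; fun_prop
  · simp [toFlow, Params.dens]
  · simp [toFlow]
  · simp [toFlow, Params.temp]
  · simp [toFlow]
  · simp [toFlow]
  · have h1 : Tendsto (fun s => z s 0) (𝓝[>] 0) (𝓝 0) := by
      have := (hc0.tendsto 0).mono_left (nhdsWithin_le_nhds (s := Ioi 0))
      simpa [h0] using this
    refine h1.congr' ?_
    filter_upwards [self_mem_nhdsWithin] with s hs
    have : s ^ 2 ≠ 0 := pow_ne_zero 2 (ne_of_gt hs)
    simp only [toFlow]
    rw [mul_div_cancel_left₀ _ this]
  · intro r hr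
    have hr0 := hr.1.ne'
    refine ((hasDerivAt_pow 2 r).mul (hd r hr 0)).congr_deriv ?_
    rw [Flow.velDeriv, hw r ⟨hr.1.le, hr.2.le⟩]
    simp [toFlow, Params.field, Params.expo, Params.D]
    field_simp
    ring
  · intro r hr
    have hr0 := hr.1.ne'
    have hgap : (1 / 2 - r * z r 0) ≠ 0 := by
      have := (abs_le.1 ((hbox r ⟨hr.1.le, hr.2.le⟩).abs_mul_le 0)).2
      linarith
    have hgap' : r / 2 - r ^ 2 * z r 0 = r * (1 / 2 - r * z r 0) := by ring
    refine ((((hasDerivAt_id r).mul (hd r hr 1)).const_add 1).const_mul p.P₀).congr_deriv ?_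
    rw [Flow.densDeriv, hw r ⟨hr.1.le, hr.2.le⟩]
    simp only [toFlow, hgap', Params.field, Params.expo, Params.dens]
    generalize p.divHat Θ₀ r (z r) = w
    generalize 1 / 2 - r * z r 0 = g at hgap
    simp
    field_simp
    ring
  · intro r hr
    have hr0 := hr.1.ne'
    refine (((hasDerivAt_id r).mul ((hd r hr 2).div_const p.Λ)).const_add Θ₀).congr_deriv ?_
    rw [Flow.tempDeriv]
    simp [toFlow, Params.field, Params.expo, Params.temp]
    field_simp
    ring
  · intro r hr
    have hr0 := hr.1.ne'
    refine ((hasDerivAt_pow 2 r).mul (hd r hr 3)).congr_deriv ?_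
    rw [Flow.momDeriv]
    simp [toFlow, Params.field, Params.expo]
    field_simp
    ring
  · intro r hr
    have hr0 := hr.1.ne'
    refine ((hasDerivAt_pow 2 r).mul (hd r hr 4)).congr_deriv ?_
    rw [Flow.energyDeriv, hw r ⟨hr.1.le, hr.2.le⟩]
    simp [toFlow, Params.field, Params.expo]
    field_simp
    ring
  · intro r hr
    rw [hw r hr, Params.divHat]
    simp only [toFlow, Params.dens, Params.temp]
    field_simp
    ring

/-- Every component is bounded by a small constant over `1 + τ`, the decay rate of the box width
itself. -/
theorem norm_lt_boxWidth {δ τ CU CS : ℝ} (hB : Bounded p Θ₀ δ τ (toFlow p Θ₀ z)) (hτ0 : 0 < τ)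
    (e0 : |z τ 0| ≤ CU * Θ₀ / (1 + τ) ^ 3)
    (hS : |(toFlow p Θ₀ z).Θ τ - Θ₀| ≤ CS * Θ₀ * (τ / (1 + τ)) ^ 2) (hδ : 32 * δ < 1)
    (hCU : 4 * (CU * Θ₀) < 1) (hCS : 4 * (p.Λ * CS * Θ₀) < 1)
    (hD : 4 * (2 * p.D * p.P₀ * Θ₀) < 1) (hE : 4 * (Bounded.energyConst p * Θ₀) < 1) :
    ‖z τ‖ < boxWidth τ := by
  have hP₀ := p.P₀_pos; have hD0 := p.D_pos; have hΛ := p.Λ_pos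
  have hE0 := Bounded.energyConst_pos p
  have hΘ₀ := hB.Θ₀_pos
  have hδsq := hB.sq_le
  have hin : τ ∈ Icc 0 τ := ⟨hτ0.le, le_rfl⟩
  have hgt1 : 1 ≤ 1 + τ := by linarith
  have hCU0 : 0 ≤ CU * Θ₀ := by
    have := (abs_nonneg _).trans e0
    rw [le_div_iff₀ (by positivity), zero_mul] at this
    exact this
  have hCS0 : 0 ≤ CS * Θ₀ := by
    have := (abs_nonneg _).trans hS
    exact nonneg_of_mul_nonneg_left this (by positivity)
  have hbw : boxWidth τ = 1 / 4 / (1 + τ) := by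
    rw [boxWidth, abs_of_pos hτ0]; field_simp
  rw [pi_norm_lt_iff (boxWidth_pos τ)]
  have hfin : ∀ {x c : ℝ}, x ≤ c / (1 + τ) → c < 1 / 4 → x < boxWidth τ := by
    intro x c h1 h2
    rw [hbw]
    refine h1.trans_lt ?_
    gcongr
  intro i
  fin_cases i
  · refine hfin (c := CU * Θ₀) (e0.trans ?_) (by linarith)
    gcongr
    exact le_self_pow₀ hgt1 (by norm_num)
  · refine hfin (c := 8 * δ) ?_ (by linarith)
    have h1 := hB.abs_P_sub_le hin
    simp only [toFlow, Params.dens] at h1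
    have e : p.P₀ * (1 + τ * z τ 1) - p.P₀ = (p.P₀ * τ) * z τ 1 := by ring
    rw [e, abs_mul, abs_of_pos (by positivity : 0 < p.P₀ * τ)] at h1
    refine le_of_mul_le_mul_left (h1.trans (le_of_eq ?_)) (by positivity : 0 < p.P₀ * τ)
    ring
  · refine hfin (c := p.Λ * CS * Θ₀) ?_ (by linarith)
    have h1 := hS
    simp only [toFlow, Params.temp] at h1
    have e : Θ₀ + τ * (z τ 2 / p.Λ) - Θ₀ = (τ / p.Λ) * z τ 2 := by ring
    rw [e, abs_mul, abs_of_pos (by positivity : 0 < τ / p.Λ)] at h1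
    refine le_of_mul_le_mul_left (h1.trans ?_) (by positivity : 0 < τ / p.Λ)
    calc CS * Θ₀ * (τ / (1 + τ)) ^ 2 ≤ CS * Θ₀ * (τ / (1 + τ) * 1) := by
          rw [pow_two]
          gcongr
          exact div_one_add_le_one hτ0.le
      _ = _ := by field_simp
  · refine hfin (c := 2 * p.D * p.P₀ * Θ₀) ?_ (by linarith)
    have h1 := hB.abs_I_le hin
    simp only [toFlow] at h1
    rw [abs_mul, abs_of_pos (by positivity : 0 < τ ^ 2)] at h1
    refine le_of_mul_le_mul_left (h1.trans ?_) (by positivity : 0 < τ ^ 2)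
    calc _ ≤ 2 * p.D * p.P₀ * Θ₀ * (τ / (1 + τ)) ^ 2 := by gcongr
      _ = τ ^ 2 * (2 * p.D * p.P₀ * Θ₀ / (1 + τ) ^ 2) := by rw [div_pow]; ring
      _ ≤ _ := by
        gcongr
        exact le_self_pow₀ hgt1 (by norm_num)
  · refine hfin (c := Bounded.energyConst p * Θ₀) ?_ (by linarith)
    have h1 := hB.abs_J_le hin
    simp only [toFlow] at h1
    rw [abs_mul, abs_of_pos (by positivity : 0 < τ ^ 2)] at h1
    refine le_of_mul_le_mul_left (h1.trans ?_) (by positivity : 0 < τ ^ 2)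
    calc _ ≤ Bounded.energyConst p * Θ₀ * (τ / (1 + τ)) ^ 2 := by gcongr
      _ = τ ^ 2 * (Bounded.energyConst p * Θ₀ / (1 + τ) ^ 2) := by rw [div_pow]; ring
      _ ≤ _ := by
        gcongr
        exact le_self_pow₀ hgt1 (by norm_num)

-- The decay bounds and membership in the box are propagated together: the box makes the flow a true
-- solution, the decay bounds feed the a priori estimates, and these improve both strictly.
set_option maxHeartbeats 800000 in
theorem exists_isMild_bounded (p : Params) : ∃ K > 0, ∃ ε > 0, ∀ Θ₀, 0 < Θ₀ → Θ₀ < ε →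
    8 * p.R * p.P₀ * Θ₀ ≤ p.a ∧ ∃ z, IsMild p Θ₀ z ∧ z 0 = 0 ∧
      (∀ r, 0 ≤ r → ‖z r‖ < boxWidth r) ∧
      ∀ τ, Bounded p Θ₀ (K * Θ₀) τ (toFlow p Θ₀ z) := by
  obtain ⟨CU, hCU, hU⟩ := Bounded.exists_abs_U_le p
  obtain ⟨CW, hCW, hW⟩ := Bounded.exists_abs_W_le p
  obtain ⟨CT, hCT, hT⟩ := Bounded.exists_abs_Θ_le p
  obtain ⟨CS, hCS, hS⟩ := Bounded.exists_abs_Θ_sub_le p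
  have hP₀ := p.P₀_pos; have hR := p.R_pos; have hD := p.D_pos; have ha := p.a_pos
  have hΛ := p.Λ_pos
  have hE := Bounded.energyConst_pos p
  -- Strictly larger than each improved constant, and larger than `1` so that the bound for `Θ` is
  -- strict at the origin.
  set K := CU + CW + CT + 1 with hK
  have hK0 : 0 < K := by positivity
  -- Each summand encodes one smallness condition: `δ² ≤ Θ₀`, `δ ≤ 1/64`, the contraction condition,
  -- and the bounds on the temperature, `I` and `J` components of the box.
  set L := K ^ 2 + 64 * K + 8 * p.R * p.P₀ / p.a + 8 * (p.Λ * CS)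
    + 16 * p.D * p.P₀ + 8 * Bounded.energyConst p with hL
  have hL0 : 0 < L := by positivity
  refine ⟨K, hK0, 1 / L, by positivity, fun Θ₀ hΘ₀ hlt => ?_⟩
  rw [lt_div_iff₀ hL0] at hlt
  have hpart : ∀ x, x ≤ L → Θ₀ * x ≤ 1 := fun x hx =>
    (mul_le_mul_of_nonneg_left hx hΘ₀.le).trans hlt.le
  have q1 : 0 < K ^ 2 := by positivity
  have q2 : 0 < 64 * K := by positivity
  have q3 : 0 < 8 * p.R * p.P₀ / p.a := by positivity
  have q4 : 0 < 8 * (p.Λ * CS) := by positivity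
  have q5 : 0 < 16 * p.D * p.P₀ := by positivity
  have q6 : 0 < 8 * Bounded.energyConst p := by positivity
  have s1 := hpart (K ^ 2) (by linarith)
  have s2 := hpart (64 * K) (by linarith)
  have s3 := hpart (8 * p.R * p.P₀ / p.a) (by linarith)
  have s4 := hpart (8 * (p.Λ * CS)) (by linarith)
  have s5 := hpart (16 * p.D * p.P₀) (by linarith)
  have s6 := hpart (8 * Bounded.energyConst p) (by linarith)
  have hsmall : 8 * p.R * p.P₀ * Θ₀ ≤ p.a := by
    rw [mul_div_assoc', div_le_one ha] at s3
    linarith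
  obtain ⟨C, hC, m, hlip, hzero⟩ := p.exists_lipschitz_cutField hΘ₀.le hsmall
  obtain ⟨z, hzc, hz⟩ := exists_eq_avg (k := p.expo) (p.continuous_cutField Θ₀) hC hlip hzero
  have hm : IsMild p Θ₀ z := ⟨hzc, hz⟩
  have h0 := hm.zero hΘ₀.le hsmall
  set δ := K * Θ₀ with hδ
  have hδ0 : 0 < δ := by positivity
  have hδΘ : Θ₀ < δ := by
    rw [hδ]; nlinarith
  have hδsq : δ ^ 2 ≤ Θ₀ := by
    calc δ ^ 2 = Θ₀ * (Θ₀ * K ^ 2) := by rw [hδ]; ring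
      _ ≤ Θ₀ * 1 := by gcongr
      _ = Θ₀ := mul_one _
  have hδle : δ ≤ 1 / 64 := by rw [hδ]; linarith
  set X := toFlow p Θ₀ z with hX
  -- A single function of which `f ≤ 1` says that the box and the decay bounds for `U`, `W` and `Θ`
  -- hold.
  let f : ℝ → ℝ := fun r => max (‖z r‖ / boxWidth r) (max (|z r 0| * (1 + r) ^ 3 / δ)
    (max (|p.cutField Θ₀ r (z r) 0| * (1 + r) ^ 3 / δ) (|X.Θ r| * (1 + r) ^ 2 / δ)))
  have hfc : Continuous f := by
    have h1 := continuous_boxWidth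
    have h2 : Continuous fun s => z s 0 := (continuous_apply 0).comp hzc
    have h3 : Continuous fun s => p.cutField Θ₀ s (z s) 0 :=
      (continuous_apply 0).comp hm.cont_field
    have h4 : Continuous X.Θ := by
      have : Continuous fun s => z s 2 := (continuous_apply 2).comp hzc
      simp only [hX, toFlow, Params.temp]
      fun_prop
    have h5 : Continuous fun r => ‖z r‖ / boxWidth r :=
      hzc.norm.div h1 fun r => (boxWidth_pos r).ne'
    exact h5.max ((by fun_prop : Continuous fun r => |z r 0| * (1 + r) ^ 3 / δ).max
      ((by fun_prop : Continuous fun r => |p.cutField Θ₀ r (z r) 0| * (1 + r) ^ 3 / δ).max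
        (by fun_prop)))
  have hfle : ∀ r, 0 ≤ r → f r ≤ 1 → ‖z r‖ ≤ boxWidth r ∧ |z r 0| ≤ δ * (1 / (1 + r) ^ 3) ∧
      |p.cutField Θ₀ r (z r) 0| ≤ δ * (1 / (1 + r) ^ 3) ∧ |X.Θ r| ≤ δ * (1 / (1 + r) ^ 2) := by
    intro r hr h
    simp only [f, max_le_iff] at h
    obtain ⟨h1, h2, h3, h4⟩ := h
    refine ⟨(div_le_one (boxWidth_pos r)).1 h1, ?_, ?_, ?_⟩
    · rw [mul_one_div, le_div_iff₀ (by positivity)]; exact (div_le_one hδ0).1 h2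
    · rw [mul_one_div, le_div_iff₀ (by positivity)]; exact (div_le_one hδ0).1 h3
    · rw [mul_one_div, le_div_iff₀ (by positivity)]; exact (div_le_one hδ0).1 h4
  have hbdd : ∀ τ, (∀ s ∈ Icc 0 τ, f s ≤ 1) → Bounded p Θ₀ δ τ X := by
    intro τ hτ
    have hbox : ∀ s ∈ Icc 0 τ, InBox s (z s) := fun s hs i =>
      (norm_le_pi_norm (z s) i).trans (hfle s hs.1 (hτ s hs)).1
    have hP : ∀ s ∈ Icc 0 τ, |s * z s 1| ≤ 1 / 4 := fun s hs => (hbox s hs).abs_mul_le 1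
    refine { toSolves := solves_toFlow hm h0 hbox, Θ₀_pos := hΘ₀, Θ₀_le := hδΘ.le,
             sq_le := hδsq, δ_le := by linarith, le_P := ?_, P_le := ?_,
             abs_U_le := ?_, abs_W_le := ?_, abs_Θ_le := ?_ }
    · intro s hs
      have := (abs_le.1 (hP s hs)).1
      simp only [hX, toFlow, Params.dens]
      nlinarith
    · intro s hs
      have := (abs_le.1 (hP s hs)).2
      simp only [hX, toFlow, Params.dens]
      nlinarith
    · intro s hs
      simp only [hX, toFlow]
      rw [abs_mul, abs_of_nonneg (by positivity)]
      calc s ^ 2 * |z s 0| ≤ s ^ 2 * (δ * (1 / (1 + s) ^ 3)) := by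
            gcongr; exact (hfle s hs.1 (hτ s hs)).2.1
        _ = _ := by ring
    · intro s hs
      have hs0 := hs.1
      simp only [hX, toFlow]
      rw [abs_mul, abs_of_nonneg hs0]
      calc s * |p.cutField Θ₀ s (z s) 0| ≤ s * (δ * (1 / (1 + s) ^ 3)) := by
            gcongr; exact (hfle s hs.1 (hτ s hs)).2.2.1
        _ = _ := by ring
    · exact fun s hs => (hfle s hs.1 (hτ s hs)).2.2.2
  have hf0 : f 0 < 1 := by
    have h1 : X.Θ 0 = Θ₀ := by simp [hX, toFlow, Params.temp]
    have h2 : Θ₀ / δ < 1 := (div_lt_one hδ0).2 hδΘ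
    simp [f, h0, p.cutField_zero, h1, abs_of_pos hΘ₀, h2]
  -- The improved constants do not depend on `δ`, so each estimate returns with a constant strictly
  -- below `δ = K Θ₀`.
  have hstep : ∀ τ, 0 ≤ τ → (∀ s ∈ Icc 0 τ, f s ≤ 1) → f τ < 1 := by
    intro τ hτ hle
    rcases hτ.eq_or_lt with rfl | hτ0
    · exact hf0
    have hB := hbdd τ hle
    have hin : τ ∈ Icc 0 τ := ⟨hτ, le_rfl⟩
    have hgt1 : 1 ≤ 1 + τ := by linarith
    have hCUΘ : CU * Θ₀ < δ := by rw [hδ]; gcongr; linarith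
    have hCWΘ : CW * Θ₀ < δ := by rw [hδ]; gcongr; linarith
    have hCTΘ : CT * Θ₀ < δ := by rw [hδ]; gcongr; linarith
    have e0 : |z τ 0| ≤ CU * Θ₀ / (1 + τ) ^ 3 := by
      have h1 := hU hB τ hin
      simp only [hX, toFlow] at h1
      rw [abs_mul, abs_of_pos (by positivity : 0 < τ ^ 2)] at h1
      refine le_of_mul_le_mul_left (h1.trans (le_of_eq ?_)) (by positivity : 0 < τ ^ 2)
      ring
    have eW : |p.cutField Θ₀ τ (z τ) 0| ≤ CW * Θ₀ / (1 + τ) ^ 3 := by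
      have h1 := hW hB τ hin
      simp only [hX, toFlow] at h1
      rw [abs_mul, abs_of_pos hτ0] at h1
      refine le_of_mul_le_mul_left (h1.trans (le_of_eq ?_)) hτ0
      ring
    have eT : |X.Θ τ| ≤ CT * Θ₀ / (1 + τ) ^ 2 := (hT hB τ hin).trans (le_of_eq (by ring))
    have hbox := norm_lt_boxWidth hB hτ0 e0 (hS hB τ hin) (by linarith) (by linarith)
      (by linarith) (by linarith) (by linarith)
    have hfin : ∀ {x c : ℝ} {j : ℕ}, x ≤ c / (1 + τ) ^ j → c < δ → x * (1 + τ) ^ j / δ < 1 := by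
      intro x c j h1 h2
      rw [le_div_iff₀ (by positivity)] at h1
      rw [div_lt_one hδ0]
      linarith
    refine max_lt ?_ (max_lt (hfin e0 hCUΘ) (max_lt (hfin eW hCWΘ) (hfin eT hCTΘ)))
    exact (div_lt_one (boxWidth_pos τ)).2 hbox
  have hall : ∀ r, 0 ≤ r → f r < 1 := fun r hr =>
    lt_one_of_bootstrap hfc.continuousOn hf0 hstep hr
  refine ⟨hsmall, z, hm, h0, fun r hr => ?_, fun τ => hbdd τ fun s hs => (hall s hs.1).le⟩
  have h1 := (le_max_left _ _).trans_lt (hall r hr)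
  exact (div_lt_one (boxWidth_pos r)).1 h1

end

end SelfSimilarNS

/-! ### Asymptotics at infinity. -/

namespace SelfSimilarNS

/-- The constant in the decay estimate for the relaxation equation with rate at least `c r`. -/
noncomputable def relaxConst (c : ℝ) : ℝ := (1 + c / 4) * (2 / c + 1) / (c / 4)

theorem relaxConst_pos {c : ℝ} (hc : 0 < c) : 0 < relaxConst c := by
  unfold relaxConst; positivity

/-- A rate of order `r` against a forcing of order `1/r` leaves `O(r⁻²)`. The constant uses only a
lower bound `c₀` of the rate, since the actual `c` involves the limit density of the particular
solution. -/
theorem abs_le_of_relaxation_tail {Z g : ℝ → ℝ} {c c₀ G : ℝ} (hc₀ : 0 < c₀) (hc : c₀ ≤ c)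
    (hd : ∀ r, 1 ≤ r → HasDerivAt Z (-(c * r) * Z r + g r) r)
    (hg : ∀ r, 1 ≤ r → |g r| ≤ G / r) (h1 : |Z 1| ≤ G) {r : ℝ} (hr : 1 ≤ r) :
    |Z r| ≤ relaxConst c₀ * G / r ^ 2 := by
  have hG : 0 ≤ G := (abs_nonneg _).trans h1
  have hr0 : 0 < r := by linarith
  have key := abs_mul_le_of_relaxation (X := Z) (g := g) (q := fun s => c * s) (a := 1) (b := r)
    (M := (1 + c₀ / 4) * (2 / c₀ + 1) * G) (η := c₀ / 4) zero_le_one (by positivity)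
    (by positivity) (fun s hs => (hd s hs.1).continuousAt.continuousWithinAt)
    (fun s hs => hd s hs.1.le) (fun s hs => by
      have := hs.1
      calc 4 * (c₀ / 4) * s = c₀ * s := by ring
        _ ≤ c * s := by gcongr) (fun s hs => by
      have hs1 := hs.1
      have hs0 : 0 < s := by linarith
      have h2 : 1 + c₀ / 4 * s ^ 2 ≤ (1 + c₀ / 4) * s ^ 2 := by
        have : 1 ≤ s ^ 2 := one_le_pow₀ hs1.le
        linarith
      calc |g s| * (1 + c₀ / 4 * s ^ 2) ≤ G / s * ((1 + c₀ / 4) * s ^ 2) := by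
            gcongr; exact hg s hs1.le
        _ = (1 + c₀ / 4) * (2 / c₀) * G / 2 * (c₀ * s) := by field_simp
        _ ≤ (1 + c₀ / 4) * (2 / c₀ + 1) * G / 2 * (c * s) := by
            gcongr
            linarith) (by
      rw [one_pow, mul_one]
      calc |Z 1| * (1 + c₀ / 4) ≤ G * (1 + c₀ / 4) := by gcongr
        _ = (1 + c₀ / 4) * 1 * G := by ring
        _ ≤ _ := by
          gcongr
          have : 0 ≤ 2 / c₀ := by positivity
          linarith) ⟨hr, le_rfl⟩
  rw [le_div_iff₀ (by positivity), relaxConst, div_mul_eq_mul_div, le_div_iff₀ (by positivity)]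
  calc |Z r| * r ^ 2 * (c₀ / 4) = |Z r| * (c₀ / 4 * r ^ 2) := by ring
    _ ≤ |Z r| * (1 + c₀ / 4 * r ^ 2) := by gcongr; linarith
    _ ≤ _ := key

theorem tail_weights {r : ℝ} (hr : 1 ≤ r) : 1 / (1 + r) ^ 3 ≤ 1 / r ^ 3 ∧
    r ^ 2 / (1 + r) ^ 5 ≤ 1 / r ^ 3 ∧ r ^ 2 / (1 + r) ^ 3 ≤ 1 / r ∧
    1 / (1 + r) ^ 2 ≤ 1 / r ^ 2 := by
  have hr0 : 0 < r := by linarith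
  refine ⟨by gcongr; linarith, ?_, ?_, by gcongr; linarith⟩
  · rw [div_le_div_iff₀ (by positivity) (by positivity), one_mul, ← pow_add]
    gcongr; linarith
  · rw [div_le_div_iff₀ (by positivity) (by positivity), one_mul, ← pow_succ]
    gcongr; linarith

-- With `P`, `I` and `J` replaced by their limits, the equations for `r U` and `r² Θ` relax to
-- constants; the differences are forcings of order `1/r`.
set_option maxHeartbeats 1600000 in
theorem exists_asymptotics (p : Params) {K : ℝ} (hK : 0 < K) : ∃ C > 0, ∀ {Θ₀ : ℝ} {X : Flow},
    (∀ τ, Bounded p Θ₀ (K * Θ₀) τ X) → ∃ Pinf Uinf Θinf : ℝ, 0 < Pinf ∧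
      (∀ r, 1 ≤ r → |X.P r - Pinf| ≤ C / r ^ 2) ∧
      (∀ r, 1 ≤ r → |X.U r - Uinf / r| ≤ C / r ^ 3) ∧
      (∀ r, 1 ≤ r → |X.Θ r - Θinf / r ^ 2| ≤ C / r ^ 4) ∧
      |Uinf - (-2 * p.R * Θ₀)| ≤ C * Θ₀ ^ 2 ∧
      |Θinf - 2 * (p.n + 1) * p.κ / (p.CV * p.P₀) * Θ₀| ≤ C * Θ₀ ^ 2 := by
  obtain ⟨CU, hCU, hU⟩ := Bounded.exists_abs_U_le p
  obtain ⟨CT, hCT, hT⟩ := Bounded.exists_abs_Θ_le p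
  have hP₀ := p.P₀_pos; have ha := p.a_pos; have hD := p.D_pos; have hR := p.R_pos
  have hκ := p.κ_pos; have hCV := p.CV_pos
  have hE := Bounded.energyConst_pos p
  set E := Bounded.energyConst p with hEdef
  set A := 2 * p.D * p.P₀ with hA
  have hA0 : 0 < A := by positivity
  -- bounds for the limits of the velocity and of the temperature
  set LU := 4 * (p.R * p.P₀ + A) / p.P₀ with hLU
  have hLU0 : 0 < LU := by positivity
  set LT := 4 * (p.κ * (p.n + 1) + E) / (p.CV * p.P₀) with hLT
  have hLT0 : 0 < LT := by positivity
  -- bounds for the forcings of the two relaxation equations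
  set GU := CU + LU + (p.R * (2 * p.P₀ * CT) + A) / p.a + (p.n + 1) * CU
    + (4 * p.P₀ + 2 * p.P₀ * CU) / p.a * CU with hGU
  have hGU0 : 0 < GU := by positivity
  set GT := CT + LT + E / p.κ + (p.n + 1) * CT
    + p.CV / p.κ * ((4 * p.P₀ + 2 * p.P₀ * CU) * CT) with hGT
  have hGT0 : 0 < GT := by positivity
  have hcU0 : 0 < p.P₀ / (4 * p.a) := by positivity
  have hcT0 : 0 < p.CV * p.P₀ / (4 * p.κ) := by positivity
  have hrU := relaxConst_pos hcU0
  have hrT := relaxConst_pos hcT0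
  set C := 8 * p.P₀ + relaxConst (p.P₀ / (4 * p.a)) * GU
    + relaxConst (p.CV * p.P₀ / (4 * p.κ)) * GT
    + 2 * (2 * A * K ^ 2 + 16 * p.R * p.P₀ * K) / p.P₀
    + 2 * (2 * E * K ^ 2 + 16 * p.κ * (p.n + 1) * K) / (p.CV * p.P₀) with hC
  have q1 : 0 < 8 * p.P₀ := by positivity
  have q2 : 0 < relaxConst (p.P₀ / (4 * p.a)) * GU := by positivity
  have q3 : 0 < relaxConst (p.CV * p.P₀ / (4 * p.κ)) * GT := by positivity
  have q4 : 0 < 2 * (2 * A * K ^ 2 + 16 * p.R * p.P₀ * K) / p.P₀ := by positivity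
  have q5 : 0 < 2 * (2 * E * K ^ 2 + 16 * p.κ * (p.n + 1) * K) / (p.CV * p.P₀) := by positivity
  refine ⟨C, by positivity, fun {Θ₀ X} hB => ?_⟩
  have hΘ₀ := (hB 0).Θ₀_pos
  set δ := K * Θ₀ with hδ
  have hδ0 : 0 < δ := (hB 0).δ_pos
  have hδ1 : δ ≤ 1 := (hB 0).δ_le.trans (by norm_num)
  have hΘ1 : Θ₀ ≤ 1 := (hB 0).Θ₀_le.trans hδ1
  have hδ2 : δ ^ 2 ≤ 1 := (hB 0).sq_le.trans hΘ1
  have hin : ∀ {r : ℝ}, 1 ≤ r → r ∈ Icc 0 (r + 1) := fun hr => ⟨by linarith, by linarith⟩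
  have hin' : ∀ {r : ℝ}, 1 ≤ r → r ∈ Ioo 0 (r + 1) := fun hr => ⟨by linarith, by linarith⟩
  obtain ⟨Pinf, hPlim, hPinf⟩ := exists_limit_of_abs_deriv_le (f := X.P) (f' := X.densDeriv)
    (M := 8 * p.P₀ * δ) (fun r hr => (hB (r + 1)).deriv_P r (hin' hr)) (fun r hr => by
      refine ((hB (r + 1)).abs_densDeriv_le (hin hr) (by linarith)).trans ?_
      rw [← mul_one_div (8 * p.P₀ * δ)]
      exact mul_le_mul_of_nonneg_left (tail_weights hr).1 (by positivity))
  obtain ⟨Iinf, hIlim, hIinf⟩ := exists_limit_of_abs_deriv_le (f := X.I) (f' := X.momDeriv p)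
    (M := A * δ ^ 2) (fun r hr => (hB (r + 1)).deriv_I r (hin' hr)) (fun r hr => by
      refine ((hB (r + 1)).abs_momDeriv_le (hin hr) (by linarith)).trans ?_
      rw [← mul_one_div (A * δ ^ 2), hA]
      have := (tail_weights hr).2.1
      gcongr)
  obtain ⟨Jinf, hJlim, hJinf⟩ := exists_limit_of_abs_deriv_le (f := X.J) (f' := X.energyDeriv p)
    (M := E * δ ^ 2) (fun r hr => (hB (r + 1)).deriv_J r (hin' hr)) (fun r hr => by
      refine ((hB (r + 1)).abs_energyDeriv_le (hin hr) (by linarith)).trans ?_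
      rw [← mul_one_div (E * δ ^ 2)]
      exact mul_le_mul_of_nonneg_left (tail_weights hr).2.1 (by positivity : 0 ≤ E * δ ^ 2))
  have hge : ∀ᶠ r : ℝ in atTop, 1 ≤ r := eventually_ge_atTop 1
  have hPle : p.P₀ / 2 ≤ Pinf := by
    refine ge_of_tendsto hPlim ?_
    filter_upwards [hge] with r hr
    exact (hB (r + 1)).le_P r (hin hr)
  have hPinf0 : 0 < Pinf := by linarith
  have hPsub : |Pinf - p.P₀| ≤ 8 * p.P₀ * δ := by
    refine le_of_tendsto (hPlim.sub_const p.P₀).abs ?_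
    filter_upwards [hge] with r hr
    refine ((hB (r + 1)).abs_P_sub_le (hin hr)).trans (mul_le_of_le_one_right (by positivity) ?_)
    exact div_one_add_le_one (by linarith)
  have hIle : |Iinf| ≤ A * δ ^ 2 := by
    refine le_of_tendsto hIlim.abs ?_
    filter_upwards [hge] with r hr
    refine ((hB (r + 1)).abs_I_le (hin hr)).trans (mul_le_of_le_one_right (by positivity) ?_)
    exact pow_le_one₀ (by positivity) (div_one_add_le_one (by linarith))
  have hJle : |Jinf| ≤ E * δ ^ 2 := by
    refine le_of_tendsto hJlim.abs ?_
    filter_upwards [hge] with r hr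
    refine ((hB (r + 1)).abs_J_le (hin hr)).trans (mul_le_of_le_one_right (by positivity) ?_)
    exact pow_le_one₀ (by positivity) (div_one_add_le_one (by linarith))
  have hUr : ∀ r, 1 ≤ r → |X.U r| ≤ CU * (1 / r) := fun r hr => by
    refine (hU (hB (r + 1)) r (hin hr)).trans ?_
    have := (tail_weights hr).2.2.1
    have : CU * Θ₀ ≤ CU := mul_le_of_le_one_right hCU.le hΘ1
    have : 0 < r := by linarith
    gcongr
  have hTr : ∀ r, 1 ≤ r → |X.Θ r| ≤ CT * (1 / r ^ 2) := fun r hr => by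
    refine (hT (hB (r + 1)) r (hin hr)).trans ?_
    have := (tail_weights hr).2.2.2
    have : CT * Θ₀ ≤ CT := mul_le_of_le_one_right hCT.le hΘ1
    gcongr
  -- Multiplied by `r`, the error `P - P∞ = O(r⁻²)` is still `O(r⁻¹)`, as is `P U`.
  have hrate : ∀ r, 1 ≤ r → |X.P r * (r / 2 - X.U r) - Pinf * r / 2|
      ≤ (4 * p.P₀ + 2 * p.P₀ * CU) * (1 / r) := fun r hr => by
    have hr0 : 0 < r := by linarith
    have h1 : |(X.P r - Pinf) * (r / 2)| ≤ 4 * p.P₀ * (1 / r) := by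
      rw [abs_mul, abs_of_pos (by positivity : 0 < r / 2)]
      calc _ ≤ 8 * p.P₀ * δ / r ^ 2 * (r / 2) := by gcongr; exact hPinf r hr
        _ = 4 * p.P₀ * (1 / r) * δ := by field_simp; norm_num
        _ ≤ _ := mul_le_of_le_one_right (by positivity) hδ1
    have h2 : |X.P r * X.U r| ≤ 2 * p.P₀ * (CU * (1 / r)) := by
      rw [abs_mul, abs_of_pos ((hB (r + 1)).P_pos (hin hr))]
      have := (hB (r + 1)).P_le r (hin hr)
      have := hUr r hr
      gcongr
    calc _ = |(X.P r - Pinf) * (r / 2) - X.P r * X.U r| := by congr 1; ring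
      _ ≤ _ := (abs_sub _ _).trans (add_le_add h1 h2)
      _ = _ := by ring
  set Finf := -(p.R * p.P₀ * Θ₀) + Iinf with hFinf
  -- The value at which the damping `P∞ r U∞ / (2 a)` cancels the limiting forcing `r F∞ / a`;
  -- `Θinf` is chosen likewise.
  set Uinf := 2 * Finf / Pinf with hUinf
  set Θinf := 2 * (p.κ * (p.n + 1) * Θ₀ + Jinf) / (p.CV * Pinf) with hΘinf
  have hUinfle : |Uinf| ≤ LU := by
    rw [hUinf, abs_div, abs_of_pos hPinf0, hLU, abs_mul, abs_two]
    have h1 : |Finf| ≤ p.R * p.P₀ + A := by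
      refine (abs_add_le _ _).trans (add_le_add ?_ ?_)
      · rw [abs_neg, abs_of_pos (by positivity)]
        exact mul_le_of_le_one_right (by positivity) hΘ1
      · exact hIle.trans (mul_le_of_le_one_right hA0.le hδ2)
    calc 2 * |Finf| / Pinf ≤ 2 * (p.R * p.P₀ + A) / (p.P₀ / 2) := by gcongr
      _ = _ := by field_simp; norm_num
  have hΘinfle : |Θinf| ≤ LT := by
    rw [hΘinf, abs_div, abs_of_pos (by positivity : 0 < p.CV * Pinf), hLT, abs_mul, abs_two]
    have h1 : |p.κ * (p.n + 1) * Θ₀ + Jinf| ≤ p.κ * (p.n + 1) + E := by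
      refine (abs_add_le _ _).trans (add_le_add ?_ ?_)
      · rw [abs_of_pos (by positivity)]
        exact mul_le_of_le_one_right (by positivity) hΘ1
      · exact hJle.trans (mul_le_of_le_one_right hE.le hδ2)
    calc _ ≤ 2 * (p.κ * (p.n + 1) + E) / (p.CV * (p.P₀ / 2)) := by gcongr
      _ = _ := by field_simp; norm_num
  refine ⟨Pinf, Uinf, Θinf, hPinf0, fun r hr => ?_, fun r hr => ?_, fun r hr => ?_, ?_, ?_⟩
  · have hr0 : 0 < r := by linarith
    refine (hPinf r hr).trans ?_
    have : 8 * p.P₀ * δ ≤ 8 * p.P₀ := mul_le_of_le_one_right q1.le hδ1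
    gcongr
    linarith
  · have hr0 : 0 < r := by linarith
    have key := abs_le_of_relaxation_tail (Z := fun s => s * X.U s - Uinf) (c := Pinf / (2 * p.a))
      (g := fun s => s * (X.forcing p Θ₀ s - Finf) / p.a - (p.n + 1) * X.U s
        - (X.P s * (s / 2 - X.U s) - Pinf * s / 2) / p.a * (s * X.U s)) (G := GU) hcU0 (by
        rw [div_le_div_iff₀ (by positivity) (by positivity)]
        nlinarith) (fun s hs => by
        have hs0 : s ≠ 0 := by linarith
        refine (((hasDerivAt_id s).mul ((hB (s + 1)).deriv_U s (hin' hs))).sub_const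
          Uinf).congr_deriv ?_
        rw [(hB (s + 1)).velDeriv_eq (hin hs)]
        simp only [id, Params.D, Flow.damping, hUinf]
        field_simp
        ring) (fun s hs => by
        have hs0 : 0 < s := by linarith
        have h1 : |X.forcing p Θ₀ s - Finf| ≤ (p.R * (2 * p.P₀ * CT) + A) * (1 / s ^ 2) := by
          have e : X.forcing p Θ₀ s - Finf = p.R * (X.P s * X.Θ s) + (X.I s - Iinf) := by
            rw [Flow.forcing, hFinf]; ring
          have h2 : |p.R * (X.P s * X.Θ s)| ≤ p.R * (2 * p.P₀ * (CT * (1 / s ^ 2))) := by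
            rw [abs_mul, abs_mul, abs_of_pos hR, abs_of_pos ((hB (s + 1)).P_pos (hin hs))]
            have := (hB (s + 1)).P_le s (hin hs)
            have := hTr s hs
            gcongr
          have h3 : |X.I s - Iinf| ≤ A * (1 / s ^ 2) := by
            refine (hIinf s hs).trans ?_
            rw [mul_one_div]
            gcongr
            exact mul_le_of_le_one_right hA0.le hδ2
          rw [e]
          refine (abs_add_le _ _).trans ((add_le_add h2 h3).trans (le_of_eq (by ring)))
        have h2 := hUr s hs
        have h3 := hrate s hs
        have h4 : |s * X.U s| ≤ CU := by
          rw [abs_mul, abs_of_pos hs0]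
          calc s * |X.U s| ≤ s * (CU * (1 / s)) := by gcongr
            _ = CU := by field_simp
        calc _ ≤ |s * (X.forcing p Θ₀ s - Finf) / p.a| + |(p.n + 1) * X.U s|
            + |(X.P s * (s / 2 - X.U s) - Pinf * s / 2) / p.a * (s * X.U s)| :=
              (abs_sub _ _).trans (add_le_add_left (abs_sub _ _) _)
          _ ≤ s * ((p.R * (2 * p.P₀ * CT) + A) * (1 / s ^ 2)) / p.a + (p.n + 1) * (CU * (1 / s))
            + (4 * p.P₀ + 2 * p.P₀ * CU) * (1 / s) / p.a * CU := by
              rw [abs_div, abs_of_pos ha, abs_mul, abs_of_pos hs0, abs_mul,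
                abs_of_pos (by positivity : (0 : ℝ) < p.n + 1), abs_mul, abs_div, abs_of_pos ha]
              gcongr
          _ = ((p.R * (2 * p.P₀ * CT) + A) / p.a + (p.n + 1) * CU
            + (4 * p.P₀ + 2 * p.P₀ * CU) / p.a * CU) / s := by field_simp
          _ ≤ GU / s := by
            gcongr
            rw [hGU]
            linarith) (by
        have h1 := hUr 1 le_rfl
        have h2 : |1 * X.U 1 - Uinf| ≤ CU + LU := by
          refine (abs_sub _ _).trans (add_le_add ?_ hUinfle)
          simpa using h1
        refine h2.trans ?_
        rw [hGU]
        have : 0 ≤ (p.R * (2 * p.P₀ * CT) + A) / p.a + (p.n + 1) * CU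
          + (4 * p.P₀ + 2 * p.P₀ * CU) / p.a * CU := by positivity
        linarith) hr
    have e : X.U r - Uinf / r = (r * X.U r - Uinf) / r := by field_simp
    rw [e, abs_div, abs_of_pos hr0, div_le_iff₀ hr0]
    refine key.trans ?_
    rw [div_mul_eq_mul_div, pow_succ r 2, mul_div_mul_right _ _ hr0.ne']
    gcongr
    linarith
  · have hr0 : 0 < r := by linarith
    have key := abs_le_of_relaxation_tail (Z := fun s => s ^ 2 * X.Θ s - Θinf)
      (c := p.CV * Pinf / (2 * p.κ))
      (g := fun s => s * (X.J s - Jinf) / p.κ - (p.n - 1) * (s * X.Θ s)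
        - p.CV / p.κ * ((X.P s * (s / 2 - X.U s) - Pinf * s / 2) * (s ^ 2 * X.Θ s)))
      (G := GT) hcT0 (by
        rw [div_le_div_iff₀ (by positivity) (by positivity)]
        have : p.CV * p.κ * (p.P₀ / 2) ≤ p.CV * p.κ * Pinf := by gcongr
        nlinarith) (fun s hs => by
        have hs0 : s ≠ 0 := by linarith
        refine (((hasDerivAt_pow 2 s).mul ((hB (s + 1)).deriv_Θ s (hin' hs))).sub_const
          Θinf).congr_deriv ?_
        simp only [Flow.tempDeriv, hΘinf]
        field_simp
        push_cast
        ring) (fun s hs => by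
        have hs0 : 0 < s := by linarith
        have h1 : |X.J s - Jinf| ≤ E * (1 / s ^ 2) := by
          refine (hJinf s hs).trans ?_
          rw [mul_one_div]
          gcongr
          exact mul_le_of_le_one_right hE.le hδ2
        have h2 := hTr s hs
        have h3 := hrate s hs
        have h4 : |s ^ 2 * X.Θ s| ≤ CT := by
          rw [abs_mul, abs_of_pos (by positivity)]
          calc s ^ 2 * |X.Θ s| ≤ s ^ 2 * (CT * (1 / s ^ 2)) := by gcongr
            _ = CT := by field_simp
        have h5 : |(p.n : ℝ) - 1| ≤ p.n + 1 := by
          have : (0 : ℝ) ≤ p.n := by positivity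
          rw [abs_le]; constructor <;> linarith
        calc _ ≤ |s * (X.J s - Jinf) / p.κ| + |((p.n : ℝ) - 1) * (s * X.Θ s)|
            + |p.CV / p.κ * ((X.P s * (s / 2 - X.U s) - Pinf * s / 2) * (s ^ 2 * X.Θ s))| :=
              (abs_sub _ _).trans (add_le_add_left (abs_sub _ _) _)
          _ ≤ s * (E * (1 / s ^ 2)) / p.κ + (p.n + 1) * (s * (CT * (1 / s ^ 2)))
            + p.CV / p.κ * ((4 * p.P₀ + 2 * p.P₀ * CU) * (1 / s) * CT) := by
              rw [abs_div, abs_of_pos hκ, abs_mul, abs_of_pos hs0, abs_mul, abs_mul s,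
                abs_of_pos hs0, abs_mul (p.CV / p.κ),
                abs_of_pos (by positivity : 0 < p.CV / p.κ), abs_mul (_ - Pinf * s / 2)]
              gcongr
          _ = (E / p.κ + (p.n + 1) * CT
            + p.CV / p.κ * ((4 * p.P₀ + 2 * p.P₀ * CU) * CT)) / s := by field_simp
          _ ≤ GT / s := by
            gcongr
            rw [hGT]
            linarith) (by
        have h1 := hTr 1 le_rfl
        have h2 : |1 ^ 2 * X.Θ 1 - Θinf| ≤ CT + LT := by
          refine (abs_sub _ _).trans (add_le_add ?_ hΘinfle)
          simpa using h1
        refine h2.trans ?_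
        rw [hGT]
        have : 0 ≤ E / p.κ + (p.n + 1) * CT
          + p.CV / p.κ * ((4 * p.P₀ + 2 * p.P₀ * CU) * CT) := by positivity
        linarith) hr
    have e : X.Θ r - Θinf / r ^ 2 = (r ^ 2 * X.Θ r - Θinf) / r ^ 2 := by field_simp
    rw [e, abs_div, abs_of_pos (by positivity : 0 < r ^ 2), div_le_iff₀ (by positivity)]
    refine key.trans ?_
    rw [div_mul_eq_mul_div, show r ^ 4 = r ^ 2 * r ^ 2 by ring,
      mul_div_mul_right _ _ (by positivity)]
    gcongr
    linarith
  · have e : Uinf - (-2 * p.R * Θ₀) = 2 * (Iinf + p.R * Θ₀ * (Pinf - p.P₀)) / Pinf := by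
      rw [hUinf, hFinf]; field_simp; ring
    rw [e, abs_div, abs_mul, abs_two, abs_of_pos hPinf0]
    -- `I∞` is quadratic in `δ`, and `P∞ - P₀` is linear in `δ` but multiplied by `Θ₀`; with `δ = K
    -- Θ₀` both are `O(Θ₀²)`.
    have h1 : |Iinf + p.R * Θ₀ * (Pinf - p.P₀)|
        ≤ A * δ ^ 2 + p.R * Θ₀ * (8 * p.P₀ * δ) := by
      refine (abs_add_le _ _).trans (add_le_add hIle ?_)
      rw [abs_mul, abs_of_pos (by positivity : 0 < p.R * Θ₀)]
      gcongr
    calc _ ≤ 2 * (A * δ ^ 2 + p.R * Θ₀ * (8 * p.P₀ * δ)) / (p.P₀ / 2) := by gcongr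
      _ = 2 * (2 * A * K ^ 2 + 16 * p.R * p.P₀ * K) / p.P₀ * Θ₀ ^ 2 := by
        rw [hδ]; field_simp; ring
      _ ≤ _ := by gcongr; linarith
  · have e : Θinf - 2 * (p.n + 1) * p.κ / (p.CV * p.P₀) * Θ₀
        = 2 * (p.P₀ * Jinf - p.κ * (p.n + 1) * Θ₀ * (Pinf - p.P₀)) / (p.CV * Pinf * p.P₀) := by
      rw [hΘinf]; field_simp; ring
    rw [e, abs_div, abs_mul, abs_two, abs_of_pos (by positivity : 0 < p.CV * Pinf * p.P₀)]
    have h1 : |p.P₀ * Jinf - p.κ * (p.n + 1) * Θ₀ * (Pinf - p.P₀)|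
        ≤ p.P₀ * (E * δ ^ 2) + p.κ * (p.n + 1) * Θ₀ * (8 * p.P₀ * δ) := by
      refine (abs_sub _ _).trans (add_le_add ?_ ?_)
      · rw [abs_mul, abs_of_pos hP₀]; gcongr
      · rw [abs_mul, abs_of_pos (by positivity : 0 < p.κ * (p.n + 1) * Θ₀)]; gcongr
    calc _ ≤ 2 * (p.P₀ * (E * δ ^ 2) + p.κ * (p.n + 1) * Θ₀ * (8 * p.P₀ * δ))
          / (p.CV * (p.P₀ / 2) * p.P₀) := by gcongr
      _ = 2 * (2 * E * K ^ 2 + 16 * p.κ * (p.n + 1) * K) / (p.CV * p.P₀) * Θ₀ ^ 2 := by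
        rw [hδ]; field_simp; ring
      _ ≤ _ := by gcongr; linarith

end SelfSimilarNS

/-! ### Equivalence of the integrated system with the original equations. -/

namespace SelfSimilarNS

section Equations

variable {p : Params} {P U Θ : ℝ → ℝ} {r P₁ U₁ U₂ Θ₁ Θ₂ : ℝ}

theorem cast_dim_sub_one (p : Params) : (((p.n + 3 : ℕ) : ℝ) - 1) = p.D := by
  unfold Params.D; push_cast; ring

theorem massEq_iff (hP : HasDerivAt P P₁ r) (hU : HasDerivAt U U₁ r) :
    MassEq (p.n + 3) P U r ↔ P₁ * (r / 2 - U r) = P r * (U₁ + p.D * (U r / r)) := by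
  rw [MassEq, cast_dim_sub_one, hP.deriv, hU.deriv]
  constructor <;> intro h <;> linear_combination -h

/-- Passage to non-conservative form, by subtracting `U` times the mass equation. -/
theorem momentumEq_iff (hP : HasDerivAt P P₁ r) (hU : HasDerivAt U U₁ r)
    (hΘ : HasDerivAt Θ Θ₁ r) (hU₂ : HasDerivAt (deriv U) U₂ r)
    (hmass : P₁ * (r / 2 - U r) = P r * (U₁ + p.D * (U r / r))) :
    MomentumEq (p.n + 3) p.R p.μ p.lam P U Θ r ↔
      p.a * (U₂ + p.D * (U₁ / r) - p.D * (U r / r ^ 2))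
        = p.R * (P₁ * Θ r + P r * Θ₁) - P r * (U r / 2 + (r / 2 - U r) * U₁) := by
  have h1 := (hP.fun_mul hU).deriv
  have h2 := (hP.fun_mul (hU.fun_pow 2)).deriv
  have h3 := ((hP.mul_const p.R).fun_mul hΘ).deriv
  rw [MomentumEq, cast_dim_sub_one, h1, h2, h3, hU.deriv, hU₂.deriv, Params.a]
  push_cast
  constructor <;> intro h
  · linear_combination -h - U r * hmass
  · linear_combination -h - U r * hmass

/-- Subtracting `U²/2 + C_V Θ` times mass and `U` times momentum removes the kinetic energy and the
viscous work, leaving the heat equation with dissipation. -/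
theorem energyEq_iff (hP : HasDerivAt P P₁ r) (hU : HasDerivAt U U₁ r)
    (hΘ : HasDerivAt Θ Θ₁ r) (hU₂ : HasDerivAt (deriv U) U₂ r) (hΘ₂ : HasDerivAt (deriv Θ) Θ₂ r)
    (hmass : P₁ * (r / 2 - U r) = P r * (U₁ + p.D * (U r / r)))
    (hmom : p.a * (U₂ + p.D * (U₁ / r) - p.D * (U r / r ^ 2))
        = p.R * (P₁ * Θ r + P r * Θ₁) - P r * (U r / 2 + (r / 2 - U r) * U₁)) :
    EnergyEq (p.n + 3) p.R p.μ p.lam p.CV p.κ P U Θ r ↔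
      p.κ * (Θ₂ + p.D * (Θ₁ / r)) + p.CV * P r * ((r / 2 - U r) * Θ₁ + Θ r)
        - p.R * P r * Θ r * (U₁ + p.D * (U r / r))
        + 2 * p.μ * (U₁ ^ 2 + p.D * (U r / r) ^ 2) + p.lam * (U₁ + p.D * (U r / r)) ^ 2 = 0 := by
  have hE : HasDerivAt (fun s => U s ^ 2 / 2 + p.CV * Θ s) (U r * U₁ + p.CV * Θ₁) r := by
    refine (((hU.fun_pow 2).div_const 2).fun_add (hΘ.const_mul p.CV)).congr_deriv ?_
    push_cast; ring
  have h1 := (hP.fun_mul hE).deriv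
  have h2 := (((hU.fun_mul hP).fun_mul hE).fun_add
    (((hU.fun_mul hP).mul_const p.R).fun_mul hΘ)).deriv
  rw [EnergyEq, cast_dim_sub_one, h1, h2, hU.deriv, hΘ.deriv, hU₂.deriv, hΘ₂.deriv]
  rw [Params.a] at hmom
  constructor <;> intro h
  · linear_combination -h - (U r ^ 2 / 2 + p.CV * Θ r) * hmass - U r * hmom
  · linear_combination -h - (U r ^ 2 / 2 + p.CV * Θ r) * hmass - U r * hmom

end Equations

section Profile

variable {p : Params} {Θ₀ : ℝ} {X : Flow}

theorem Solves.deriv_velDeriv {τ r : ℝ} (h : Solves p Θ₀ τ X) (hr : r ∈ Ioo 0 τ)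
    (hgap : r / 2 - X.U r ≠ 0) : HasDerivAt (X.velDeriv p)
      (X.divDeriv p Θ₀ r / p.a - p.D * (X.velDeriv p r / r - X.U r / r ^ 2)) r := by
  have hr0 := hr.1.ne'
  have h1 := (h.deriv_W hr hgap).sub
    (((h.deriv_U r hr).div (hasDerivAt_id r) hr0).const_mul p.D)
  refine h1.congr_deriv ?_
  simp only [id]
  field_simp

theorem Solves.deriv_tempDeriv {τ r : ℝ} (h : Solves p Θ₀ τ X) (hr : r ∈ Ioo 0 τ) :
    HasDerivAt (X.tempDeriv p Θ₀)
      ((X.energyDeriv p r - p.CV * ((X.densDeriv r * (r * (r / 2 - X.U r))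
          + X.P r * (r / 2 - X.U r + r * (1 / 2 - X.velDeriv p r))) * X.Θ r
          + X.P r * (r * (r / 2 - X.U r)) * X.tempDeriv p Θ₀ r)
        - p.κ * (p.n + 2) * X.tempDeriv p Θ₀ r) / (p.κ * r)) r := by
  have hr0 := hr.1.ne'
  have hκ := p.κ_pos.ne'
  have hgap : HasDerivAt (fun s => s / 2 - X.U s) (1 / 2 - X.velDeriv p r) r :=
    ((hasDerivAt_id r).div_const 2).sub (h.deriv_U r hr)
  have h1 := ((h.deriv_J r hr).fun_sub ((((h.deriv_P r hr).const_mul p.CV).fun_mul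
    ((hasDerivAt_id r).fun_mul hgap)).fun_mul (h.deriv_Θ r hr))).fun_sub
      (((h.deriv_Θ r hr).sub_const Θ₀).const_mul (p.κ * (p.n + 1)))
  have h2 := h1.fun_div ((hasDerivAt_id r).const_mul p.κ) (by simp [hr0, hκ])
  refine (h2.congr_of_eventuallyEq ?_).congr_deriv ?_
  · filter_upwards [lt_mem_nhds hr.1] with s hs
    have := ne_of_gt hs
    simp only [Flow.tempDeriv, id]
    field_simp
  · have e : X.tempDeriv p Θ₀ r = (X.J r - p.CV * X.P r * (r * (r / 2 - X.U r)) * X.Θ r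
      - p.κ * (p.n + 1) * (X.Θ r - Θ₀)) / (p.κ * r) := by
      rw [Flow.tempDeriv]; field_simp
    have e' : X.J r - p.CV * X.P r * (r * (r / 2 - X.U r)) * X.Θ r
      - p.κ * (p.n + 1) * (X.Θ r - Θ₀) = X.tempDeriv p Θ₀ r * (p.κ * r) := by
      rw [e]; field_simp
    simp only [id]
    rw [e']
    generalize X.tempDeriv p Θ₀ r = T
    generalize X.energyDeriv p r = E
    field_simp
    ring

/-- The derivative formulas are required on all of `(0, ∞)` because second derivatives are taken of
`deriv`, which must be known near `r`. -/
theorem Solves.equations {τ r : ℝ} (h : Solves p Θ₀ τ X) (hr : r ∈ Ioo 0 τ)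
    (hgap : r / 2 - X.U r ≠ 0) (hU : ∀ s, 0 < s → HasDerivAt X.U (X.velDeriv p s) s)
    (hΘ : ∀ s, 0 < s → HasDerivAt X.Θ (X.tempDeriv p Θ₀ s) s) :
    DifferentiableAt ℝ (deriv X.U) r ∧ DifferentiableAt ℝ (deriv X.Θ) r ∧
      MassEq (p.n + 3) X.P X.U r ∧ MomentumEq (p.n + 3) p.R p.μ p.lam X.P X.U X.Θ r ∧
      EnergyEq (p.n + 3) p.R p.μ p.lam p.CV p.κ X.P X.U X.Θ r := by
  have hr0 := hr.1.ne'
  have ha := p.a_pos.ne'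
  have hκ := p.κ_pos.ne'
  have hU₂ := (h.deriv_velDeriv hr hgap).congr_of_eventuallyEq (f₁ := deriv X.U) (by
    filter_upwards [lt_mem_nhds hr.1] with s hs
    exact (hU s hs).deriv)
  have hΘ₂ := (h.deriv_tempDeriv hr).congr_of_eventuallyEq (f₁ := deriv X.Θ) (by
    filter_upwards [lt_mem_nhds hr.1] with s hs
    exact (hΘ s hs).deriv)
  have hP := h.deriv_P r hr
  have hPW : X.densDeriv r * (r / 2 - X.U r) = X.P r * X.W r := div_mul_cancel₀ _ hgap
  have hdiv : X.velDeriv p r + p.D * (X.U r / r) = X.W r := by rw [Flow.velDeriv]; ring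
  have hmass : X.densDeriv r * (r / 2 - X.U r)
      = X.P r * (X.velDeriv p r + p.D * (X.U r / r)) := by rw [hdiv, hPW]
  have hmom : p.a * (X.divDeriv p Θ₀ r / p.a - p.D * (X.velDeriv p r / r - X.U r / r ^ 2)
      + p.D * (X.velDeriv p r / r) - p.D * (X.U r / r ^ 2))
        = p.R * (X.densDeriv r * X.Θ r + X.P r * X.tempDeriv p Θ₀ r)
          - X.P r * (X.U r / 2 + (r / 2 - X.U r) * X.velDeriv p r) := by
    rw [Flow.divDeriv, Flow.velDeriv]
    field_simp
    ring
  refine ⟨hU₂.differentiableAt, hΘ₂.differentiableAt,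
    (massEq_iff hP (hU r hr.1)).2 hmass,
    (momentumEq_iff hP (hU r hr.1) (hΘ r hr.1) hU₂ hmass).2 hmom,
    (energyEq_iff hP (hU r hr.1) (hΘ r hr.1) hU₂ hΘ₂ hmass hmom).2 ?_⟩
  have e : (X.densDeriv r * (r * (r / 2 - X.U r))
      + X.P r * (r / 2 - X.U r + r * (1 / 2 - X.velDeriv p r))) * X.Θ r
      = (r * (X.P r * X.W r)
      + X.P r * (r / 2 - X.U r + r * (1 / 2 - X.velDeriv p r))) * X.Θ r := by
    rw [← hPW]; ring
  rw [e, hdiv, Flow.energyDeriv]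
  generalize X.tempDeriv p Θ₀ r = T
  simp only [Flow.velDeriv, Params.D]
  field_simp
  ring

variable {z : ℝ → Fin 5 → ℝ} {δ : ℝ}

/-- Regularity up to the origin: in the rescaled unknowns the quotients in the derivative formulas
become continuous expressions on `[0, ∞)`. -/
theorem isProfile_toFlow (hm : IsMild p Θ₀ z) (h0 : z 0 = 0) (hbox : ∀ r, 0 ≤ r → InBox r (z r))
    (hB : ∀ τ, Bounded p Θ₀ δ τ (toFlow p Θ₀ z)) :
    IsProfile (p.n + 3) p.R p.μ p.lam p.CV p.κ (toFlow p Θ₀ z).P (toFlow p Θ₀ z).U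
      (toFlow p Θ₀ z).Θ ∧
    (∀ r, 0 ≤ r → derivWithin (toFlow p Θ₀ z).U (Ici 0) r = (toFlow p Θ₀ z).velDeriv p r) ∧
    (∀ r, 0 ≤ r → derivWithin (toFlow p Θ₀ z).Θ (Ici 0) r
      = (toFlow p Θ₀ z).tempDeriv p Θ₀ r) := by
  set X := toFlow p Θ₀ z with hX
  have hκ := p.κ_pos.ne'
  have hΛ := p.Λ_pos.ne'
  have hc : ∀ i, Continuous fun s => z s i := fun i => (continuous_apply i).comp hm.cont
  have hc0 := hc 0; have hc1 := hc 1; have hc2 := hc 2; have hc4 := hc 4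
  have hcw : Continuous fun s => p.cutField Θ₀ s (z s) 0 :=
    (continuous_apply 0).comp hm.cont_field
  have hin : ∀ {r : ℝ}, 0 < r → r ∈ Ioo 0 (r + 1) := fun hr => ⟨hr, by linarith⟩
  have hP : ∀ r, 0 < r → HasDerivAt X.P (X.densDeriv r) r :=
    fun r hr => (hB (r + 1)).deriv_P r (hin hr)
  have hU : ∀ r, 0 < r → HasDerivAt X.U (X.velDeriv p r) r :=
    fun r hr => (hB (r + 1)).deriv_U r (hin hr)
  have hΘ : ∀ r, 0 < r → HasDerivAt X.Θ (X.tempDeriv p Θ₀ r) r :=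
    fun r hr => (hB (r + 1)).deriv_Θ r (hin hr)
  have hXP : Continuous X.P := by simp only [hX, toFlow, Params.dens]; fun_prop
  have hXU : Continuous X.U := by simp only [hX, toFlow]; fun_prop
  have hXΘ : Continuous X.Θ := by simp only [hX, toFlow, Params.temp]; fun_prop
  have hUc : ContinuousOn (X.velDeriv p) (Ici 0) := by
    have h1 : Continuous fun s => s * (p.cutField Θ₀ s (z s) 0 - p.D * z s 0) := by fun_prop
    refine h1.continuousOn.congr fun r hr => ?_
    rcases (mem_Ici.1 hr).eq_or_lt with rfl | hr0
    -- At `r = 0` division by zero returns `0`, which agrees with the continuous extension.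
    · simp [hX, Flow.velDeriv, toFlow]
    · simp only [hX, Flow.velDeriv, toFlow]
      field_simp
  have hPc : ContinuousOn X.densDeriv (Ici 0) := by
    have hgap : ∀ r ∈ Ici (0 : ℝ), 1 / 2 - r * z r 0 ≠ 0 := fun r hr => by
      have := (abs_le.1 ((hbox r hr).abs_mul_le 0)).2
      linarith
    have h1 : ContinuousOn (fun s => X.P s * p.cutField Θ₀ s (z s) 0 / (1 / 2 - s * z s 0))
        (Ici 0) := by
      refine ContinuousOn.div (by fun_prop) (by fun_prop) hgap
    refine h1.congr fun r hr => ?_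
    rcases (mem_Ici.1 hr).eq_or_lt with rfl | hr0
    · simp [hX, Flow.densDeriv, toFlow, h0, p.cutField_zero]
    · have h2 := hgap r hr
      have h3 : r / 2 - r ^ 2 * z r 0 = r * (1 / 2 - r * z r 0) := by ring
      simp only [hX, Flow.densDeriv, toFlow, h3]
      field_simp
  have hΘc : ContinuousOn (X.tempDeriv p Θ₀) (Ici 0) := by
    have h1 : Continuous fun s => (s * z s 4 - p.CV * X.P s * (s * (1 / 2 - s * z s 0)) * X.Θ s)
        / p.κ - (p.n + 1) * (z s 2 / p.Λ) := by fun_prop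
    refine h1.continuousOn.congr fun r hr => ?_
    rcases (mem_Ici.1 hr).eq_or_lt with rfl | hr0
    · simp [hX, Flow.tempDeriv, toFlow, h0]
    · simp only [hX, Flow.tempDeriv, toFlow, Params.temp]
      field_simp
      ring
  have heq : ∀ r : ℝ, 0 < r → _ := fun r hr => (hB (r + 1)).equations (hin hr) (by
    have := ((hB (r + 1)).gap (r := r) ⟨hr.le, by linarith⟩).1
    linarith) hU hΘ
  refine ⟨⟨contDiffOn_one_Ici hXP.continuousOn hPc hP, contDiffOn_one_Ici hXU.continuousOn hUc hU,
    contDiffOn_one_Ici hXΘ.continuousOn hΘc hΘ, fun r hr => (heq r hr).1,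
    fun r hr => (heq r hr).2.1, fun r hr => (heq r hr).2.2.1, fun r hr => (heq r hr).2.2.2.1,
    fun r hr => (heq r hr).2.2.2.2⟩, fun r hr => ?_, fun r hr => ?_⟩
  · exact derivWithin_Ici_eq hXU.continuousOn hUc hU hr
  · exact derivWithin_Ici_eq hXΘ.continuousOn hΘc hΘ hr

theorem originCond_toFlow {C : ℝ} (hB : ∀ τ, Bounded p Θ₀ δ τ (toFlow p Θ₀ z))
    (hT : ∀ r, 0 < r → |(toFlow p Θ₀ z).tempDeriv p Θ₀ r| ≤ C * r) :
    OriginCond p.P₀ Θ₀ (toFlow p Θ₀ z).P (toFlow p Θ₀ z).U (toFlow p Θ₀ z).Θ := by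
  have hin : ∀ {r : ℝ}, 0 < r → r ∈ Ioo 0 (r + 1) := fun hr => ⟨hr, by linarith⟩
  have hin' : ∀ {r : ℝ}, 0 < r → r ∈ Icc 0 (r + 1) := fun hr => ⟨hr.le, by linarith⟩
  have hδ := (hB 0).δ_pos
  have hw : ∀ {r : ℝ} (j : ℕ), 0 < r → δ * (r ^ j / (1 + r) ^ 3) ≤ δ * r ^ j := fun {r} j hr => by
    gcongr
    exact div_le_self (by positivity) (one_le_pow₀ (by linarith))
  refine ⟨(hB 0).P_zero, (hB 0).Θ_zero, ?_, ?_, ?_⟩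
  · refine IsBigO.of_bound δ ?_
    filter_upwards [self_mem_nhdsWithin] with r hr
    rw [Real.norm_eq_abs, Real.norm_of_nonneg (by positivity)]
    exact ((hB (r + 1)).abs_U_le r (hin' hr)).trans (hw 2 hr)
  · refine IsBigO.of_bound (δ + p.D * δ) ?_
    filter_upwards [self_mem_nhdsWithin] with r hr
    have hr0 : 0 < r := hr
    rw [((hB (r + 1)).deriv_U r (hin hr)).deriv, Real.norm_eq_abs, Real.norm_of_nonneg hr0.le]
    have h1 := ((hB (r + 1)).abs_W_le r (hin' hr))
    have h2 := (hB (r + 1)).abs_U_div_le (hin' hr) hr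
    have h3 := hw 1 hr0
    rw [pow_one] at h3
    have hD := p.D_pos
    calc |(toFlow p Θ₀ z).velDeriv p r| ≤ _ := abs_sub _ _
      _ ≤ δ * r + p.D * (δ * r) := by
        rw [abs_mul, abs_of_pos hD]
        have := h2.trans h3
        have := h1.trans h3
        gcongr
      _ = _ := by ring
  · refine IsBigO.of_bound C ?_
    filter_upwards [self_mem_nhdsWithin] with r hr
    have hr0 : 0 < r := hr
    rw [((hB (r + 1)).deriv_Θ r (hin hr)).deriv, Real.norm_eq_abs, Real.norm_of_nonneg hr0.le]
    exact hT r hr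

end Profile

end SelfSimilarNS

/-! ### Uniqueness: behaviour of an arbitrary profile at the origin. -/

namespace SelfSimilarNS

/-- The flow belonging to a density, a velocity and a temperature profile. -/
noncomputable def flowOf (p : Params) (Θ₀ : ℝ) (Q V T : ℝ → ℝ) : Flow where
  P := Q
  U := V
  W r := deriv V r + p.D * (V r / r)
  Θ := T
  I r := p.a * (deriv V r + p.D * (V r / r)) - p.R * (Q r * T r - p.P₀ * Θ₀)
    + Q r * (r / 2 - V r) * V r
  J r := p.κ * (r * deriv T r + (p.n + 1) * (T r - Θ₀)) + p.CV * Q r * (r * (r / 2 - V r)) * T r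

section Derivatives

variable {p : Params} {Θ₀ : ℝ} {Q V T : ℝ → ℝ}

theorem hasDerivAt_of_contDiffOn {f : ℝ → ℝ} (hf : ContDiffOn ℝ 1 f (Ici 0)) {r : ℝ}
    (hr : 0 < r) : HasDerivAt f (deriv f r) r :=
  (((hf.differentiableOn one_ne_zero) r hr.le).differentiableAt (Ici_mem_nhds hr)).hasDerivAt

/-- The combinations `I` and `J` are such that the momentum equation, and `r` times the energy
equation, become exact derivatives up to terms without second derivatives. -/
theorem flowOf_derivs (h : IsProfile (p.n + 3) p.R p.μ p.lam p.CV p.κ Q V T) {r : ℝ}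
    (hr : 0 < r) :
    deriv Q r * (r / 2 - V r) = Q r * (flowOf p Θ₀ Q V T).W r ∧
    HasDerivAt (flowOf p Θ₀ Q V T).I ((flowOf p Θ₀ Q V T).momDeriv p r) r ∧
    HasDerivAt (flowOf p Θ₀ Q V T).J ((flowOf p Θ₀ Q V T).energyDeriv p r) r := by
  have hr0 := hr.ne'
  have hQ := hasDerivAt_of_contDiffOn h.contDiffOn_P hr
  have hV := hasDerivAt_of_contDiffOn h.contDiffOn_U hr
  have hT := hasDerivAt_of_contDiffOn h.contDiffOn_Θ hr
  have hV₂ := (h.differentiableAt_deriv_U r hr).hasDerivAt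
  have hT₂ := (h.differentiableAt_deriv_Θ r hr).hasDerivAt
  have hmass := (massEq_iff hQ hV).1 (h.mass r hr)
  have hmom := (momentumEq_iff hQ hV hT hV₂ hmass).1 (h.momentum r hr)
  have hen := (energyEq_iff hQ hV hT hV₂ hT₂ hmass hmom).1 (h.energy r hr)
  have hgap : HasDerivAt (fun s => s / 2 - V s) (1 / 2 - deriv V r) r :=
    ((hasDerivAt_id r).div_const 2).sub hV
  have hQg := hQ.fun_mul hgap
  refine ⟨hmass, ?_, ?_⟩
  · have h1 := (((hV₂.fun_add ((hV.fun_div (hasDerivAt_id r) hr0).const_mul p.D)).const_mul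
      p.a).fun_sub (((hQ.fun_mul hT).sub_const (p.P₀ * Θ₀)).const_mul p.R)).fun_add
        (hQg.fun_mul hV)
    refine h1.congr_deriv ?_
    simp only [id, flowOf, Flow.momDeriv]
    have e : (deriv V r * r - V r * 1) / r ^ 2 = deriv V r / r - V r / r ^ 2 := by
      field_simp
    rw [e]
    linear_combination hmom + V r * hmass
  · have h1 := ((((hasDerivAt_id r).fun_mul hT₂).fun_add
      ((hT.sub_const Θ₀).const_mul ((p.n : ℝ) + 1))).const_mul p.κ).fun_add
        (((hQ.const_mul p.CV).fun_mul ((hasDerivAt_id r).fun_mul hgap)).fun_mul hT)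
    refine h1.congr_deriv ?_
    simp only [id, flowOf, Flow.energyDeriv]
    have e : r * (deriv T r / r) = deriv T r := by field_simp
    have e' : r * (V r / r) = V r := by field_simp
    have hD : p.D = p.n + 2 := rfl
    rw [hD] at hmass hen ⊢
    linear_combination r * hen + p.CV * r * T r * hmass
      - p.κ * (p.n + 2) * e + p.CV * Q r * T r * (p.n + 2) * e'

end Derivatives

/-- The mean value comparison runs on `[s, r]` and `s → 0`, so nothing is needed at the origin
beyond the limit. -/
theorem abs_le_of_tendsto_zero {f f' : ℝ → ℝ} {C ρ : ℝ} {k : ℕ} (hC : 0 ≤ C)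
    (h0 : Tendsto f (𝓝[>] 0) (𝓝 0)) (hd : ∀ r ∈ Ioo 0 ρ, HasDerivAt f (f' r) r)
    (hle : ∀ r ∈ Ioo 0 ρ, |f' r| ≤ C * r ^ k) {r : ℝ} (hr : r ∈ Ioo 0 ρ) :
    |f r| ≤ C * r ^ (k + 1) := by
  have h1 : Tendsto (fun s => |f r - f s|) (𝓝[>] 0) (𝓝 |f r - 0|) := (h0.const_sub (f r)).abs
  rw [sub_zero] at h1
  refine le_of_tendsto h1 ?_
  filter_upwards [Ioo_mem_nhdsGT hr.1] with s hs
  have hin : ∀ x ∈ Icc s r, x ∈ Ioo 0 ρ := fun x hx => ⟨hs.1.trans_le hx.1, hx.2.trans_lt hr.2⟩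
  have h2 := abs_sub_le_of_abs_deriv_le (f := f) (f' := f')
    (φ := fun x => C / (k + 1) * x ^ (k + 1)) (φ' := fun x => C * x ^ k) (a := s) (b := r)
    (fun x hx => (hd x (hin x hx)).continuousAt.continuousWithinAt) (by fun_prop)
    (fun x hx => hd x (hin x ⟨hx.1.le, hx.2.le⟩)) (fun x _ => by
      refine ((hasDerivAt_pow (k + 1) x).const_mul (C / (k + 1))).congr_deriv ?_
      rw [Nat.add_sub_cancel]
      push_cast
      field_simp)
    (fun x hx => hle x (hin x ⟨hx.1.le, hx.2.le⟩)) (right_mem_Icc.2 hs.2.le)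
  have h3 : 0 ≤ C / (k + 1) * s ^ (k + 1) := by
    have := hs.1.le
    positivity
  have h4 : C / (k + 1) * r ^ (k + 1) ≤ C * r ^ (k + 1) := by
    have := hr.1.le
    gcongr
    exact div_le_self hC (by
      have : (0 : ℝ) ≤ k := by positivity
      linarith)
  linarith

theorem tendsto_div_pow_zero {f : ℝ → ℝ} {C : ℝ} {j : ℕ}
    (h : ∀ᶠ r in 𝓝[>] (0 : ℝ), |f r| ≤ C * r ^ (j + 1)) :
    Tendsto (fun r => f r / r ^ j) (𝓝[>] 0) (𝓝 0) := by
  have h0 : Tendsto (fun r : ℝ => C * r) (𝓝[>] 0) (𝓝 0) := by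
    have : Tendsto (fun r : ℝ => C * r) (𝓝 0) (𝓝 (C * 0)) := tendsto_id.const_mul C
    rw [mul_zero] at this
    exact this.mono_left nhdsWithin_le_nhds
  refine squeeze_zero_norm' ?_ h0
  filter_upwards [h, self_mem_nhdsWithin] with r hr hr0
  have hr0 : 0 < r := hr0
  rw [Real.norm_eq_abs, abs_div, abs_of_pos (by positivity : 0 < r ^ j),
    div_le_iff₀ (by positivity)]
  exact hr.trans (le_of_eq (by ring))

section Uniqueness

variable {p : Params} {Θ₀ : ℝ} {Q V T : ℝ → ℝ}

/-- The rescaled unknowns of a profile, away from the origin. -/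
noncomputable def hat (p : Params) (Θ₀ : ℝ) (Y : Flow) (r : ℝ) : Fin 5 → ℝ :=
  ![Y.U r / r ^ 2, (Y.P r / p.P₀ - 1) / r, p.Λ * (Y.Θ r - Θ₀) / r, Y.I r / r ^ 2, Y.J r / r ^ 2]

/-- The behaviour of a profile at the origin. -/
theorem tendsto_hat (h : IsProfile (p.n + 3) p.R p.μ p.lam p.CV p.κ Q V T)
    (h0 : OriginCond p.P₀ Θ₀ Q V T) (hΘ₀ : 0 ≤ Θ₀) (hsmall : 8 * p.R * p.P₀ * Θ₀ ≤ p.a) :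
    Tendsto (hat p Θ₀ (flowOf p Θ₀ Q V T)) (𝓝[>] 0) (𝓝 0) := by
  set Y := flowOf p Θ₀ Q V T with hY
  have hP₀ := p.P₀_pos; have hR := p.R_pos; have ha := p.a_pos; have hD := p.D_pos
  have hκ := p.κ_pos; have hCV := p.CV_pos
  have hid : Tendsto (fun r : ℝ => r) (𝓝[>] 0) (𝓝 0) := tendsto_id.mono_left nhdsWithin_le_nhds
  have hlimit : ∀ {f : ℝ → ℝ}, ContDiffOn ℝ 1 f (Ici 0) → Tendsto f (𝓝[>] 0) (𝓝 (f 0)) :=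
    fun {f} hf => (hf.continuousOn 0 self_mem_Ici).mono_left
      (nhdsWithin_mono _ Ioi_subset_Ici_self)
  have hQ0 : Tendsto Q (𝓝[>] 0) (𝓝 p.P₀) := h0.P_zero ▸ hlimit h.contDiffOn_P
  have hT0 : Tendsto T (𝓝[>] 0) (𝓝 Θ₀) := h0.Θ_zero ▸ hlimit h.contDiffOn_Θ
  have hV0 : Tendsto V (𝓝[>] 0) (𝓝 0) := h0.U_isBigO.trans_tendsto (by simpa using hid.pow 2)
  have hV10 : Tendsto (deriv V) (𝓝[>] 0) (𝓝 0) := h0.deriv_U_isBigO.trans_tendsto hid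
  have hT10 : Tendsto (deriv T) (𝓝[>] 0) (𝓝 0) := h0.deriv_Θ_isBigO.trans_tendsto hid
  have hVr0 : Tendsto (fun r => V r / r) (𝓝[>] 0) (𝓝 0) := by
    obtain ⟨c, hc⟩ := h0.U_isBigO.bound
    have := tendsto_div_pow_zero (f := V) (C := c) (j := 1) (by
      filter_upwards [hc] with r hr
      simpa using hr)
    simpa using this
  have hgap0 : Tendsto (fun r => r / 2 - V r) (𝓝[>] 0) (𝓝 0) := by
    simpa using (hid.div_const 2).sub hV0
  have hW0 : Tendsto Y.W (𝓝[>] 0) (𝓝 0) := by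
    have := hV10.add (hVr0.const_mul p.D)
    rw [mul_zero, add_zero] at this
    exact this
  have hI0 : Tendsto Y.I (𝓝[>] 0) (𝓝 0) := by
    have := ((hW0.const_mul p.a).sub (((hQ0.mul hT0).sub_const (p.P₀ * Θ₀)).const_mul p.R)).add
      ((hQ0.mul hgap0).mul hV0)
    simp only [mul_zero, sub_self, add_zero] at this
    exact this
  have hJ0 : Tendsto Y.J (𝓝[>] 0) (𝓝 0) := by
    have := (((hid.mul hT10).add ((hT0.sub_const Θ₀).const_mul ((p.n : ℝ) + 1))).const_mul
      p.κ).add (((hQ0.const_mul p.CV).mul (hid.mul hgap0)).mul hT0)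
    simp only [mul_zero, zero_mul, sub_self, add_zero] at this
    exact this
  have hderivs := fun r (hr : 0 < r) => flowOf_derivs (Θ₀ := Θ₀) h hr
  rw [← hY] at hderivs
  -- a common bound near the origin
  obtain ⟨M, ρ, hM, hρ, hb⟩ : ∃ M ρ : ℝ, 0 ≤ M ∧ 0 < ρ ∧ ∀ r ∈ Ioo 0 ρ, |V r| ≤ M * r ^ 2 ∧
      |deriv V r| ≤ M * r ∧ |deriv T r| ≤ M * r ∧ |Q r| ≤ M ∧ |T r| ≤ M := by
    obtain ⟨c₁, h₁⟩ := h0.U_isBigO.bound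
    obtain ⟨c₂, h₂⟩ := h0.deriv_U_isBigO.bound
    obtain ⟨c₃, h₃⟩ := h0.deriv_Θ_isBigO.bound
    have h₄ := hQ0.abs.eventually_le_const (lt_add_one |p.P₀|)
    have h₅ := hT0.abs.eventually_le_const (lt_add_one |Θ₀|)
    obtain ⟨ρ, hρ, hsub⟩ := mem_nhdsGT_iff_exists_Ioo_subset.1
      (h₁.and (h₂.and (h₃.and (h₄.and h₅))))
    refine ⟨|c₁| + |c₂| + |c₃| + (|p.P₀| + 1) + (|Θ₀| + 1), ρ, by positivity, hρ,
      fun r hr => ?_⟩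
    obtain ⟨e₁, e₂, e₃, e₄, e₅⟩ := hsub hr
    have hr0 := hr.1
    have a1 := le_abs_self c₁; have a2 := le_abs_self c₂; have a3 := le_abs_self c₃
    have b1 := abs_nonneg c₁; have b2 := abs_nonneg c₂; have b3 := abs_nonneg c₃
    have b4 := abs_nonneg p.P₀; have b5 := abs_nonneg Θ₀
    rw [Real.norm_eq_abs, Real.norm_of_nonneg (by positivity)] at e₁ e₂ e₃
    refine ⟨e₁.trans ?_, e₂.trans ?_, e₃.trans ?_, e₄.trans ?_, e₅.trans ?_⟩
    · gcongr; linarith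
    · gcongr; linarith
    · gcongr; linarith
    · linarith
    · linarith
  have hnear : ∀ᶠ r in 𝓝[>] (0 : ℝ), r ∈ Ioo 0 ρ := Ioo_mem_nhdsGT hρ
  have hVr : ∀ r ∈ Ioo 0 ρ, |V r / r| ≤ M * r := fun r hr => by
    have hr0 := hr.1
    rw [abs_div, abs_of_pos hr0, div_le_iff₀ hr0]
    exact (hb r hr).1.trans (le_of_eq (by ring))
  have hWb : ∀ r ∈ Ioo 0 ρ, |Y.W r| ≤ (1 + p.D) * M * r := fun r hr => by
    have h1 := hVr r hr
    have h2 := (hb r hr).2.1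
    calc |Y.W r| ≤ |deriv V r| + |p.D * (V r / r)| := abs_add_le _ _
      _ ≤ M * r + p.D * (M * r) := by
        rw [abs_mul, abs_of_pos hD]; gcongr
      _ = _ := by ring
  have hI2 : Tendsto (fun r => Y.I r / r ^ 2) (𝓝[>] 0) (𝓝 0) ∧
      Tendsto (fun r => Y.I r / r) (𝓝[>] 0) (𝓝 0) := by
    have h1 : ∀ᶠ r in 𝓝[>] (0 : ℝ), |Y.I r| ≤ p.D * M * M * M * ρ * r ^ (2 + 1) := by
      filter_upwards [hnear] with r hr
      refine abs_le_of_tendsto_zero (by positivity) hI0 (fun s hs => (hderivs s hs.1).2.1)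
        (fun s hs => ?_) hr
      obtain ⟨b1, -, -, b4, -⟩ := hb s hs
      have b6 := hVr s hs
      have hs0 := hs.1
      have hsρ := hs.2
      calc |Y.momDeriv p s| = p.D * |Q s| * |V s| * |V s / s| := by
            simp only [Flow.momDeriv, hY, flowOf, abs_mul, abs_of_pos hD]
        _ ≤ p.D * M * (M * s ^ 2) * (M * s) := by gcongr
        _ = p.D * M * M * M * s * s ^ 2 := by ring
        _ ≤ _ := by gcongr
    refine ⟨tendsto_div_pow_zero h1, ?_⟩
    have h2 : ∀ᶠ r in 𝓝[>] (0 : ℝ), |Y.I r| ≤ p.D * M * M * M * ρ * ρ * r ^ (1 + 1) := by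
      filter_upwards [h1, hnear] with r hr hr'
      refine hr.trans ?_
      have := hr'.1
      have := hr'.2
      calc _ = p.D * M * M * M * ρ * r * r ^ (1 + 1) := by ring
        _ ≤ _ := by gcongr
    simpa using tendsto_div_pow_zero h2
  have hJ2 : Tendsto (fun r => Y.J r / r ^ 2) (𝓝[>] 0) (𝓝 0) := by
    set c := p.CV * (p.n + 1) * M * M * M + p.R * M * M * ((1 + p.D) * M)
      + (2 * p.μ * (((1 + p.D) * M + p.D * M) ^ 2 + p.D * M ^ 2)
        + p.lam * ((1 + p.D) * M) ^ 2) * ρ with hc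
    have := p.μ_pos; have := p.lam_pos
    refine tendsto_div_pow_zero (C := c) ?_
    filter_upwards [hnear] with r hr
    refine abs_le_of_tendsto_zero (by positivity) hJ0 (fun s hs => (hderivs s hs.1).2.2)
      (fun s hs => ?_) hr
    obtain ⟨b1, -, -, b4, b5⟩ := hb s hs
    have b6 := hVr s hs
    have b7 := hWb s hs
    have hs0 := hs.1
    have hsρ := hs.2
    have e1 : |p.CV * (p.n + 1) * Q s * V s * T s| ≤ p.CV * (p.n + 1) * M * (M * s ^ 2) * M := by
      rw [abs_mul, abs_mul, abs_mul, abs_of_pos (by positivity : 0 < p.CV * ((p.n : ℝ) + 1))]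
      gcongr
    have e2 : |p.R * s * Q s * T s * Y.W s| ≤ p.R * s * M * M * ((1 + p.D) * M * s) := by
      rw [abs_mul, abs_mul, abs_mul, abs_of_pos (by positivity : 0 < p.R * s)]
      gcongr
    have e3 : |Y.W s - p.D * (V s / s)| ≤ ((1 + p.D) * M + p.D * M) * s := by
      refine (abs_sub _ _).trans ?_
      rw [abs_mul, abs_of_pos hD]
      calc _ ≤ (1 + p.D) * M * s + p.D * (M * s) := by gcongr
        _ = _ := by ring
    have e4 := sq_le_sq' (abs_le.1 e3).1 (abs_le.1 e3).2
    have e5 := sq_le_sq' (abs_le.1 b6).1 (abs_le.1 b6).2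
    have e6 := sq_le_sq' (abs_le.1 b7).1 (abs_le.1 b7).2
    have e7 : |s * (2 * p.μ * ((Y.W s - p.D * (V s / s)) ^ 2 + p.D * (V s / s) ^ 2)
        + p.lam * Y.W s ^ 2)| ≤ s * (2 * p.μ * ((((1 + p.D) * M + p.D * M) * s) ^ 2
        + p.D * (M * s) ^ 2) + p.lam * ((1 + p.D) * M * s) ^ 2) := by
      rw [abs_of_nonneg (by positivity)]
      gcongr
    calc |Y.energyDeriv p s| ≤ _ := (abs_sub _ _).trans (add_le_add_left (abs_add_le _ _) _)
      _ ≤ _ := add_le_add (add_le_add e1 e2) e7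
      _ = (p.CV * (p.n + 1) * M * M * M + p.R * M * M * ((1 + p.D) * M)
        + (2 * p.μ * (((1 + p.D) * M + p.D * M) ^ 2 + p.D * M ^ 2)
          + p.lam * ((1 + p.D) * M) ^ 2) * s) * s ^ 2 := by ring
      _ ≤ c * s ^ 2 := by rw [hc]; gcongr
  have hT2 : Tendsto (fun r => (T r - Θ₀) / r) (𝓝[>] 0) (𝓝 0) := by
    have : Tendsto (fun r => (T r - Θ₀) / r ^ 1) (𝓝[>] 0) (𝓝 0) := by
      refine tendsto_div_pow_zero (C := M) ?_
      filter_upwards [hnear] with r hr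
      exact abs_le_of_tendsto_zero (k := 1) hM (by simpa using hT0.sub_const Θ₀)
        (fun s hs => (hasDerivAt_of_contDiffOn h.contDiffOn_Θ hs.1).sub_const Θ₀)
        (fun s hs => by simpa using (hb s hs).2.2.1) hr
    simpa using this
  -- the slope of the density at the origin vanishes
  set q := derivWithin Q (Ici 0) 0 with hq
  have hu : UniqueDiffOn ℝ (Ici (0 : ℝ)) := uniqueDiffOn_Ici 0
  have hQ1 : Tendsto (deriv Q) (𝓝[>] 0) (𝓝 q) := by
    have h1 : ContinuousOn (derivWithin Q (Ici 0)) (Ici 0) :=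
      h.contDiffOn_P.continuousOn_derivWithin hu le_rfl
    have h2 : Tendsto (derivWithin Q (Ici 0)) (𝓝[>] 0) (𝓝 q) :=
      (h1 0 self_mem_Ici).mono_left (nhdsWithin_mono _ Ioi_subset_Ici_self)
    refine h2.congr' ?_
    filter_upwards [self_mem_nhdsWithin] with r hr
    exact derivWithin_of_mem_nhds (Ici_mem_nhds hr)
  have hQs : Tendsto (fun r => (Q r - p.P₀) / r) (𝓝[>] 0) (𝓝 q) := by
    have h1 : HasDerivWithinAt Q q (Ici 0) 0 :=
      (h.contDiffOn_P.differentiableOn one_ne_zero 0 self_mem_Ici).hasDerivWithinAt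
    have h2 := hasDerivWithinAt_iff_tendsto_slope.1 h1
    rw [Ici_sdiff_left] at h2
    refine h2.congr fun r => ?_
    rw [slope_def_field, h0.P_zero, sub_zero]
  -- Divide the algebraic law for `W` by `r`: only the slope `q` of the density survives.
  have hw : Tendsto (fun r => Y.W r / r) (𝓝[>] 0) (𝓝 (p.R * Θ₀ * q / p.a)) := by
    have h1 := ((((hT0.mul hQs).add (hT2.const_mul p.P₀)).const_mul p.R).sub
      ((hQ0.mul hgap0).mul hVr0)).add hI2.2
    have h2 := h1.div_const p.a
    have e : (p.R * (Θ₀ * q + p.P₀ * 0) - p.P₀ * 0 * 0 + 0) / p.a = p.R * Θ₀ * q / p.a := by ring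
    rw [e] at h2
    refine h2.congr' ?_
    filter_upwards [self_mem_nhdsWithin] with r hr
    have hr0 : r ≠ 0 := ne_of_gt hr
    have ha' := ha.ne'
    simp only [hY, flowOf]
    field_simp
    ring
  -- The mass equation divided by `r` becomes `q / 2 = P₀ R Θ₀ q / a` in the limit. Smallness of
  -- `Θ₀` excludes `a = 2 R P₀ Θ₀`, so `q = 0`.
  have hq0 : q = 0 := by
    have h1 : Tendsto (fun r => deriv Q r * (1 / 2 - V r / r)) (𝓝[>] 0) (𝓝 (q * (1 / 2 - 0))) :=
      hQ1.mul (hVr0.const_sub _)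
    have h2 : Tendsto (fun r => Q r * (Y.W r / r)) (𝓝[>] 0)
        (𝓝 (p.P₀ * (p.R * Θ₀ * q / p.a))) := hQ0.mul hw
    have h3 := tendsto_nhds_unique (h1.congr' (by
      filter_upwards [self_mem_nhdsWithin] with r hr
      have hr0 : r ≠ 0 := ne_of_gt hr
      have := (hderivs r hr).1
      calc deriv Q r * (1 / 2 - V r / r) = deriv Q r * (r / 2 - V r) / r := by field_simp
        _ = Q r * (Y.W r / r) := by rw [this, mul_div_assoc])) h2
    rw [sub_zero, mul_one_div, ← mul_div_assoc, div_eq_div_iff two_ne_zero ha.ne'] at h3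
    have h4 : q * (p.a - 2 * (p.R * p.P₀ * Θ₀)) = 0 := by linear_combination h3
    rcases mul_eq_zero.1 h4 with h5 | h5
    · exact h5
    · have : 0 ≤ p.R * p.P₀ * Θ₀ := by positivity
      linarith
  rw [hq0] at hQs hw
  -- The hypothesis gives only `O(r²)`. The improvement to `o(r²)` comes from integrating `(r^(n+2)
  -- V)' = r^(n+2) W` with `W = o(r)`.
  have hU2 : Tendsto (fun r => V r / r ^ 2) (𝓝[>] 0) (𝓝 0) := by
    rw [mul_zero, zero_div] at hw
    rw [Metric.tendsto_nhds]
    intro ε hε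
    have h1 := (hw.abs).eventually_le_const (by simpa using half_pos hε : |(0 : ℝ)| < ε / 2)
    obtain ⟨σ, hσ, hsub⟩ := mem_nhdsGT_iff_exists_Ioo_subset.1 h1
    filter_upwards [Ioo_mem_nhdsGT hσ] with r hr
    have hr0 := hr.1
    have h2 := abs_le_of_tendsto_zero (f := fun s => s ^ (p.n + 2) * V s)
      (f' := fun s => s ^ (p.n + 2) * Y.W s) (k := p.n + 3) (C := ε / 2) (by positivity)
      (by simpa using (hid.pow (p.n + 2)).mul hV0) (fun s hs => by
        have hs0 := hs.1.ne'
        refine ((hasDerivAt_pow (p.n + 2) s).mul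
          (hasDerivAt_of_contDiffOn h.contDiffOn_U hs.1)).congr_deriv ?_
        simp only [hY, flowOf, Params.D, show p.n + 2 - 1 = p.n + 1 by omega]
        push_cast
        field_simp
        ring) (fun s hs => by
        have hs0 := hs.1
        have h3 : |Y.W s / s| ≤ ε / 2 := hsub hs
        rw [abs_div, abs_of_pos hs0, div_le_iff₀ hs0] at h3
        rw [abs_mul, abs_of_pos (by positivity)]
        calc s ^ (p.n + 2) * |Y.W s| ≤ s ^ (p.n + 2) * (ε / 2 * s) := by gcongr
          _ = _ := by ring) hr
    rw [abs_mul, abs_of_pos (by positivity)] at h2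
    have h3 : |V r| ≤ ε / 2 * r ^ 2 :=
      le_of_mul_le_mul_left (h2.trans (le_of_eq (by ring))) (by positivity : 0 < r ^ (p.n + 2))
    rw [dist_zero_right, Real.norm_eq_abs, abs_div, abs_of_pos (by positivity : 0 < r ^ 2),
      div_lt_iff₀ (by positivity)]
    refine h3.trans_lt ?_
    gcongr
    linarith
  rw [tendsto_pi_nhds]
  intro i
  fin_cases i
  · exact hU2
  · have := hQs.div_const p.P₀
    rw [zero_div] at this
    refine this.congr fun r => ?_
    simp only [hat, hY, flowOf]
    simp
    field_simp
  · have := hT2.const_mul p.Λ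
    rw [mul_zero] at this
    refine this.congr fun r => ?_
    simp [hat, hY, flowOf, mul_div_assoc]
  · exact hI2.1
  · exact hJ2

end Uniqueness

end SelfSimilarNS

/-! ### Uniqueness: coincidence with the constructed solution. -/

namespace SelfSimilarNS

section Uniqueness

variable {p : Params} {Θ₀ : ℝ} {Q V T : ℝ → ℝ}

theorem hat_decode (p : Params) (Θ₀ : ℝ) (Y : Flow) {r : ℝ} (hr : r ≠ 0) :
    p.dens r (hat p Θ₀ Y r) = Y.P r ∧ p.temp Θ₀ r (hat p Θ₀ Y r) = Y.Θ r := by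
  have hP₀ := p.P₀_pos.ne'
  have hΛ := p.Λ_pos.ne'
  constructor
  · simp only [Params.dens, hat, Matrix.cons_val]
    field_simp
    ring
  · simp only [Params.temp, hat, Matrix.cons_val]
    field_simp
    ring

theorem divHat_hat {r : ℝ} (hr : r ≠ 0) :
    p.divHat Θ₀ r (hat p Θ₀ (flowOf p Θ₀ Q V T) r) = (flowOf p Θ₀ Q V T).W r / r := by
  have ha := p.a_pos.ne'
  have hP₀ := p.P₀_pos.ne'
  have hΛ := p.Λ_pos.ne'
  obtain ⟨h1, h2⟩ := hat_decode p Θ₀ (flowOf p Θ₀ Q V T) hr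
  rw [Params.divHat, h1, h2]
  simp only [hat, flowOf, Matrix.cons_val]
  field_simp
  ring

/-- Membership in the box serves only to keep `r/2 - V` away from zero, so that the mass equation
can be solved for the derivative of the density. -/
theorem hasDerivAt_hat (h : IsProfile (p.n + 3) p.R p.μ p.lam p.CV p.κ Q V T) {r : ℝ}
    (hr : 0 < r) (hbox : InBox r (hat p Θ₀ (flowOf p Θ₀ Q V T) r)) (i : Fin 5) :
    HasDerivAt (fun s => s ^ (p.expo i + 1) * hat p Θ₀ (flowOf p Θ₀ Q V T) s i)
      (r ^ p.expo i * p.field Θ₀ r (hat p Θ₀ (flowOf p Θ₀ Q V T) r) i) r := by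
  have hr0 := hr.ne'
  have hP₀ := p.P₀_pos.ne'
  have hΛ := p.Λ_pos.ne'
  have hκ := p.κ_pos.ne'
  obtain ⟨hmass, hI, hJ⟩ := flowOf_derivs (Θ₀ := Θ₀) h hr
  have hQ := hasDerivAt_of_contDiffOn h.contDiffOn_P hr
  have hV := hasDerivAt_of_contDiffOn h.contDiffOn_U hr
  have hT := hasDerivAt_of_contDiffOn h.contDiffOn_Θ hr
  have hdiv := divHat_hat (p := p) (Θ₀ := Θ₀) (Q := Q) (V := V) (T := T) hr0
  obtain ⟨hdens, htemp⟩ := hat_decode p Θ₀ (flowOf p Θ₀ Q V T) hr0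
  set Y := flowOf p Θ₀ Q V T with hY
  have hpos : ∀ᶠ s in 𝓝 r, s ≠ 0 := (lt_mem_nhds hr).mono fun s hs => ne_of_gt hs
  have hgap : r / 2 - V r ≠ 0 := by
    have h1 := (abs_le.1 (hbox.abs_mul_le 0)).2
    have h2 : r * hat p Θ₀ Y r 0 = V r / r := by
      simp only [hat, hY, flowOf, Matrix.cons_val]
      field_simp
    rw [h2, div_le_iff₀ hr] at h1
    linarith
  fin_cases i
  · have h1 := (hasDerivAt_pow (p.n + 2) r).mul hV
    refine (h1.congr_of_eventuallyEq ?_).congr_deriv ?_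
    · filter_upwards [hpos] with s hs
      simp only [Params.expo, hat, hY, flowOf, Fin.zero_eta, Matrix.cons_val_zero, Pi.mul_apply]
      field_simp
      ring
    · simp only [Params.expo, Params.field, Fin.zero_eta, Matrix.cons_val_zero, hdiv]
      simp only [hY, flowOf, Params.D, show p.n + 2 - 1 = p.n + 1 by omega]
      push_cast
      field_simp
      ring
  · have h1 := (hQ.div_const p.P₀).sub_const 1
    refine (h1.congr_of_eventuallyEq ?_).congr_deriv ?_
    · filter_upwards [hpos] with s hs
      simp [Params.expo, hat, hY, flowOf]
      field_simp
    · have e1 : deriv Q r = Q r * Y.W r / (r / 2 - V r) := by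
        rw [← hmass, mul_div_cancel_right₀ _ hgap]
      have e2 : (1 + r * hat p Θ₀ Y r 1) = Q r / p.P₀ := by
        have : p.P₀ * (1 + r * hat p Θ₀ Y r 1) = Q r := hdens
        rw [← this, mul_div_cancel_left₀ _ hP₀]
      have e3 : 1 / 2 - r * hat p Θ₀ Y r 0 = (r / 2 - V r) / r := by
        simp only [hat, hY, flowOf, Matrix.cons_val]
        field_simp
      simp only [Params.expo, Params.field, Fin.mk_one, Matrix.cons_val_one, Matrix.cons_val_zero,
        hdiv, e1, e2, e3, pow_zero, one_mul]
      field_simp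
  · have h1 := (hasDerivAt_pow (p.n + 1) r).mul ((hT.sub_const Θ₀).const_mul p.Λ)
    refine (h1.congr_of_eventuallyEq ?_).congr_deriv ?_
    · filter_upwards [hpos] with s hs
      simp [Params.expo, hat, hY, flowOf]
      field_simp
      ring
    · simp only [Params.expo, Params.field, Fin.reduceFinMk, Matrix.cons_val, hdens, htemp]
      simp only [hat, hY, flowOf, Matrix.cons_val, Nat.add_sub_cancel]
      push_cast
      field_simp
      ring
  · refine (hI.congr_of_eventuallyEq ?_).congr_deriv ?_
    · filter_upwards [hpos] with s hs
      simp [Params.expo, hat, hY, flowOf]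
      field_simp
    · simp only [Params.expo, Params.field, Fin.reduceFinMk, Matrix.cons_val, hdens]
      simp only [Flow.momDeriv, hat, Matrix.cons_val]
      field_simp
  · refine (hJ.congr_of_eventuallyEq ?_).congr_deriv ?_
    · filter_upwards [hpos] with s hs
      simp [Params.expo, hat, hY, flowOf]
      field_simp
    · simp only [Params.expo, Params.field, Fin.reduceFinMk, Matrix.cons_val, hdens, htemp, hdiv]
      simp only [Flow.energyDeriv, hat, Matrix.cons_val]
      field_simp

theorem continuousAt_hat (h : IsProfile (p.n + 3) p.R p.μ p.lam p.CV p.κ Q V T) {r : ℝ}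
    (hr : 0 < r) : ContinuousAt (hat p Θ₀ (flowOf p Θ₀ Q V T)) r := by
  have hr0 := hr.ne'
  obtain ⟨-, hI, hJ⟩ := flowOf_derivs (Θ₀ := Θ₀) h hr
  have hQ := (hasDerivAt_of_contDiffOn h.contDiffOn_P hr).continuousAt
  have hV := (hasDerivAt_of_contDiffOn h.contDiffOn_U hr).continuousAt
  have hT := (hasDerivAt_of_contDiffOn h.contDiffOn_Θ hr).continuousAt
  have hsq : ContinuousAt (fun s : ℝ => s ^ 2) r := by fun_prop
  have hsq0 : r ^ 2 ≠ 0 := pow_ne_zero 2 hr0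
  refine continuousAt_pi.2 fun i => ?_
  fin_cases i
  · exact hV.div hsq hsq0
  · exact ((hQ.div_const p.P₀).sub continuousAt_const).div continuousAt_id hr0
  · exact ((hT.sub continuousAt_const).const_mul p.Λ).div continuousAt_id hr0
  · exact hI.continuousAt.div hsq hsq0
  · exact hJ.continuousAt.div hsq hsq0

theorem eqOn_of_isProfile {z : ℝ → Fin 5 → ℝ} (hm : IsMild p Θ₀ z)
    (hzbox : ∀ r, 0 ≤ r → ‖z r‖ < boxWidth r) (hΘ₀ : 0 ≤ Θ₀)
    (hsmall : 8 * p.R * p.P₀ * Θ₀ ≤ p.a)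
    (h : IsProfile (p.n + 3) p.R p.μ p.lam p.CV p.κ Q V T) (h0 : OriginCond p.P₀ Θ₀ Q V T) :
    EqOn Q (toFlow p Θ₀ z).P (Ici 0) ∧ EqOn V (toFlow p Θ₀ z).U (Ici 0) ∧
      EqOn T (toFlow p Θ₀ z).Θ (Ici 0) := by
  set Y := flowOf p Θ₀ Q V T with hY
  let y : ℝ → Fin 5 → ℝ := fun r => if 0 < r then hat p Θ₀ Y r else 0
  have hypos : ∀ {r}, 0 < r → y r = hat p Θ₀ Y r := fun hr => if_pos hr
  have hy0 : y 0 = 0 := if_neg (lt_irrefl 0)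
  have hyc : ContinuousOn y (Ici 0) := by
    intro r hr
    rcases (mem_Ici.1 hr).eq_or_lt with rfl | hr0
    · rw [← continuousWithinAt_Ioi_iff_Ici, ContinuousWithinAt, hy0]
      refine (tendsto_hat h h0 hΘ₀ hsmall).congr' ?_
      filter_upwards [self_mem_nhdsWithin] with s hs
      exact (hypos hs).symm
    · refine ((continuousAt_hat (Θ₀ := Θ₀) h hr0).congr ?_).continuousWithinAt
      filter_upwards [lt_mem_nhds hr0] with s hs
      exact (hypos hs).symm
  obtain ⟨C, hC, m, hlip, -⟩ := p.exists_lipschitz_cutField hΘ₀ hsmall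
  have hcf := p.continuous_cutField Θ₀
  -- While the competitor is in the box the truncated field is the true one, so both curves solve
  -- the same averaged equation.
  have hloc : ∀ τ, 0 ≤ τ → (∀ s ∈ Icc 0 τ, ‖y s‖ ≤ boxWidth s) → EqOn y z (Icc 0 τ) := by
    intro τ hτ hbox
    have hyτ : ContinuousOn y (Icc 0 τ) := hyc.mono Icc_subset_Ici_self
    refine eqOn_of_eq_avg hcf hC hlip hτ hyτ hm.cont.continuousOn (fun r hr => ?_)
      (fun r hr => hm.eq_avg r hr.1)
    refine eq_avg_of_hasDerivAt hyτ (hcf.comp_continuousOn (continuousOn_id.prodMk hyτ))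
      (fun s hs i => ?_) hy0 (by simp [hy0, p.cutField_zero]) hr
    have hin : InBox s (y s) := fun i =>
      (norm_le_pi_norm (y s) i).trans (hbox s ⟨hs.1.le, hs.2.le⟩)
    change HasDerivAt (fun x => x ^ (p.expo i + 1) * y x i)
      (s ^ p.expo i * p.field Θ₀ s (clamp s (y s)) i) s
    rw [clamp_eq hin]
    rw [hypos hs.1] at hin ⊢
    refine (hasDerivAt_hat h hs.1 hin i).congr_of_eventuallyEq ?_
    filter_upwards [lt_mem_nhds hs.1] with x hx
    rw [hypos hx]
  have hfc : ContinuousOn (fun r => ‖y r‖ / boxWidth r) (Ici 0) :=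
    hyc.norm.div continuous_boxWidth.continuousOn fun r _ => (boxWidth_pos r).ne'
  -- Up to any `τ` reached inside the closed box, `y` equals `z`, which is strictly inside; hence
  -- `y` never leaves.
  have hall : ∀ r, 0 ≤ r → ‖y r‖ / boxWidth r < 1 := fun r hr =>
    lt_one_of_bootstrap hfc (by simp [hy0]) (fun τ hτ hle => by
      have := hloc τ hτ (fun s hs => (div_le_one (boxWidth_pos s)).1 (hle s hs))
      simp only [this ⟨hτ, le_rfl⟩]
      exact (div_lt_one (boxWidth_pos τ)).2 (hzbox τ hτ)) hr
  have hyz : ∀ r, 0 ≤ r → y r = z r := fun r hr =>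
    hloc r hr (fun s hs => ((div_lt_one (boxWidth_pos s)).1 (hall s hs.1)).le) ⟨hr, le_rfl⟩
  have hQ0 := h0.P_zero
  have hT0 := h0.Θ_zero
  have hV0 : V 0 = 0 := by
    have h1 : Tendsto V (𝓝[>] 0) (𝓝 (V 0)) :=
      (h.contDiffOn_U.continuousOn 0 self_mem_Ici).mono_left
        (nhdsWithin_mono _ Ioi_subset_Ici_self)
    have hid : Tendsto (fun r : ℝ => r ^ 2) (𝓝[>] 0) (𝓝 0) := by
      have : Tendsto (fun r : ℝ => r ^ 2) (𝓝 0) (𝓝 (0 ^ 2)) := (continuous_pow 2).tendsto 0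
      rw [zero_pow two_ne_zero] at this
      exact this.mono_left nhdsWithin_le_nhds
    exact tendsto_nhds_unique h1 (h0.U_isBigO.trans_tendsto hid)
  refine ⟨fun r hr => ?_, fun r hr => ?_, fun r hr => ?_⟩
  all_goals rcases (mem_Ici.1 hr).eq_or_lt with rfl | hr0
  · simp [toFlow, Params.dens, hQ0]
  · simp only [toFlow]
    rw [← hyz r hr0.le, hypos hr0, (hat_decode p Θ₀ Y hr0.ne').1]
    rfl
  · simp [toFlow, hV0]
  · simp only [toFlow]
    rw [← hyz r hr0.le, hypos hr0]
    simp only [hat, hY, flowOf, Matrix.cons_val]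
    field_simp
  · simp [toFlow, Params.temp, hT0]
  · simp only [toFlow]
    rw [← hyz r hr0.le, hypos hr0, (hat_decode p Θ₀ Y hr0.ne').2]
    rfl

end Uniqueness

end SelfSimilarNS

/-! ### The main theorem. -/

theorem theorem3p1 (d : ℕ) (hd : 3 ≤ d) (R μ lam CV κ P₀ : ℝ)
    (hR : 0 < R) (hμ : 0 < μ) (hlam : 0 < lam) (hCV : 0 < CV) (hκ : 0 < κ) (hP₀ : 0 < P₀) :
    ∃ ε > 0, ∃ C > 0, ∀ Θ₀ : ℝ, 0 < Θ₀ → Θ₀ < ε →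
      ∃ P U Θ : ℝ → ℝ,
        SelfSimilarNS.IsProfile d R μ lam CV κ P U Θ ∧
        SelfSimilarNS.OriginCond P₀ Θ₀ P U Θ ∧
        (∀ Q V T : ℝ → ℝ, SelfSimilarNS.IsProfile d R μ lam CV κ Q V T →
          SelfSimilarNS.OriginCond P₀ Θ₀ Q V T →
          EqOn Q P (Ici 0) ∧ EqOn V U (Ici 0) ∧ EqOn T Θ (Ici 0)) ∧
        (∀ r : ℝ, 0 ≤ r → |U r| ≤ C * (Θ₀ * r ^ 2 / (1 + r) ^ 3)) ∧
        (∀ r : ℝ, 0 ≤ r → |derivWithin U (Ici 0) r| ≤ C * (Θ₀ * r / (1 + r) ^ 3)) ∧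
        (∀ r : ℝ, 0 ≤ r → |Θ r| ≤ C * (Θ₀ / (1 + r) ^ 2)) ∧
        (∀ r : ℝ, 0 ≤ r → |derivWithin Θ (Ici 0) r| ≤ C * (Θ₀ * r / (1 + r) ^ 2)) ∧
        ∃ Pinf Uinf Θinf : ℝ, 0 < Pinf ∧ Uinf < 0 ∧ 0 < Θinf ∧
          (∀ r : ℝ, 1 ≤ r → |P r - Pinf| ≤ C / r ^ 2) ∧
          (∀ r : ℝ, 1 ≤ r → |U r - Uinf / r| ≤ C / r ^ 3) ∧
          (∀ r : ℝ, 1 ≤ r → |Θ r - Θinf / r ^ 2| ≤ C / r ^ 4) ∧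
          |Uinf - (-2 * R * Θ₀)| ≤ C * Θ₀ ^ 2 ∧
          |Θinf - 2 * ((d : ℝ) - 2) * κ / (CV * P₀) * Θ₀| ≤ C * Θ₀ ^ 2 := by
  obtain ⟨n, rfl⟩ : ∃ n, d = n + 3 := ⟨d - 3, by omega⟩
  open SelfSimilarNS in
  let p : Params := ⟨n, R, μ, lam, CV, κ, P₀, hR, hμ, hlam, hCV, hκ, hP₀⟩
  have hcast : (((n + 3 : ℕ) : ℝ) - 2) = n + 1 := by push_cast; ring
  rw [hcast]
  obtain ⟨K, hK, ε₀, hε₀, hex⟩ := SelfSimilarNS.exists_isMild_bounded p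
  obtain ⟨CA, hCA, hasym⟩ := SelfSimilarNS.exists_asymptotics p hK
  obtain ⟨CT, hCT, hT⟩ := SelfSimilarNS.Bounded.exists_abs_tempDeriv_le p
  have hD := p.D_pos
  set q := 2 * ((n : ℝ) + 1) * κ / (CV * P₀) with hq
  have hq0 : 0 < q := by positivity
  -- The last two thresholds keep the error `CA Θ₀²` below the leading terms `2 R Θ₀` and `q Θ₀`,
  -- which fixes the signs of the limits.
  refine ⟨min ε₀ (min (2 * R / CA) (q / CA)), by positivity, CA + CT + K * (1 + p.D),
    by positivity, fun Θ₀ hΘ₀ hlt => ?_⟩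
  have hlt₀ : Θ₀ < ε₀ := hlt.trans_le (min_le_left _ _)
  have hlt₁ : Θ₀ < 2 * R / CA := hlt.trans_le ((min_le_right _ _).trans (min_le_left _ _))
  have hlt₂ : Θ₀ < q / CA := hlt.trans_le ((min_le_right _ _).trans (min_le_right _ _))
  rw [lt_div_iff₀ hCA] at hlt₁ hlt₂
  obtain ⟨hsmall, z, hm, hz0, hzbox, hB⟩ := hex Θ₀ hΘ₀ hlt₀
  have hin : ∀ r, 0 ≤ r → SelfSimilarNS.InBox r (z r) := fun r hr i =>
    (norm_le_pi_norm (z r) i).trans (hzbox r hr).le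
  obtain ⟨hprof, hdU, hdΘ⟩ := SelfSimilarNS.isProfile_toFlow hm hz0 hin hB
  obtain ⟨Pinf, Uinf, Θinf, hPinf, hasP, hasU, hasΘ, hUinf, hΘinf⟩ := hasym hB
  set X := SelfSimilarNS.toFlow p Θ₀ z with hX
  have hmem : ∀ {r : ℝ}, 0 ≤ r → r ∈ Icc 0 r := fun hr => ⟨hr, le_rfl⟩
  have hKle : K ≤ CA + CT + K * (1 + p.D) := by
    have : 0 < K * p.D := by positivity
    linarith
  have hCAle : CA ≤ CA + CT + K * (1 + p.D) := by
    have : 0 < K * (1 + p.D) := by positivity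
    linarith
  have hCTle : CT ≤ CA + CT + K * (1 + p.D) := by
    have : 0 < K * (1 + p.D) := by positivity
    linarith
  have htemp : ∀ r, 0 ≤ r → |X.tempDeriv p Θ₀ r| ≤ CT * (Θ₀ * r / (1 + r) ^ 2) := by
    intro r hr
    rcases hr.eq_or_lt with rfl | hr0
    · simp [SelfSimilarNS.Flow.tempDeriv]
    · exact (hT (hB r) r (hmem hr) hr0).trans (le_of_eq (by ring))
  have hUneg : Uinf < 0 := by
    have h1 := (abs_le.1 hUinf).2
    have h2 : Θ₀ * CA * Θ₀ < 2 * R * Θ₀ := by gcongr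
    change Uinf - (-2 * R * Θ₀) ≤ CA * Θ₀ ^ 2 at h1
    linarith
  have hΘpos : 0 < Θinf := by
    have h1 := (abs_le.1 hΘinf).1
    have h2 : Θ₀ * CA * Θ₀ < q * Θ₀ := by gcongr
    change -(CA * Θ₀ ^ 2) ≤ Θinf - q * Θ₀ at h1
    linarith
  refine ⟨X.P, X.U, X.Θ, hprof, SelfSimilarNS.originCond_toFlow (C := CT * Θ₀) hB fun r hr => ?_,
    fun Q V T hQ hQ0 =>
      SelfSimilarNS.eqOn_of_isProfile hm hzbox hΘ₀.le hsmall hQ hQ0,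
    fun r hr => ?_, fun r hr => ?_, fun r hr => ?_, fun r hr => ?_,
    Pinf, Uinf, Θinf, hPinf, hUneg, hΘpos, fun r hr => ?_, fun r hr => ?_, fun r hr => ?_, ?_, ?_⟩
  · refine (htemp r hr.le).trans ?_
    calc CT * (Θ₀ * r / (1 + r) ^ 2) ≤ CT * (Θ₀ * r) := by
          gcongr
          exact div_le_self (by positivity) (one_le_pow₀ (by linarith))
      _ = _ := by ring
  · calc |X.U r| ≤ K * Θ₀ * (r ^ 2 / (1 + r) ^ 3) := (hB r).abs_U_le r (hmem hr)
      _ = K * (Θ₀ * r ^ 2 / (1 + r) ^ 3) := by ring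
      _ ≤ _ := by gcongr
  · rw [hdU r hr]
    have h1 := (hB r).abs_W_le r (hmem hr)
    have h2 : |X.U r / r| ≤ K * Θ₀ * (r / (1 + r) ^ 3) := by
      rcases hr.eq_or_lt with rfl | hr0
      · simp
      · exact (hB r).abs_U_div_le (hmem hr) hr0
    calc |X.velDeriv p r| ≤ |X.W r| + |p.D * (X.U r / r)| := abs_sub _ _
      _ ≤ K * Θ₀ * (r / (1 + r) ^ 3) + p.D * (K * Θ₀ * (r / (1 + r) ^ 3)) := by
        rw [abs_mul, abs_of_pos hD]
        gcongr
      _ = K * (1 + p.D) * (Θ₀ * r / (1 + r) ^ 3) := by ring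
      _ ≤ _ := by gcongr; linarith
  · calc |X.Θ r| ≤ K * Θ₀ * (1 / (1 + r) ^ 2) := (hB r).abs_Θ_le r (hmem hr)
      _ = K * (Θ₀ / (1 + r) ^ 2) := by ring
      _ ≤ _ := by gcongr
  · rw [hdΘ r hr]
    refine (htemp r hr).trans ?_
    gcongr
  · exact (hasP r hr).trans (by gcongr)
  · exact (hasU r hr).trans (by gcongr)
  · exact (hasΘ r hr).trans (by gcongr)
  · refine (show |Uinf - (-2 * R * Θ₀)| ≤ CA * Θ₀ ^ 2 from hUinf).trans ?_
    gcongr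
  · refine (show |Θinf - q * Θ₀| ≤ CA * Θ₀ ^ 2 from hΘinf).trans ?_
    gcongr
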